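/- **Setting.** Let $n,k\ge 0$ and $N=n+k$. Let $\mathcal R(\mathbb T)$ be the ring of rational functions in $\beta,t_1,\dots,t_N$ that are regular at $\beta=0$ and at $\beta=-1$ (quotients of integer polynomials whose denominator does not vanish identically at $\beta=0$ or at $\beta=-1$), and let $\mathcal R(\mathbb T,q)=\mathcal R(\mathbb T)[\![q]\!]$. Write $x\oplus y=x+y+\beta xy$, $x\ominus y=\frac{x-y}{1+\beta y}$, $\ominus x=0\ominus x$, $\Pi(x)=\prod_i(1+\beta x_i)$. A boxed partition $\lambda\subset(k^n)$ corresponds to the set $I_\lambda=\{\lambda_n+1,\lambda_{n-1}+2,\dots,\lambda_1+n\}\subset\{1,\dots,N\}$ and to the binary string $b(\lambda)$ with $1$-letters at the places in $I_\lambda$; put $t_\lambda=(t_{\lambda_n+1},\dots,t_{\lambda_1+n})$. Let $\lambda^*\subset(n^k)$ be the partition whose string is $b(\lambda)$ with $0$ and $1$ swapped (the conjugate of the complement of $\lambda$ in the box). The factorial Grothendieck polynomial is $$G_\lambda(x|t)=\sum_{T}\beta^{|T|-|\lambda|}\prod_{\langle i,j\rangle\in\lambda,\ r\in T(i,j)}x_r\oplus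 t_{r+j-i},$$ the sum over set-valued tableaux $T$ of shape $\lambda$ with entries in $\{1,\dots,n\}$ (in $\{1,\dots,k\}$ for $G_{\lambda^*}$). Let $V=\mathbb Zv_0\oplus\mathbb Zv_1$, $\sigma^-v_1=v_0$, $\sigma^-v_0=0$, $\sigma^+v_0=v_1$, $\sigma^+v_1=0$. On $\mathcal R(\mathbb T,q)\otimes V^{\otimes N}$ define $M(x)=L_N\cdots L_2L_1=\begin{pmatrix}A(x)&B(x)\\C(x)&D(x)\end{pmatrix}$, where $$L_j=\begin{pmatrix}\sigma_j^+\sigma_j^-+(x\ominus t_j)\,\sigma_j^-\sigma_j^+&(1+\beta\,(x\ominus t_j))\,\sigma_j^+\\ \sigma_j^-&\sigma_j^-\sigma_j^+\end{pmatrix}.$$ Let $|0\rangle=v_0\otimes\cdots\otimes v_0$, $|y\rangle=B(y_n)\cdots B(y_1)|0\rangle$ and $e(x,y)=\langle 0|C(x_1)\cdots C(x_n)B(y_n)\cdots B(y_1)|0\rangle$. Let $v_\lambda=v_{b_1}\otimes\cdots\otimes v_{b_N}$ with $b=b(\lambda)$ be the spin (Schubert) basis of the submodule $\mathcal V_n^q$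 spanned by the $v_b$ with exactly $n$ letters $1$. **Bethe roots.** For every $\alpha\subset(k^n)$ there is a unique $n$-tuple $y_\alpha=(y_1,\dots,y_n)$ of pairwise distinct elements of $\mathcal R(\mathbb T,q)$ with $y_\alpha|_{q=0}=t_\alpha$ and $$(-1)^n\frac{\Pi(y)}{(1+\beta y_i)^n}\prod_{j=1}^N(y_i\ominus t_j)+q=0\qquad(i=1,\dots,n),$$ and a unique $k$-tuple $y_{\alpha^*}$ of pairwise distinct elements with $y_{\alpha^*}|_{q=0}=t_{\alpha^*}$ such that $z=\ominus y_{\alpha^*}$ satisfies $$(-1)^k\frac{\Pi(z)}{(1+\beta z_i)^k}\prod_{j=1}^N(z_i\oplus t_j)+q=0\qquad(i=1,\dots,k).$$ **Residue formula.** All $e(y_\alpha,y_\alpha)$ are units, and the vectors $Y_\alpha=e(y_\alpha,y_\alpha)^{-1}|y_\alpha\rangle$ form a basis of $\mathcal V_n^q$. Let $\circledast$ be the bilinear product on $\mathcal V_n^q$ with $Y_\lambda\circledast Y_\mu=\delta_{\lambda\mu}Y_\mu$, let $(\cdot,\cdot)$ be the bilinear form with $(Y_\lambda,Y_\mu)=\delta_{\lambda\mu}\,e(y_\lambda,y_\lambda)^{-1}$,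 and let $\boldsymbol G_\lambda$ be the operator with $\boldsymbol G_\lambda Y_\mu=G_\lambda(y_\mu|\ominus t)Y_\mu$. Then for all $\lambda,\mu,\nu\subset(k^n)$ $$v_\lambda\circledast v_\mu=\boldsymbol G_\lambda v_\mu=\sum_{\nu\subset(k^n)}C_{\lambda\mu}^\nu(t,q)\,v_\nu,$$ where the structure constants $C_{\lambda\mu}^\nu(t,q)=\langle\nu|\boldsymbol G_\lambda|\mu\rangle$ are $$C_{\lambda\mu}^\nu(t,q)=\sum_{\alpha\subset(k^n)}\frac{\Pi(y_\alpha)}{\Pi(t_\nu)}\,\frac{G_\lambda(y_\alpha|\ominus t)\,G_\mu(y_\alpha|\ominus t)\,G_{\nu^*}(\ominus y_{\alpha^*}|t)}{e(y_\alpha,y_\alpha)},$$ and $$(v_\lambda,v_\mu)=\sum_{\alpha\subset(k^n)}\frac{G_\lambda(y_\alpha|\ominus t)\,G_\mu(y_\alpha|\ominus t)}{e(y_\alpha,y_\alpha)}.$$ -/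

import Mathlib

open scoped BigOperators

noncomputable section

namespace BetheSchubert

/-! ### The multiplicative formal group law -/

section FormalGroup

variable {A : Type*} [CommRing A]

/-- The quotient `a / b`; it is used for units `b` only. -/
def quo (a b : A) : A := a * Ring.inverse b

/-- `x ⊕ y = x + y + β x y`. -/
def oplus (β x y : A) : A := x + y + β * x * y

/-- `x ⊖ y = (x - y) / (1 + β y)`. -/
def ominus (β x y : A) : A := quo (x - y) (1 + β * y)

/-- `⊖ x = 0 ⊖ x`. -/
def oneg (β x : A) : A := ominus β 0 x

/-- `Π(x) = ∏ᵢ (1 + β xᵢ)`. -/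
def bigPi (β : A) {m : ℕ} (x : Fin m → A) : A := ∏ i, (1 + β * x i)

end FormalGroup

/-! ### Boxed partitions -/

/-- Partitions `l₁ ≥ ⋯ ≥ l_n` with at most `n` parts, each at most `k`. The part `l_{i+1}` is the
value at `i : Fin n`. -/
abbrev BoxedPartition (n k : ℕ) : Type := {l : Fin n → Fin (k + 1) // Antitone l}

instance (n k : ℕ) : Fintype (BoxedPartition n k) := Fintype.ofFinite _

namespace BoxedPartition

variable {n k : ℕ}

/-- The parts as natural numbers. -/
def part (l : BoxedPartition n k) (i : Fin n) : ℕ := (l.1 i : ℕ)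

/-- The number of boxes `|l|`. -/
def size (l : BoxedPartition n k) : ℕ := ∑ i, l.part i

/-- The elements `w(1) < ⋯ < w(n)` of `I_l ⊆ {1, …, n + k}`, where `w(i) = l_{n+1-i} + i`;
the argument is `i - 1`. -/
def pos (l : BoxedPartition n k) (i : Fin n) : ℕ := l.part (Fin.rev i) + (i : ℕ) + 1

/-- The complement `l^∨` of `l` in the bounding box: `l^∨_i = k - l_{n+1-i}`. -/
def dual (l : BoxedPartition n k) : BoxedPartition n k :=
  ⟨fun i => Fin.rev (l.1 (Fin.rev i)), fun _ _ h =>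
    Fin.rev_le_rev.2 (l.2 (Fin.rev_le_rev.2 h))⟩

/-- The conjugate partition: `l'_j` is the number of `i` with `l_i ≥ j`. -/
def conj (l : BoxedPartition n k) : BoxedPartition k n :=
  ⟨fun j => ⟨(Finset.univ.filter fun i : Fin n => (j : ℕ) < l.part i).card,
      Nat.lt_succ_of_le ((Finset.card_le_univ _).trans (Fintype.card_fin n).le)⟩,
    fun _ _ h => Fin.mk_le_mk.2 (Finset.card_le_card fun _ hi => by
      simp only [Finset.mem_filter, Finset.mem_univ, true_and] at hi ⊢
      exact lt_of_le_of_lt h hi)⟩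

/-- `l^* = (l^∨)'`, whose binary string is that of `l` with `0` and `1` swapped. -/
def star (l : BoxedPartition n k) : BoxedPartition k n := l.dual.conj

/-- The binary string of length `n + k` whose `1`-letters are at the places in `I_l`. -/
def bits (l : BoxedPartition n k) (j : Fin (n + k)) : Fin 2 :=
  open Classical in if ∃ i, l.pos i = (j : ℕ) + 1 then 1 else 0

theorem pos_strictMono (l : BoxedPartition n k) : StrictMono l.pos := by
  intro i j hij
  have h : l.part (Fin.rev i) ≤ l.part (Fin.rev j) := l.2 (Fin.rev_le_rev.2 hij.le)
  have h' : (i : ℕ) < j := hij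
  unfold pos
  omega

theorem pos_le (l : BoxedPartition n k) (i : Fin n) : l.pos i ≤ n + k := by
  have h : l.part (Fin.rev i) < k + 1 := (l.1 (Fin.rev i)).2
  have h' := i.2
  unfold pos
  omega

theorem bits_card (l : BoxedPartition n k) :
    (Finset.univ.filter fun j => l.bits j = 1).card = n := by
  classical
  let f : Fin n → Fin (n + k) := fun i =>
    ⟨l.pos i - 1, by have := l.pos_le i; have : 0 < l.pos i := Nat.succ_pos _; omega⟩
  have hf : Function.Injective f := by
    intro i j h
    have h1 : l.pos i - 1 = l.pos j - 1 := congrArg Fin.val h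
    have hi : 0 < l.pos i := Nat.succ_pos _
    have hj : 0 < l.pos j := Nat.succ_pos _
    exact l.pos_strictMono.injective (by omega)
  have : (Finset.univ.filter fun j => l.bits j = 1) = Finset.univ.image f := by
    ext j
    have key : l.bits j = 1 ↔ ∃ i, l.pos i = (j : ℕ) + 1 := by
      unfold bits
      split_ifs with hc <;> simp [hc]
    simp only [Finset.mem_filter, Finset.mem_univ, true_and, Finset.mem_image, key]
    constructor
    · rintro ⟨i, hi⟩
      exact ⟨i, Fin.ext (by simp [f, hi])⟩
    · rintro ⟨i, rfl⟩
      exact ⟨i, by have : 0 < l.pos i := Nat.succ_pos _; simp only [f]; omega⟩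
  rw [this, Finset.card_image_of_injective _ hf, Finset.card_univ, Fintype.card_fin]

end BoxedPartition

/-! ### Factorial Grothendieck polynomials -/

/-- Set-valued tableaux of shape `l` with entries in `[n]`. The box in row `i + 1` and column
`j + 1` carries the set `T i j`, which is nonempty exactly when the box belongs to `l`. Row
neighbours satisfy `max T(i,j) ≤ min T(i,j+1)` and column neighbours
`max T(i,j) < min T(i+1,j)`. -/
def IsSetValuedTableau {n k : ℕ} (l : BoxedPartition n k)
    (T : Fin n → Fin k → Finset (Fin n)) : Prop :=
  (∀ (i : Fin n) (j : Fin k), (T i j).Nonempty ↔ (j : ℕ) < l.part i) ∧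
  (∀ (i : Fin n) (j j' : Fin k), (j' : ℕ) = j + 1 → ∀ a ∈ T i j, ∀ b ∈ T i j', a ≤ b) ∧
  (∀ (i i' : Fin n) (j : Fin k), (i' : ℕ) = i + 1 → ∀ a ∈ T i j, ∀ b ∈ T i' j, a < b)

section Polynomials

variable {A : Type*} [CommRing A]

/-- The factorial Grothendieck polynomial
`G_l(x|t) = ∑_T β^{|T|-|l|} ∏_{(i,j) ∈ l, r ∈ T(i,j)} x_r ⊕ t_{r+j-i}`, the sum over all set-valued
tableaux of shape `l`; rows, columns and entries are numbered from `1` in this formula. -/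
def grothendieck (β : A) {n k : ℕ} (l : BoxedPartition n k) (x : Fin n → A) (t : ℤ → A) : A :=
  open Classical in
  ∑ T ∈ Finset.univ.filter (fun T : Fin n → Fin k → Finset (Fin n) => IsSetValuedTableau l T),
    β ^ ((∑ i, ∑ j, (T i j).card) - l.size) *
      ∏ i, ∏ j, ∏ r ∈ T i j,
        oplus β (x r) (t (((r : ℕ) + 1 : ℤ) + ((j : ℕ) + 1 : ℤ) - ((i : ℕ) + 1 : ℤ)))

/-- `t_l = (t_{l_n + 1}, …, t_{l_1 + n})`. -/
def specialize (t : ℤ → A) {n k : ℕ} (l : BoxedPartition n k) (i : Fin n) : A := t (l.pos i)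

end Polynomials

/-! ### The quantum space and the Yang-Baxter algebra -/

section YangBaxter

variable {A : Type*} [CommRing A]

/-- The quantum space `A ⊗ V^{⊗ N}` with `V = ℤ v₀ ⊕ ℤ v₁`, in coordinates with respect to the
basis `v_{b₁} ⊗ ⋯ ⊗ v_{b_N}` indexed by binary strings. -/
abbrev QuantumSpace (N : ℕ) (A : Type*) : Type _ := (Fin N → Fin 2) → A

/-- The basis vector `v_{b₁} ⊗ ⋯ ⊗ v_{b_N}`. -/
def tensorVec {N : ℕ} (b : Fin N → Fin 2) : QuantumSpace N A := Pi.single b 1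

/-- The operator `σ⁻` at site `j`: `v₁ ↦ v₀`, `v₀ ↦ 0`. -/
def sigmaMinus {N : ℕ} (j : Fin N) : Module.End A (QuantumSpace N A) where
  toFun f b := if b j = 0 then f (Function.update b j 1) else 0
  map_add' f g := by ext b; by_cases h : b j = 0 <;> simp [h]
  map_smul' c f := by ext b; by_cases h : b j = 0 <;> simp [h]

/-- The operator `σ⁺` at site `j`: `v₀ ↦ v₁`, `v₁ ↦ 0`. -/
def sigmaPlus {N : ℕ} (j : Fin N) : Module.End A (QuantumSpace N A) where
  toFun f b := if b j = 1 then f (Function.update b j 0) else 0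
  map_add' f g := by ext b; by_cases h : b j = 1 <;> simp [h]
  map_smul' c f := by ext b; by_cases h : b j = 1 <;> simp [h]

/-- The `L`-operator with spectral parameter `x` at site `j` with inhomogeneity `s`, as a
`2 × 2` matrix over the auxiliary space. -/
def lOperator (β : A) {N : ℕ} (x s : A) (j : Fin N) :
    Matrix (Fin 2) (Fin 2) (Module.End A (QuantumSpace N A)) :=
  !![sigmaPlus j * sigmaMinus j + ominus β x s • (sigmaMinus j * sigmaPlus j),
      (1 + β * ominus β x s) • sigmaPlus j;
    sigmaMinus j, sigmaMinus j * sigmaPlus j]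

/-- The row monodromy matrix `M(x|t) = L_N ⋯ L_2 L_1`. -/
def monodromy (β : A) (N : ℕ) (t : ℤ → A) (x : A) :
    Matrix (Fin 2) (Fin 2) (Module.End A (QuantumSpace N A)) :=
  (List.ofFn fun j : Fin N => lOperator β x (t ((j : ℕ) + 1)) j).reverse.prod

/-- The entry `B(x|t)` of the monodromy matrix `(A B; C D)`. -/
def opB (β : A) (N : ℕ) (t : ℤ → A) (x : A) : Module.End A (QuantumSpace N A) :=
  monodromy β N t x 0 1

/-- The entry `C(x|t)` of the monodromy matrix `(A B; C D)`. -/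
def opC (β : A) (N : ℕ) (t : ℤ → A) (x : A) : Module.End A (QuantumSpace N A) :=
  monodromy β N t x 1 0

/-- The Bethe vector `|y₁, …, y_n⟩ = B(y_n) ⋯ B(y₁) |0⟩` with `|0⟩ = v₀ ⊗ ⋯ ⊗ v₀`. -/
def betheVector (β : A) (N : ℕ) (t : ℤ → A) {n : ℕ} (y : Fin n → A) : QuantumSpace N A :=
  (List.ofFn fun i => opB β N t (y i)).reverse.prod (tensorVec fun _ => 0)

/-- The matrix element `e(x,y) = ⟨0| C(x₁) ⋯ C(x_n) B(y_n) ⋯ B(y₁) |0⟩`. -/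
def normElement (β : A) (N : ℕ) (t : ℤ → A) {n : ℕ} (x y : Fin n → A) : A :=
  ((List.ofFn fun i => opC β N t (x i)).prod (betheVector β N t y)) fun _ => 0

/-- The weight space spanned by the `v_b` with `b` having exactly `n` letters `1`. -/
def weightSpace (A : Type*) [CommRing A] (N n : ℕ) : Submodule A (QuantumSpace N A) :=
  Submodule.span A {v | ∃ b : Fin N → Fin 2,
    (Finset.univ.filter fun j => b j = 1).card = n ∧ v = tensorVec b}

/-- The spin basis vector `v_l`, an element of the weight space. -/
def spinVec (A : Type*) [CommRing A] {n k : ℕ} (l : BoxedPartition n k) :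
    weightSpace A (n + k) n :=
  ⟨tensorVec l.bits, Submodule.subset_span ⟨l.bits, l.bits_card, rfl⟩⟩

end YangBaxter

/-! ### Structures defined by a basis -/

section FromBasis

variable {ι A M : Type*} [CommRing A] [AddCommGroup M] [Module A M]

/-- The bilinear product for which the basis `Y` consists of orthogonal idempotents:
`Y_i ⊛ Y_j = δ_{ij} Y_j`. -/
def idempotentProduct [DecidableEq ι] (Y : Module.Basis ι A M) : M →ₗ[A] M →ₗ[A] M :=
  Y.constr A fun i => Y.constr A fun j => if i = j then Y j else 0

/-- The bilinear form with `(Y_i, Y_j) = c_i δ_{ij}`. -/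
def diagonalForm [DecidableEq ι] (Y : Module.Basis ι A M) (c : ι → A) : M →ₗ[A] M →ₗ[A] A :=
  Y.constr A fun i => Y.constr A fun j => if i = j then c i else 0

/-- The operator with eigenbasis `Y` and eigenvalues `g`: `Y_i ↦ g_i Y_i`. -/
def diagonalOperator (Y : Module.Basis ι A M) (g : ι → A) : M →ₗ[A] M :=
  Y.constr A fun i => g i • Y i

end FromBasis

/-! ### The coefficient ring and the Bethe roots -/

/-- Substitution of the integer `c` for `β` in `ℤ[β, t₁, …, t_N]`. The variable `none` is `β` and
`some j` is `t_{j+1}`. -/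
def substBeta (N : ℕ) (c : ℤ) :
    MvPolynomial (Option (Fin N)) ℤ →ₐ[ℤ] MvPolynomial (Fin N) ℤ :=
  MvPolynomial.aeval fun o => o.elim (MvPolynomial.C c) MvPolynomial.X

/-- The polynomials in `β, t₁, …, t_N` that vanish neither identically at `β = 0` nor identically
at `β = -1`. -/
def denominators (N : ℕ) : Submonoid (MvPolynomial (Option (Fin N)) ℤ) :=
  (nonZeroDivisors (MvPolynomial (Fin N) ℤ)).comap (substBeta N 0) ⊓
    (nonZeroDivisors (MvPolynomial (Fin N) ℤ)).comap (substBeta N (-1))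

/-- The ring of rational functions in `β, t₁, …, t_N` that are regular at `β = 0` and
`β = -1`. -/
def RT (N : ℕ) : Type := Localization (denominators N)

instance (N : ℕ) : CommRing (RT N) := inferInstanceAs (CommRing (Localization (denominators N)))

instance (N : ℕ) : Algebra (MvPolynomial (Option (Fin N)) ℤ) (RT N) :=
  inferInstanceAs (Algebra (MvPolynomial (Option (Fin N)) ℤ) (Localization (denominators N)))

instance (N : ℕ) : IsLocalization (denominators N) (RT N) :=
  inferInstanceAs (IsLocalization (denominators N) (Localization (denominators N)))

/-- The coefficient ring: formal power series in `q` over `RT N`. -/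
abbrev RTq (N : ℕ) : Type := PowerSeries (RT N)

/-- The parameter `β`. -/
def beta (N : ℕ) : RTq N :=
  PowerSeries.C (algebraMap (MvPolynomial (Option (Fin N)) ℤ) (RT N) (MvPolynomial.X none))

/-- The equivariant parameters `t_j`, with `t_j = 0` unless `1 ≤ j ≤ N`. -/
def tParam (N : ℕ) (j : ℤ) : RTq N :=
  if h : 1 ≤ j ∧ j ≤ N then
    PowerSeries.C (algebraMap (MvPolynomial (Option (Fin N)) ℤ) (RT N)
      (MvPolynomial.X (some ⟨(j - 1).toNat, by omega⟩)))
  else 0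

/-- The sequence `⊖ t`. -/
def negT (N : ℕ) (j : ℤ) : RTq N := oneg (beta N) (tParam N j)

/-- `y` is the Bethe root `y_α`: it consists of pairwise distinct solutions of
`(-1)^n Π(y) / (1 + β y_i)^n ∏_{j=1}^N (y_i ⊖ t_j) + q = 0` for all `i`, with constant term `t_α`
at `q = 0`. Here `N = n + k`. -/
def IsBetheRoot {n k : ℕ} (α : BoxedPartition n k) (y : Fin n → RTq (n + k)) : Prop :=
  Function.Injective y ∧
  (∀ i, (-1) ^ n * quo (bigPi (beta (n + k)) y) ((1 + beta (n + k) * y i) ^ n) *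
      ∏ j : Fin (n + k), ominus (beta (n + k)) (y i) (tParam (n + k) ((j : ℕ) + 1))
      + PowerSeries.X = 0) ∧
  ∀ i, PowerSeries.constantCoeff (y i) =
    PowerSeries.constantCoeff (specialize (tParam (n + k)) α i)

/-- `w` is the complementary Bethe root `y_{α^*}`: the `k`-tuple `z = ⊖ w` consists of pairwise
distinct solutions of `(-1)^k Π(z) / (1 + β z_i)^k ∏_{j=1}^N (z_i ⊕ t_j) + q = 0` for all `i`, and
`w` has constant term `t_{α^*}` at `q = 0`. Here `N = n + k`. -/
def IsComplementaryRoot {n k : ℕ} (α : BoxedPartition n k) (w : Fin k → RTq (n + k)) : Prop :=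
  Function.Injective w ∧
  (∀ i, (-1) ^ k * quo (bigPi (beta (n + k)) fun l => oneg (beta (n + k)) (w l))
        ((1 + beta (n + k) * oneg (beta (n + k)) (w i)) ^ k) *
      ∏ j : Fin (n + k), oplus (beta (n + k)) (oneg (beta (n + k)) (w i))
        (tParam (n + k) ((j : ℕ) + 1))
      + PowerSeries.X = 0) ∧
  ∀ i, PowerSeries.constantCoeff (w i) =
    PowerSeries.constantCoeff (specialize (tParam (n + k)) α.star i)

/-- The quantity `e(y,y)` for the parameters `t`. -/
def betheNorm {n : ℕ} (N : ℕ) (y : Fin n → RTq N) : RTq N :=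
  normElement (beta N) N (tParam N) y y

/-- `G_l(y|⊖t)`. -/
def schubertValue {n k : ℕ} (l : BoxedPartition n k) (y : Fin n → RTq (n + k)) : RTq (n + k) :=
  grothendieck (beta (n + k)) l y (negT (n + k))

/-- `G_{l^*}(⊖w|t)`. -/
def dualSchubertValue {n k : ℕ} (l : BoxedPartition n k) (w : Fin k → RTq (n + k)) :
    RTq (n + k) :=
  grothendieck (beta (n + k)) l.star (fun i => oneg (beta (n + k)) (w i)) (tParam (n + k))

/-- The weight space `𝒱_n^q` over the coefficient ring, where `N = n + k`. -/
abbrev Vq (n k : ℕ) : Type := weightSpace (RTq (n + k)) (n + k) n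

/-- The spin (Schubert) basis vector `v_l` of `𝒱_n^q`. -/
def schubertVec {n k : ℕ} (l : BoxedPartition n k) : Vq n k := spinVec (RTq (n + k)) l

/-- The matrix element `⟨ν| O |μ⟩` of an operator on `𝒱_n^q` in the spin basis. -/
def spinElement {n k : ℕ} (O : Vq n k →ₗ[RTq (n + k)] Vq n k) (ν μ : BoxedPartition n k) :
    RTq (n + k) :=
  (O (schubertVec μ) : QuantumSpace (n + k) (RTq (n + k))) ν.bits

/-- The operator `𝐆_l` on `𝒱_n^q` with `𝐆_l Y_α = G_l(y_α|⊖t) Y_α`. -/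
def schubertOperator {n k : ℕ} (Y : Module.Basis (BoxedPartition n k) (RTq (n + k)) (Vq n k))
    (y : BoxedPartition n k → Fin n → RTq (n + k)) (l : BoxedPartition n k) :
    Vq n k →ₗ[RTq (n + k)] Vq n k :=
  diagonalOperator Y fun α => schubertValue l (y α)

end BetheSchubert

end

open BetheSchubert

/-! Write `a_λ(y)` for the coefficient of the vacuum in `C(y_1) ⋯ C(y_n) v_λ` (`amplitude`) and
`c_λ(y)` for the coefficient of `v_λ` in `|y⟩` (`creation`), so that `e(x, y) = ∑_λ a_λ(x) c_λ(y)`.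
The theorem follows from three facts about these coefficients.

(1) For distinct arguments, `a_λ(y) = G_λ(y|⊖t)`. Multiplied by the Vandermonde product, both sides
become the determinant with rows `(1 + β y)^{n-i} ∏_{l<p_i} (y ⊕ s_l)`, where `p_i` are the places
of the letters `1` and `s = ⊖t`. On the lattice side (`vandermondeProd_mul_amplitude`) this comes
from a closed form for the monodromy matrix acting on products of row functions; on the tableau side
(`vandermondeProd_mul_grothendieck`) from the branching rule that removes the largest letter.
Splitting off the last variable produces the same row reduction, `det_rowMatrix_succ`, in both
cases.

(2) On shell, `∑_λ a_λ(y_α) c_λ(y_α')` vanishes for `α ≠ α'` and is a unit for `α = α'`. Row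
operations on the determinants show that `⟨0|C(y_1) ⋯ C(y_n)` is a left eigenvector of `A(x) + q
D(x)` (`sum_transfer_mul_amplitude`); transposing the `L`-operators and reversing the chain turns
this into the statement for `|y⟩`. Specializing `x` to a suitable `t_j` separates the eigenvalues of
two different Bethe roots. At `q = 0` both coefficient matrices are triangular, in opposite
directions, so only `λ = α` contributes to the norm (`isUnit_betheNorm`). Hence `(a_λ(y_α))` and
`(c_λ(y_α) / e(y_α, y_α))` are inverse matrices: the `Y_α` form a basis, `v_λ = ∑_α G_λ(y_α|⊖t)
Y_α`, and the product, the form and the operators are computed coordinatewise.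

(3) `c_ν(y_α) = Π(y_α) / Π(t_ν) · G_{ν*}(⊖y_{α*}|t)`. By reversal the left side is an `n × n`
determinant in `y_α`, while the right side is a `k × k` determinant in `y_{α*}`. Together the two
tuples are the `N` roots of a single equation `∏_j (u - t_j) = κ (1 + β u)^n`
(`exists_common_constant`). Lagrange interpolation at these roots inverts the matrix of all row
functions (`sum_residues`), and Jacobi's theorem on complementary minors (`det_complementary`)
identifies the two determinants.

Existence and uniqueness of the roots is a Hensel-type argument: once denominators are cleared, both
systems deform the simple roots `t_j` of `∏_j (u - t_j)`, and the fixed point iteration contracts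
`q`-adically. -/

namespace BetheSchubert

/-! ### Matrix elements of the monodromy matrix. -/

section Transfer

variable {A : Type*} [CommRing A]

/-- The matrix element of an `L`-operator between the states `b` and `b'` of one site, a matrix
over the auxiliary space. -/
def localWeight (β X : A) (b' b : Fin 2) : Matrix (Fin 2) (Fin 2) A :=
  if b' = 0 then (if b = 0 then !![X, 0; 0, 1] else !![0, 0; 1, 0])
  else (if b = 0 then !![0, 1 + β * X; 0, 0] else !![1, 0; 0, 0])

/-- The matrix element of the monodromy matrix between the strings `b` and `b'`, where `X j` is the
weight of an empty site. -/
def transfer (β : A) : {N : ℕ} → (X : Fin N → A) → (b' b : Fin N → Fin 2) →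
    Matrix (Fin 2) (Fin 2) A
  | 0, _, _, _ => 1
  | _ + 1, X, b', b =>
    transfer β (Fin.tail X) (Fin.tail b') (Fin.tail b) * localWeight β (X 0) (b' 0) (b 0)

theorem lOperator_apply (β : A) {N : ℕ} (x s : A) (j : Fin N) (c a : Fin 2)
    (f : QuantumSpace N A) (b : Fin N → Fin 2) :
    lOperator β x s j c a f b =
      ∑ v, localWeight β (ominus β x s) (b j) v c a * f (Function.update b j v) := by
  have key : ∀ w : Fin 2, w = 0 ∨ w = 1 := by decide
  have h0 : ∀ w : Fin 2, b j = w → Function.update b j w = b := by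
    rintro w rfl; simp
  rcases key c with rfl | rfl <;> rcases key a with rfl | rfl <;> rcases key (b j) with h | h <;>
    simp [lOperator, sigmaPlus, sigmaMinus, localWeight, h, h0 _ h]

/-- The restriction of a vector to the strings with first letter `v`. -/
def slice {N : ℕ} (v : Fin 2) (f : QuantumSpace (N + 1) A) : QuantumSpace N A :=
  fun b => f (Fin.cons v b)

/-- Operators at later sites do not see the first letter, so an induction on the length of the chain
can strip it off. -/
theorem slice_lOperator (β : A) {N : ℕ} (x s : A) (j : Fin N) (c a v : Fin 2)
    (f : QuantumSpace (N + 1) A) :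
    slice v (lOperator β x s j.succ c a f) = lOperator β x s j c a (slice v f) := by
  funext b
  simp only [slice, lOperator_apply, Fin.cons_succ, Fin.cons_update]

theorem slice_prod (β : A) {N : ℕ} (x : A) (s : Fin N → A) (v : Fin 2) (js : List (Fin N))
    (c a : Fin 2) (f : QuantumSpace (N + 1) A) :
    slice v ((js.map fun j => lOperator β x (s j) j.succ).reverse.prod c a f) =
      (js.map fun j => lOperator β x (s j) j).reverse.prod c a (slice v f) := by
  induction js generalizing c a f with
  | nil =>
    by_cases h : c = a <;> simp [h]
    rfl
  | cons j js ih =>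
    have hs : ∀ g h : QuantumSpace (N + 1) A, slice v (g + h) = slice v g + slice v h :=
      fun _ _ => rfl
    simp only [List.map_cons, List.reverse_cons, List.prod_append, List.prod_cons, List.prod_nil,
      mul_one, Matrix.mul_apply, Fin.sum_univ_two, LinearMap.add_apply, Module.End.mul_apply, hs,
      ih, slice_lOperator]

theorem sum_cons {M : Type*} [AddCommMonoid M] {N : ℕ} (F : (Fin (N + 1) → Fin 2) → M) :
    ∑ b, F b = ∑ v, ∑ b, F (Fin.cons v b) := by
  rw [← (Fin.consEquiv fun _ : Fin (N + 1) => Fin 2).sum_comp, Fintype.sum_prod_type]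
  rfl

theorem prod_lOperator_apply (β : A) {N : ℕ} (x : A) (s : Fin N → A) (c a : Fin 2)
    (f : QuantumSpace N A) (b' : Fin N → Fin 2) :
    (List.ofFn fun j => lOperator β x (s j) j).reverse.prod c a f b' =
      ∑ b, transfer β (fun j => ominus β x (s j)) b' b c a * f b := by
  induction N generalizing c a with
  | zero =>
    have : ∀ b : Fin 0 → Fin 2, f b = f b' := fun b => congrArg f (Subsingleton.elim _ _)
    by_cases h : c = a <;> simp [transfer, Matrix.one_apply, h, this]
  | succ N ih =>
    obtain ⟨v, b', rfl⟩ : ∃ v b'', b' = Fin.cons v b'' :=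
      ⟨b' 0, Fin.tail b', (Fin.cons_self_tail b').symm⟩
    have h1 : (List.ofFn fun j : Fin N => lOperator β x (s j.succ) j.succ) =
        (List.finRange N).map fun j => lOperator β x (s j.succ) j.succ := List.ofFn_eq_map
    have h2 : (List.ofFn fun j : Fin N => lOperator β x (s j.succ) j) =
        (List.finRange N).map fun j => lOperator β x (s j.succ) j := List.ofFn_eq_map
    have h3 : ∀ (e : Fin 2) (g : QuantumSpace (N + 1) A),
        (List.ofFn fun j : Fin N => lOperator β x (s j.succ) j.succ).reverse.prod c e g
          (Fin.cons v b') =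
        ∑ b, transfer β (fun j : Fin N => ominus β x (s j.succ)) b' b c e * g (Fin.cons v b) := by
      intro e g
      have := congrFun (slice_prod β x (fun j => s j.succ) v (List.finRange N) c e g) b'
      rw [← h1, ← h2, ih] at this
      exact this
    rw [List.ofFn_succ, List.reverse_cons, List.prod_append, List.prod_cons, List.prod_nil,
      mul_one, Matrix.mul_apply, LinearMap.sum_apply, Finset.sum_apply]
    simp only [Module.End.mul_apply, h3, lOperator_apply, Fin.cons_zero, Fin.update_cons_zero]
    rw [sum_cons]
    simp only [transfer, Fin.cons_zero, Fin.tail_cons, Matrix.mul_apply, Finset.sum_mul,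
      Finset.mul_sum]
    rw [Finset.sum_comm]
    simp only [Fin.sum_univ_two, ← Finset.sum_add_distrib]
    refine Finset.sum_congr rfl fun b _ => ?_
    simp only [Fin.tail_def]
    ring

theorem monodromy_apply (β : A) (N : ℕ) (t : ℤ → A) (x : A) (c a : Fin 2)
    (f : QuantumSpace N A) (b' : Fin N → Fin 2) :
    monodromy β N t x c a f b' =
      ∑ b, transfer β (fun j : Fin N => ominus β x (t ((j : ℕ) + 1))) b' b c a * f b :=
  prod_lOperator_apply β x (fun j : Fin N => t ((j : ℕ) + 1)) c a f b'

end Transfer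

/-! ### Closed form of the monodromy matrix on products of row functions. -/

section ClosedForm

variable {A : Type*} [CommRing A]

/-- The product of the values `f_i(y_i)` of a list of functions at a list of arguments of the same
length; it is zero when the lengths differ. -/
def evalProd : List (A → A) → List A → A
  | [], [] => 1
  | f :: fs, y :: ys => f y * evalProd fs ys
  | _, _ => 0

/-- The product `∏ y ⊕ s` over the entries `y` of a list. -/
def oplusProd (β s : A) (ys : List A) : A := (ys.map fun y => oplus β y s).prod

/-- Multiplication of functions by `y ↦ y ⊕ s`. -/
def scaleFns (β s : A) (fs : List (A → A)) : List (A → A) := fs.map fun f y => oplus β y s * f y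

theorem evalProd_scaleFns (β s : A) (fs : List (A → A)) (ys : List A) :
    evalProd (scaleFns β s fs) ys = oplusProd β s ys * evalProd fs ys := by
  induction fs generalizing ys with
  | nil => cases ys <;> simp [evalProd, scaleFns, oplusProd]
  | cons f fs ih =>
    cases ys with
    | nil => simp [evalProd, scaleFns]
    | cons y ys =>
      have := ih ys
      simp only [scaleFns, oplusProd, List.map_cons, evalProd, List.prod_cons] at this ⊢
      rw [this]; ring

/-- The functions `y ↦ ∏_{j < p} (y ⊕ s_j)`, where `p` runs through the places of the letter `1`. -/
def rowFns (β : A) : {N : ℕ} → (s : Fin N → A) → (b : Fin N → Fin 2) → List (A → A)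
  | 0, _, _ => []
  | _ + 1, s, b =>
    if b 0 = 1 then (fun _ => 1) :: scaleFns β (s 0) (rowFns β (Fin.tail s) (Fin.tail b))
    else scaleFns β (s 0) (rowFns β (Fin.tail s) (Fin.tail b))

/-- The product of `v ⊕ s_j` over the places before the first letter `1`. -/
def leadProd (β v : A) : {N : ℕ} → (s : Fin N → A) → (b : Fin N → Fin 2) → A
  | 0, _, _ => 1
  | _ + 1, s, b => if b 0 = 1 then 1 else oplus β v (s 0) * leadProd β v (Fin.tail s) (Fin.tail b)

/-- The functions `y ↦ (1 + β x) ∏_{j < p'} (y ⊕ s_j) - (1 + β y) ∏_{j < p} (y ⊕ s_j)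
∏_{p ≤ j < p'} (x ⊕ s_j)`, where `p` runs through the places of the letter `1` and `p'` is the next
such place. -/
def gapFns (β x : A) : {N : ℕ} → (s : Fin N → A) → (b : Fin N → Fin 2) → List (A → A)
  | 0, _, _ => []
  | _ + 1, s, b =>
    if b 0 = 1 then
      (fun y => (1 + β * x) * (oplus β y (s 0) * leadProd β y (Fin.tail s) (Fin.tail b)) -
        (1 + β * y) * (oplus β x (s 0) * leadProd β x (Fin.tail s) (Fin.tail b))) ::
          scaleFns β (s 0) (gapFns β x (Fin.tail s) (Fin.tail b))
    else scaleFns β (s 0) (gapFns β x (Fin.tail s) (Fin.tail b))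

/-- The action of a monodromy matrix element on the functional `b ↦ ∏ᵢ fᵢ(yᵢ)`, where the `fᵢ` are
the row functions of `b`. -/
def monodromySum (β x : A) {N : ℕ} (s : Fin N → A) (c a : Fin 2) (ys : List A)
    (b : Fin N → Fin 2) : A :=
  ∑ b', transfer β (fun j => oplus β x (s j)) b' b c a * evalProd (rowFns β s b') ys

theorem monodromySum_cons_nil (β x : A) {N : ℕ} (s : Fin (N + 1) → A) (c a b₀ : Fin 2)
    (b : Fin N → Fin 2) :
    monodromySum β x s c a [] (Fin.cons b₀ b) =
      ∑ e, localWeight β (oplus β x (s 0)) 0 b₀ e a * monodromySum β x (Fin.tail s) c e [] b := by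
  have h1 : ∀ b' : Fin N → Fin 2, evalProd (rowFns β s (Fin.cons 1 b')) [] = 0 := by
    intro b'; simp [rowFns, evalProd]
  have h0 : ∀ b' : Fin N → Fin 2, evalProd (rowFns β s (Fin.cons 0 b')) [] =
      evalProd (rowFns β (Fin.tail s) b') [] := by
    intro b'; simp [rowFns, evalProd_scaleFns, oplusProd]
  simp only [monodromySum, sum_cons, Fin.sum_univ_two, h1, h0, mul_zero, Finset.sum_const_zero,
    add_zero, transfer, Fin.cons_zero, Fin.tail_cons, Matrix.mul_apply, Finset.mul_sum,
    ← Finset.sum_add_distrib]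
  refine Finset.sum_congr rfl fun b' _ => ?_
  simp only [Fin.tail_def]
  ring

theorem monodromySum_cons_cons (β x : A) {N : ℕ} (s : Fin (N + 1) → A) (c a b₀ : Fin 2)
    (y : A) (ys : List A) (b : Fin N → Fin 2) :
    monodromySum β x s c a (y :: ys) (Fin.cons b₀ b) =
      ∑ e, (localWeight β (oplus β x (s 0)) 0 b₀ e a * oplusProd β (s 0) (y :: ys) *
          monodromySum β x (Fin.tail s) c e (y :: ys) b +
        localWeight β (oplus β x (s 0)) 1 b₀ e a * oplusProd β (s 0) ys *
          monodromySum β x (Fin.tail s) c e ys b) := by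
  have h1 : ∀ b' : Fin N → Fin 2, evalProd (rowFns β s (Fin.cons 1 b')) (y :: ys) =
      oplusProd β (s 0) ys * evalProd (rowFns β (Fin.tail s) b') ys := by
    intro b'; simp [rowFns, evalProd, evalProd_scaleFns]
  have h0 : ∀ b' : Fin N → Fin 2, evalProd (rowFns β s (Fin.cons 0 b')) (y :: ys) =
      oplusProd β (s 0) (y :: ys) * evalProd (rowFns β (Fin.tail s) b') (y :: ys) := by
    intro b'; simp [rowFns, evalProd_scaleFns]
  simp only [monodromySum, sum_cons, Fin.sum_univ_two, h1, h0, transfer, Fin.cons_zero,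
    Fin.tail_cons, Matrix.mul_apply, Finset.mul_sum, ← Finset.sum_add_distrib]
  refine Finset.sum_congr rfl fun b' _ => ?_
  simp only [Fin.tail_def]
  ring

/-- The product of the differences `y - x`. -/
def diffProd (x : A) (ys : List A) : A := (ys.map fun y => y - x).prod

theorem leadProd_cons_one (β v : A) {N : ℕ} (s : Fin (N + 1) → A) (b : Fin N → Fin 2) :
    leadProd β v s (Fin.cons 1 b) = 1 := by simp [leadProd]

theorem leadProd_cons_zero (β v : A) {N : ℕ} (s : Fin (N + 1) → A) (b : Fin N → Fin 2) :
    leadProd β v s (Fin.cons 0 b) = oplus β v (s 0) * leadProd β v (Fin.tail s) b := by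
  simp [leadProd]

theorem gapFns_cons_one (β x : A) {N : ℕ} (s : Fin (N + 1) → A) (b : Fin N → Fin 2) :
    gapFns β x s (Fin.cons 1 b) =
      (fun y => (1 + β * x) * (oplus β y (s 0) * leadProd β y (Fin.tail s) b) -
        (1 + β * y) * (oplus β x (s 0) * leadProd β x (Fin.tail s) b)) ::
          scaleFns β (s 0) (gapFns β x (Fin.tail s) b) := by
  simp [gapFns]

theorem gapFns_cons_zero (β x : A) {N : ℕ} (s : Fin (N + 1) → A) (b : Fin N → Fin 2) :
    gapFns β x s (Fin.cons 0 b) = scaleFns β (s 0) (gapFns β x (Fin.tail s) b) := by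
  simp [gapFns]

theorem exists_cons {N : ℕ} (b : Fin (N + 1) → Fin 2) :
    (∃ b', b = Fin.cons 0 b') ∨ ∃ b', b = Fin.cons 1 b' := by
  have key : ∀ w : Fin 2, w = 0 ∨ w = 1 := by decide
  rcases key (b 0) with h | h
  · exact Or.inl ⟨Fin.tail b, by rw [← h, Fin.cons_self_tail]⟩
  · exact Or.inr ⟨Fin.tail b, by rw [← h, Fin.cons_self_tail]⟩

theorem monodromySum_zero_one_nil (β x : A) {N : ℕ} (s : Fin N → A) (b : Fin N → Fin 2) :
    monodromySum β x s 0 1 [] b = 0 := by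
  induction N with
  | zero => simp [monodromySum, transfer]
  | succ N ih =>
    rcases exists_cons b with ⟨b, rfl⟩ | ⟨b, rfl⟩ <;>
      simp [monodromySum_cons_nil, localWeight, ih]

/-- The two entries are proved together because the first site couples the auxiliary states: a
letter `0` can feed the second from the first, and a letter `1` the first from both. Clearing the
differences `y - x` keeps the identity free of denominators. -/
theorem monodromySum_zero (β x : A) {N : ℕ} (s : Fin N → A) (b : Fin N → Fin 2) :
    (∀ ys, diffProd x ys * monodromySum β x s 0 0 ys b =
      leadProd β x s b * evalProd (gapFns β x s b) ys) ∧
    ∀ y ys, diffProd x (y :: ys) * monodromySum β x s 0 1 (y :: ys) b =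
      (1 + β * x) * (leadProd β y s b - leadProd β x s b) * evalProd (gapFns β x s b) ys := by
  induction N with
  | zero =>
    constructor
    · rintro (_ | ⟨y, ys⟩) <;> simp [monodromySum, transfer, rowFns, evalProd, diffProd, leadProd,
        gapFns]
    · intro y ys
      simp [monodromySum, transfer, leadProd]
  | succ N ih =>
    rcases exists_cons b with ⟨b, rfl⟩ | ⟨b, rfl⟩ <;> obtain ⟨ih0, ih1⟩ := ih (Fin.tail s) b
    · constructor
      · rintro (_ | ⟨y, ys⟩)
        · have := ih0 []
          simp only [diffProd, List.map_nil, List.prod_nil, one_mul] at this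
          simp [monodromySum_cons_nil, localWeight, leadProd_cons_zero, gapFns_cons_zero,
            evalProd_scaleFns, oplusProd, diffProd, this, mul_assoc]
        · have := ih0 (y :: ys)
          simp only [monodromySum_cons_cons, localWeight, leadProd_cons_zero, gapFns_cons_zero,
            evalProd_scaleFns, Fin.sum_univ_two]
          simp
          linear_combination oplus β x (s 0) * oplusProd β (s 0) (y :: ys) * this
      · intro y ys
        have h0 := ih0 ys
        have h1 := ih1 y ys
        simp only [monodromySum_cons_cons, localWeight, leadProd_cons_zero, gapFns_cons_zero,
          evalProd_scaleFns, Fin.sum_univ_two]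
        simp
        simp only [oplusProd, diffProd, List.map_cons, List.prod_cons, oplus] at h0 h1 ⊢
        -- The output may keep the first letter or create a `1` there. The two contributions combine
        -- through `1 + β (x ⊕ s) = (1 + β x)(1 + β s)` and `(1 + β s)(y - x) = y ⊕ s - x ⊕ s`.
        linear_combination (y + s 0 + β * y * s 0) *
            (List.map (fun y => y + s 0 + β * y * s 0) ys).prod * h1 +
          (1 + β * x) * (1 + β * s 0) * (y - x) *
            (List.map (fun y => y + s 0 + β * y * s 0) ys).prod * h0
    · constructor
      · rintro (_ | ⟨y, ys⟩)
        · simp [monodromySum_cons_nil, localWeight, gapFns_cons_one, monodromySum_zero_one_nil,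
            evalProd]
        · have h0 := ih0 ys
          have h1 := ih1 y ys
          simp only [monodromySum_cons_cons, localWeight, leadProd_cons_one, gapFns_cons_one,
            evalProd_scaleFns, Fin.sum_univ_two, evalProd]
          simp
          simp only [oplusProd, diffProd, List.map_cons, List.prod_cons, oplus] at h0 h1 ⊢
          linear_combination (y + s 0 + β * y * s 0) *
            (List.map (fun y => y + s 0 + β * y * s 0) ys).prod * h1 +
            (y - x) * (List.map (fun y => y + s 0 + β * y * s 0) ys).prod * h0
      · intro y ys
        simp [monodromySum_cons_cons, localWeight, leadProd_cons_one]

theorem scaleFns_eq_nil (β s : A) (fs : List (A → A)) : scaleFns β s fs = [] ↔ fs = [] := by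
  simp [scaleFns]

theorem dropLast_scaleFns (β s : A) (fs : List (A → A)) :
    (scaleFns β s fs).dropLast = scaleFns β s fs.dropLast := by
  simp [scaleFns, List.map_dropLast]

theorem monodromySum_one_one_nil (β x : A) {N : ℕ} (s : Fin N → A) (b : Fin N → Fin 2) :
    (gapFns β x s b = [] → monodromySum β x s 1 1 [] b = 1) ∧
    (gapFns β x s b ≠ [] → monodromySum β x s 1 1 [] b = 0) := by
  induction N with
  | zero => simp [monodromySum, transfer, gapFns, rowFns, evalProd]
  | succ N ih =>
    rcases exists_cons b with ⟨b, rfl⟩ | ⟨b, rfl⟩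
    · simpa [monodromySum_cons_nil, localWeight, gapFns_cons_zero, scaleFns_eq_nil] using
        ih (Fin.tail s) b
    · simp [monodromySum_cons_nil, localWeight, gapFns_cons_one]

/-- The string has no letter `1`, so `C` cannot lower it and `D` returns only the string itself,
which pairs to zero with a nonempty list of arguments. -/
theorem monodromySum_one_of_nil (β x : A) {N : ℕ} (s : Fin N → A) (b : Fin N → Fin 2)
    (hb : gapFns β x s b = []) :
    (∀ ys, monodromySum β x s 1 0 ys b = 0) ∧ ∀ y ys, monodromySum β x s 1 1 (y :: ys) b = 0 := by
  induction N with
  | zero => simp [monodromySum, transfer, rowFns, evalProd]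
  | succ N ih =>
    rcases exists_cons b with ⟨b, rfl⟩ | ⟨b, rfl⟩
    · rw [gapFns_cons_zero, scaleFns_eq_nil] at hb
      obtain ⟨h0, h1⟩ := ih (Fin.tail s) b hb
      constructor
      · rintro (_ | ⟨y, ys⟩)
        · simp [monodromySum_cons_nil, localWeight, h0]
        · simp [monodromySum_cons_cons, localWeight, h0]
      · intro y ys
        simp [monodromySum_cons_cons, localWeight, h0, h1]
    · simp [gapFns_cons_one] at hb

/-- The recursion is that of the row `c = 0`; only the boundary condition at the far end of the
chain changes. Leaving in auxiliary state `1` forbids a letter in the gap after the last `1`, so the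
last gap function is dropped. -/
theorem monodromySum_one (β x : A) {N : ℕ} (s : Fin N → A) (b : Fin N → Fin 2)
    (hb : gapFns β x s b ≠ []) :
    (∀ ys, diffProd x ys * monodromySum β x s 1 0 ys b =
      leadProd β x s b * evalProd (gapFns β x s b).dropLast ys) ∧
    ∀ y ys, diffProd x (y :: ys) * monodromySum β x s 1 1 (y :: ys) b =
      (1 + β * x) * (leadProd β y s b - leadProd β x s b) *
        evalProd (gapFns β x s b).dropLast ys := by
  induction N with
  | zero => simp [gapFns] at hb
  | succ N ih =>
    rcases exists_cons b with ⟨b, rfl⟩ | ⟨b, rfl⟩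
    · rw [gapFns_cons_zero, Ne, scaleFns_eq_nil] at hb
      obtain ⟨ih0, ih1⟩ := ih (Fin.tail s) b hb
      constructor
      · rintro (_ | ⟨y, ys⟩)
        · have := ih0 []
          simp only [diffProd, List.map_nil, List.prod_nil, one_mul] at this
          simp [monodromySum_cons_nil, localWeight, leadProd_cons_zero, gapFns_cons_zero,
            evalProd_scaleFns, dropLast_scaleFns, oplusProd, diffProd, this, mul_assoc]
        · have := ih0 (y :: ys)
          simp only [monodromySum_cons_cons, localWeight, leadProd_cons_zero, gapFns_cons_zero,
            evalProd_scaleFns, dropLast_scaleFns, Fin.sum_univ_two]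
          simp
          linear_combination oplus β x (s 0) * oplusProd β (s 0) (y :: ys) * this
      · intro y ys
        have h0 := ih0 ys
        have h1 := ih1 y ys
        simp only [monodromySum_cons_cons, localWeight, leadProd_cons_zero, gapFns_cons_zero,
          evalProd_scaleFns, dropLast_scaleFns, Fin.sum_univ_two]
        simp
        simp only [oplusProd, diffProd, List.map_cons, List.prod_cons, oplus] at h0 h1 ⊢
        linear_combination (y + s 0 + β * y * s 0) *
            (List.map (fun y => y + s 0 + β * y * s 0) ys).prod * h1 +
          (1 + β * x) * (1 + β * s 0) * (y - x) *
            (List.map (fun y => y + s 0 + β * y * s 0) ys).prod * h0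
    · constructor
      -- If the first letter is the only `1`, its gap is the dropped one, and what remains is `D` on
      -- a string of zeros with no arguments, which is `1`.
      · by_cases hb' : gapFns β x (Fin.tail s) b = []
        · obtain ⟨h0, h1⟩ := monodromySum_one_of_nil β x (Fin.tail s) b hb'
          have h2 := (monodromySum_one_one_nil β x (Fin.tail s) b).1 hb'
          rintro (_ | ⟨y, ys⟩)
          · simp [monodromySum_cons_nil, localWeight, gapFns_cons_one, h2, diffProd,
              leadProd_cons_one, hb', scaleFns, evalProd]
          · simp [monodromySum_cons_cons, localWeight, gapFns_cons_one, h0, h1,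
              leadProd_cons_one, hb', scaleFns, evalProd]
        · obtain ⟨ih0, ih1⟩ := ih (Fin.tail s) b hb'
          have hd : ∀ g : A → A,
              (g :: scaleFns β (s 0) (gapFns β x (Fin.tail s) b)).dropLast =
                g :: scaleFns β (s 0) (gapFns β x (Fin.tail s) b).dropLast := by
            intro g
            rw [List.dropLast_cons_of_ne_nil (by rwa [Ne, scaleFns_eq_nil]), dropLast_scaleFns]
          rintro (_ | ⟨y, ys⟩)
          · simp [monodromySum_cons_nil, localWeight, gapFns_cons_one, hd, evalProd,
              (monodromySum_one_one_nil β x (Fin.tail s) b).2 hb']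
          · have h0 := ih0 ys
            have h1 := ih1 y ys
            simp only [monodromySum_cons_cons, localWeight, leadProd_cons_one, gapFns_cons_one,
              evalProd_scaleFns, hd, Fin.sum_univ_two, evalProd]
            simp
            simp only [oplusProd, diffProd, List.map_cons, List.prod_cons, oplus] at h0 h1 ⊢
            linear_combination (y + s 0 + β * y * s 0) *
              (List.map (fun y => y + s 0 + β * y * s 0) ys).prod * h1 +
              (y - x) * (List.map (fun y => y + s 0 + β * y * s 0) ys).prod * h0
      · intro y ys
        simp [monodromySum_cons_cons, localWeight, leadProd_cons_one]

end ClosedForm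

/-! ### Strings described by the places of the letter `1`. -/

section Places

variable {A : Type*} [CommRing A]

/-- The values of `p` other than the last one are the places of the letter `1` in `b`, in increasing
order, counted from `0`; the last value is the length of `b`. -/
structure IsPlaces {N m : ℕ} (b : Fin N → Fin 2) (p : Fin (m + 1) → ℕ) : Prop where
  strictMono : StrictMono p
  last : p (Fin.last m) = N
  iff : ∀ j, b j = 1 ↔ ∃ i : Fin m, p i.castSucc = j

/-- `∏_{l < p} (y ⊕ s_l)`. -/
def initProd (β y : A) {N : ℕ} (s : Fin N → A) (p : ℕ) : A :=
  ∏ l : Fin N, if (l : ℕ) < p then oplus β y (s l) else 1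

/-- `∏_{p ≤ l < p'} (y ⊕ s_l)`. -/
def midProd (β y : A) {N : ℕ} (s : Fin N → A) (p p' : ℕ) : A :=
  ∏ l : Fin N, if p ≤ (l : ℕ) ∧ (l : ℕ) < p' then oplus β y (s l) else 1

theorem initProd_mul_midProd (β y : A) {N : ℕ} (s : Fin N → A) {p p' : ℕ} (h : p ≤ p') :
    initProd β y s p * midProd β y s p p' = initProd β y s p' := by
  unfold initProd midProd
  rw [← Finset.prod_mul_distrib]
  refine Finset.prod_congr rfl fun l _ => ?_
  by_cases h1 : (l : ℕ) < p
  · have h2 : (l : ℕ) < p' := by omega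
    have h3 : ¬ p ≤ (l : ℕ) := by omega
    simp [h1, h2, h3]
  · have h3 : p ≤ (l : ℕ) := by omega
    simp [h1, h3]

theorem initProd_zero (β y : A) {N : ℕ} (s : Fin N → A) : initProd β y s 0 = 1 := by
  simp [initProd]

theorem initProd_length (β y : A) {N : ℕ} (s : Fin N → A) :
    initProd β y s N = ∏ l, oplus β y (s l) := by
  simp [initProd]

theorem initProd_succ (β y : A) {N : ℕ} (s : Fin (N + 1) → A) (p : ℕ) :
    initProd β y s (p + 1) = oplus β y (s 0) * initProd β y (Fin.tail s) p := by
  simp [initProd, Fin.prod_univ_succ, Fin.tail]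

theorem midProd_succ (β y : A) {N : ℕ} (s : Fin (N + 1) → A) (p p' : ℕ) :
    midProd β y s (p + 1) (p' + 1) = midProd β y (Fin.tail s) p p' := by
  simp [midProd, Fin.prod_univ_succ, Fin.tail]

theorem midProd_zero_succ (β y : A) {N : ℕ} (s : Fin (N + 1) → A) (p : ℕ) :
    midProd β y s 0 (p + 1) = oplus β y (s 0) * initProd β y (Fin.tail s) p := by
  simp [midProd, initProd, Fin.prod_univ_succ, Fin.tail]

theorem IsPlaces.of_cons_zero {N m : ℕ} {b : Fin N → Fin 2} {p : Fin (m + 1) → ℕ}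
    (h : IsPlaces (Fin.cons 0 b : Fin (N + 1) → Fin 2) p) :
    ∃ q : Fin (m + 1) → ℕ, IsPlaces b q ∧ p = fun i => q i + 1 := by
  have hpos : ∀ i, 0 < p i := by
    intro i
    rcases Nat.eq_zero_or_pos (p i) with h0 | h0
    · exfalso
      have hi : i ≠ Fin.last m := by rintro rfl; have := h.last; omega
      obtain ⟨i, rfl⟩ := Fin.exists_castSucc_eq.2 hi
      have := (h.iff 0).2 ⟨i, h0⟩
      simp at this
    · exact h0
  refine ⟨fun i => p i - 1, ⟨fun i j hij => ?_, ?_, fun j => ?_⟩, ?_⟩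
  · have := h.strictMono hij; have := hpos i; omega
  · have := h.last; omega
  · have := h.iff j.succ
    rw [Fin.cons_succ] at this
    rw [this]
    refine exists_congr fun i => ?_
    have := hpos i.castSucc
    rw [Fin.val_succ]; omega
  · funext i; have := hpos i; change p i = p i - 1 + 1; omega

theorem IsPlaces.of_cons_one {N m : ℕ} {b : Fin N → Fin 2} {p : Fin (m + 1) → ℕ}
    (h : IsPlaces (Fin.cons 1 b : Fin (N + 1) → Fin 2) p) :
    ∃ m', ∃ hm : m = m' + 1, ∃ q : Fin (m' + 1) → ℕ, IsPlaces b q ∧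
      p = (Fin.cons 0 (fun i => q i + 1) : Fin (m' + 2) → ℕ) ∘ Fin.cast (by rw [hm]) := by
  obtain ⟨i₀, hi₀⟩ := (h.iff 0).1 (by simp)
  obtain ⟨m', rfl⟩ : ∃ m', m = m' + 1 := Nat.exists_eq_succ_of_ne_zero (by
    rintro rfl; exact i₀.elim0)
  have h0 : p 0 = 0 := by
    have := h.strictMono.monotone (Fin.zero_le i₀.castSucc)
    rw [hi₀] at this
    simpa using this
  have hpos : ∀ i : Fin (m' + 1), 0 < p i.succ := fun i =>
    lt_of_le_of_lt (Nat.zero_le _) (h.strictMono (Fin.succ_pos i))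
  refine ⟨m', rfl, fun i => p i.succ - 1, ⟨fun i j hij => ?_, ?_, fun j => ?_⟩, ?_⟩
  · have := h.strictMono (Fin.succ_lt_succ_iff.2 hij)
    have := hpos i; omega
  · have := h.last; rw [← Fin.succ_last] at this; omega
  · have := h.iff j.succ
    rw [Fin.cons_succ] at this
    rw [this]
    constructor
    · rintro ⟨i, hi⟩
      rcases Fin.eq_zero_or_eq_succ i with rfl | ⟨i, rfl⟩
      · rw [Fin.castSucc_zero, h0, Fin.val_succ] at hi; omega
      · refine ⟨i, ?_⟩
        rw [← Fin.succ_castSucc, Fin.val_succ] at hi; omega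
    · rintro ⟨i, hi⟩
      refine ⟨i.succ, ?_⟩
      have := hpos i.castSucc
      rw [← Fin.succ_castSucc, Fin.val_succ]; omega
  · funext i
    rcases Fin.eq_zero_or_eq_succ i with rfl | ⟨i, rfl⟩
    · simpa using h0
    · have := hpos i
      simp only [Function.comp_apply, Fin.cast_eq_self, Fin.cons_succ]; omega

/-- Indexed families make determinants available. Because the extra value of `p` is the length `N`,
the last gap closes at the end of the string, where the product over all sites appears; this is
where the Bethe equations will enter. -/
theorem IsPlaces.fns {N m : ℕ} {b : Fin N → Fin 2} {p : Fin (m + 1) → ℕ} (h : IsPlaces b p)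
    (β x : A) (s : Fin N → A) :
    rowFns β s b = List.ofFn (fun (i : Fin m) y => initProd β y s (p i.castSucc)) ∧
    (∀ v, leadProd β v s b = initProd β v s (p 0)) ∧
    gapFns β x s b = List.ofFn (fun (i : Fin m) y =>
      (1 + β * x) * initProd β y s (p i.succ) - (1 + β * y) * (initProd β y s (p i.castSucc) *
        midProd β x s (p i.castSucc) (p i.succ))) := by
  induction N generalizing m with
  | zero =>
    obtain rfl : m = 0 := by
      rcases Nat.eq_zero_or_pos m with hm | hm
      · exact hm
      · have h1 := h.strictMono (show (0 : Fin (m + 1)) < Fin.last m from by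
          rw [Fin.lt_def]; simpa using hm)
        have := h.last; omega
    have : p 0 = 0 := h.last
    simp [rowFns, leadProd, gapFns, initProd]
  | succ N ih =>
    rcases exists_cons b with ⟨b, rfl⟩ | ⟨b, rfl⟩
    · obtain ⟨q, hq, rfl⟩ := h.of_cons_zero
      obtain ⟨h1, h2, h3⟩ := ih hq (Fin.tail s)
      refine ⟨?_, fun v => ?_, ?_⟩
      · simp [rowFns, h1, scaleFns, List.map_ofFn, initProd_succ, Function.comp_def]
      · simp [leadProd, h2, initProd_succ]
      · rw [gapFns_cons_zero, h3]
        simp only [scaleFns, List.map_ofFn, initProd_succ, midProd_succ, Function.comp_def]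
        congr 1; funext i y; ring
    · obtain ⟨m', rfl, q, hq, hp⟩ := h.of_cons_one
      obtain rfl : p = Fin.cons 0 (fun i => q i + 1) := by simpa [Function.comp_def] using hp
      obtain ⟨h1, h2, h3⟩ := ih hq (Fin.tail s)
      refine ⟨?_, fun v => ?_, ?_⟩
      · simp [rowFns, h1, scaleFns, List.map_ofFn, initProd_succ, Function.comp_def,
          List.ofFn_succ, initProd_zero, ← Fin.succ_castSucc]
      · simp [leadProd, initProd_zero]
      · rw [gapFns_cons_one, h3, List.ofFn_succ]
        simp only [scaleFns, List.map_ofFn, initProd_succ, midProd_succ, Function.comp_def,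
          Fin.castSucc_zero, Fin.cons_zero, Fin.cons_succ, midProd_zero_succ, initProd_zero, h2,
          ← Fin.succ_castSucc]
        congr 1
        · funext y; ring
        · congr 1; funext i y; ring

theorem exists_isPlaces {N : ℕ} (b : Fin N → Fin 2) :
    ∃ m, ∃ p : Fin (m + 1) → ℕ, IsPlaces b p := by
  induction N with
  | zero =>
    exact ⟨0, fun _ => 0, fun i j hij => absurd hij (by omega),
      rfl, fun j => j.elim0⟩
  | succ N ih =>
    rcases exists_cons b with ⟨b, rfl⟩ | ⟨b, rfl⟩ <;> obtain ⟨m, q, hq⟩ := ih b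
    · refine ⟨m, fun i => q i + 1, fun i j hij => ?_, ?_, fun j => ?_⟩
      · exact Nat.succ_lt_succ (hq.strictMono hij)
      · simp [hq.last]
      · rcases Fin.eq_zero_or_eq_succ j with rfl | ⟨j, rfl⟩
        · simp
        · simp [hq.iff]
    · refine ⟨m + 1, Fin.cons 0 fun i => q i + 1, ?_, ?_, fun j => ?_⟩
      · intro i j hij
        rcases Fin.eq_zero_or_eq_succ j with rfl | ⟨j, rfl⟩
        · exact absurd hij (Fin.not_lt_zero i)
        rcases Fin.eq_zero_or_eq_succ i with rfl | ⟨i, rfl⟩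
        · simp
        · simpa using hq.strictMono (Fin.succ_lt_succ_iff.1 hij)
      · rw [← Fin.succ_last]; simp [hq.last]
      · rcases Fin.eq_zero_or_eq_succ j with rfl | ⟨j, rfl⟩
        · simpa using ⟨0, by simp⟩
        · simp only [Fin.cons_succ, hq.iff]
          constructor
          · rintro ⟨i, hi⟩
            exact ⟨i.succ, by simp [← Fin.succ_castSucc, hi]⟩
          · rintro ⟨i, hi⟩
            rcases Fin.eq_zero_or_eq_succ i with rfl | ⟨i, rfl⟩
            · simp at hi
            · exact ⟨i, by simpa [← Fin.succ_castSucc] using hi⟩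

theorem IsPlaces.card {N m : ℕ} {b : Fin N → Fin 2} {p : Fin (m + 1) → ℕ} (h : IsPlaces b p) :
    (Finset.univ.filter fun j => b j = 1).card = m := by
  have hlt : ∀ i : Fin m, p i.castSucc < N := fun i => by
    have := h.strictMono (Fin.castSucc_lt_last i); rwa [h.last] at this
  let f : Fin m → Fin N := fun i => ⟨p i.castSucc, hlt i⟩
  have hf : Function.Injective f := fun i j hij =>
    Fin.castSucc_injective _ (h.strictMono.injective (congrArg Fin.val hij))
  have : (Finset.univ.filter fun j => b j = 1) = Finset.univ.image f := by
    ext j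
    simp [h.iff, f, Fin.ext_iff]
  rw [this, Finset.card_image_of_injective _ hf, Finset.card_univ, Fintype.card_fin]

end Places

/-! ### Determinant identities and the Vandermonde product. -/

section Determinants

variable {A : Type*} [CommRing A]

/-- The row operation is multiplication by a lower bidiagonal matrix with diagonal `1, u, …, u`. -/
theorem det_of_lower_bidiagonal {m : ℕ} (F B : Matrix (Fin (m + 1)) (Fin (m + 1)) A) (u : A)
    (c : Fin m → A) (h0 : ∀ j, B 0 j = F 0 j)
    (hs : ∀ i j, B i.succ j = u * F i.succ j - c i * F i.castSucc j) :
    B.det = u ^ m * F.det := by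
  let K : Matrix (Fin (m + 1)) (Fin (m + 1)) A := Matrix.of (Fin.cons
    (fun k => if k = 0 then 1 else 0) fun i k =>
      (if k = i.succ then u else 0) - (if k = i.castSucc then c i else 0))
  have hK : B = K * F := by
    ext i j
    rcases Fin.eq_zero_or_eq_succ i with rfl | ⟨i, rfl⟩
    · simp [K, Matrix.mul_apply, h0]
    · simp [K, Matrix.mul_apply, hs, sub_mul, Finset.sum_sub_distrib, ite_mul]
  have hdet : K.det = u ^ m := by
    rw [Matrix.det_of_isLowerTriangular]
    · rw [Fin.prod_univ_succ]
      simp [K, (Fin.castSucc_lt_succ).ne']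
    · intro i j hij
      have hij : i < j := hij
      rcases Fin.eq_zero_or_eq_succ i with rfl | ⟨i, rfl⟩
      · simp [K, hij.ne']
      · have h2 : j ≠ i.castSucc := fun h => by
          subst h; exact absurd hij (not_lt.2 (Fin.castSucc_lt_succ).le)
        simp [K, hij.ne', h2]
  rw [hK, Matrix.det_mul, hdet]

/-- The same combinations of rows, with the last row kept instead of the first, form an upper
bidiagonal matrix whose diagonal is given by the `-c i` and a final `1`. -/
theorem det_of_upper_bidiagonal {m : ℕ} (F B : Matrix (Fin (m + 1)) (Fin (m + 1)) A) (u : A)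
    (c : Fin m → A) (h0 : ∀ j, B (Fin.last m) j = F (Fin.last m) j)
    (hs : ∀ i j, B i.castSucc j = u * F i.succ j - c i * F i.castSucc j) :
    B.det = (∏ i, -c i) * F.det := by
  let K : Matrix (Fin (m + 1)) (Fin (m + 1)) A := Matrix.of (Fin.snoc (α := fun _ => Fin (m + 1) → A)
    (fun i k => (if k = i.succ then u else 0) - (if k = i.castSucc then c i else 0))
    (fun k => if k = Fin.last m then 1 else 0))
  have hK : B = K * F := by
    ext i j
    rcases Fin.eq_castSucc_or_eq_last i with ⟨i, rfl⟩ | rfl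
    · simp [K, Matrix.mul_apply, hs, sub_mul, Finset.sum_sub_distrib, ite_mul]
    · simp [K, Matrix.mul_apply, h0]
  have hdet : K.det = ∏ i, -c i := by
    rw [Matrix.det_of_isUpperTriangular]
    · rw [Fin.prod_univ_castSucc]
      simp [K, (Fin.castSucc_lt_succ).ne]
    · intro i j hij
      have hij : j < i := hij
      rcases Fin.eq_castSucc_or_eq_last i with ⟨i, rfl⟩ | rfl
      · have h2 : j ≠ i.succ := fun h => by
          subst h; exact absurd hij (not_lt.2 (Fin.castSucc_lt_succ).le)
        simp [K, hij.ne, h2]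
      · simp [K, hij.ne]
  rw [hK, Matrix.det_mul, hdet]

theorem det_of_last_col {m : ℕ} (B : Matrix (Fin (m + 1)) (Fin (m + 1)) A)
    (h : ∀ i : Fin m, B i.succ (Fin.last m) = 0) :
    B.det = (-1) ^ m * B 0 (Fin.last m) *
      (Matrix.of fun i j : Fin m => B i.succ j.castSucc).det := by
  rw [Matrix.det_succ_column B (Fin.last m), Fin.sum_univ_succ]
  simp only [h, mul_zero, zero_mul, Finset.sum_const_zero, add_zero, Fin.val_zero, zero_add,
    Fin.val_last]
  congr 2
  ext i j
  simp

theorem det_cons_lin {m : ℕ} (a : Fin m → Fin (m + 1) → A) (r r' : Fin (m + 1) → A) (c d : A) :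
    (Matrix.of (Fin.cons (c • r + d • r') a : Fin (m + 1) → Fin (m + 1) → A)).det =
      c * (Matrix.of (Fin.cons r a : Fin (m + 1) → Fin (m + 1) → A)).det +
      d * (Matrix.of (Fin.cons r' a : Fin (m + 1) → Fin (m + 1) → A)).det := by
  have h : ∀ r, (Matrix.of (Fin.cons r a : Fin (m + 1) → Fin (m + 1) → A)) =
      Matrix.updateRow (Matrix.of (Fin.cons 0 a : Fin (m + 1) → Fin (m + 1) → A)) 0 r := by
    intro r
    ext i j
    rcases Fin.eq_zero_or_eq_succ i with rfl | ⟨i, rfl⟩ <;> simp [Matrix.updateRow_apply]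
  rw [h, h r, h r', Matrix.det_updateRow_add, Matrix.det_updateRow_smul, Matrix.det_updateRow_smul]

/-- Moving a row from the bottom to the top is a cycle of length `m + 1`, of sign `(-1) ^ m`. -/
theorem det_snoc_eq {m : ℕ} (a : Fin m → Fin (m + 1) → A) (r : Fin (m + 1) → A) :
    (Matrix.of (Fin.snoc a r : Fin (m + 1) → Fin (m + 1) → A)).det =
      (-1) ^ m * (Matrix.of (Fin.cons r a : Fin (m + 1) → Fin (m + 1) → A)).det := by
  have h := Matrix.det_permute (finRotate (m + 1))
    (Matrix.of (Fin.cons r a : Fin (m + 1) → Fin (m + 1) → A))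
  rw [sign_finRotate] at h
  have h2 : (Matrix.of (Fin.cons r a : Fin (m + 1) → Fin (m + 1) → A)).submatrix
      (finRotate (m + 1)) id = Matrix.of (Fin.snoc a r : Fin (m + 1) → Fin (m + 1) → A) := by
    ext i j
    rcases Fin.eq_castSucc_or_eq_last i with ⟨i, rfl⟩ | rfl
    · simp [Fin.coeSucc_eq_succ]
    · simp
  rw [h2] at h
  simpa using h

theorem det_fns {m : ℕ} (f : Fin m → A → A) (y : Fin m → A) :
    (Matrix.of fun i j => f i (y j)).det =
      ∑ σ : Equiv.Perm (Fin m), ((Equiv.Perm.sign σ : ℤ) : A) * ∏ i, f i (y (σ i)) := by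
  rw [← Matrix.det_transpose, Matrix.det_apply']
  rfl

/-- The Vandermonde product `∏_{i < j} (y_j - y_i)`. -/
def vandermondeProd {m : ℕ} (y : Fin m → A) : A := ∏ i, ∏ j ∈ Finset.Ioi i, (y j - y i)

theorem vandermondeProd_succ {m : ℕ} (y : Fin (m + 1) → A) :
    vandermondeProd y =
      vandermondeProd (fun i => y (Fin.castSucc i)) * ∏ i : Fin m, (y (Fin.last m) - y i.castSucc) := by
  have h : ∀ (m : ℕ) (y : Fin m → A), vandermondeProd y =
      ∏ i, ∏ j, if i < j then y j - y i else 1 := by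
    intro m y
    refine Finset.prod_congr rfl fun i _ => ?_
    rw [← Finset.prod_filter]
    refine Finset.prod_congr ?_ fun _ _ => rfl
    ext j; simp
  rw [h, h, Fin.prod_univ_castSucc]
  simp [Fin.prod_univ_castSucc, Finset.prod_mul_distrib, Fin.castSucc_lt_last, not_lt.2 (Fin.le_last _)]

theorem vandermondeProd_ne_zero [IsDomain A] {m : ℕ} {y : Fin m → A} (h : Function.Injective y) :
    vandermondeProd y ≠ 0 :=
  Finset.prod_ne_zero_iff.2 fun i _ => Finset.prod_ne_zero_iff.2 fun j hj =>
    sub_ne_zero.2 (h.ne (Finset.mem_Ioi.1 hj).ne')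

theorem evalProd_ofFn {m : ℕ} (f : Fin m → A → A) (z : Fin m → A) :
    evalProd (List.ofFn f) (List.ofFn z) = ∏ i, f i (z i) := by
  induction m with
  | zero => simp [evalProd]
  | succ m ih => rw [List.ofFn_succ, List.ofFn_succ, evalProd, ih, Fin.prod_univ_succ]

theorem evalProd_eq_zero (fs : List (A → A)) (zs : List A) (h : fs.length ≠ zs.length) :
    evalProd fs zs = 0 := by
  induction fs generalizing zs with
  | nil =>
    cases zs with
    | nil => simp at h
    | cons _ _ => rfl
  | cons f fs ih =>
    cases zs with
    | nil => rfl
    | cons z zs => rw [evalProd, ih zs (by simpa using h), mul_zero]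

theorem diffProd_ofFn {m : ℕ} (x : A) (z : Fin m → A) :
    diffProd x (List.ofFn z) = ∏ i, (z i - x) := by
  simp [diffProd, List.map_ofFn, List.prod_ofFn]

end Determinants

/-! ### Amplitudes and alternating sums of row functions. -/

section Amplitudes

variable {A : Type*} [CommRing A]

/-- The coefficient of `v_0` in `C(y_1) ⋯ C(y_m) v_b`, with weights `y ⊕ s_j`. -/
def amplitude (β : A) {N : ℕ} (s : Fin N → A) : {m : ℕ} → (Fin m → A) → (Fin N → Fin 2) → A
  | 0, _, b => if b = 0 then 1 else 0
  | m + 1, y, b => ∑ b', transfer β (fun j => oplus β (y (Fin.last m)) (s j)) b' b 1 0 *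
      amplitude β s (fun i : Fin m => y i.castSucc) b'

/-- The antisymmetrised product of the row functions of `b`. -/
def altSum (β : A) {N : ℕ} (s : Fin N → A) {m : ℕ} (y : Fin m → A) (b : Fin N → Fin 2) : A :=
  ∑ σ : Equiv.Perm (Fin m), ((Equiv.Perm.sign σ : ℤ) : A) *
    ((∏ i : Fin m, (1 + β * y (σ i)) ^ (m - 1 - (i : ℕ))) *
      evalProd (rowFns β s b) (List.ofFn fun i => y (σ i)))

/-- The matrix `(1 + β y_j)^{m - i} ∏_{l < p_i} (y_j ⊕ s_l)`. -/
def rowMatrix (β : A) {N : ℕ} (s : Fin N → A) {m : ℕ} (y : Fin m → A) (p : Fin (m + 1) → ℕ) :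
    Matrix (Fin m) (Fin m) A :=
  Matrix.of fun i j => (1 + β * y j) ^ (m - 1 - (i : ℕ)) * initProd β (y j) s (p i.castSucc)

theorem altSum_eq_det (β : A) {N : ℕ} (s : Fin N → A) {m : ℕ} (y : Fin m → A)
    {b : Fin N → Fin 2} {p : Fin (m + 1) → ℕ} (h : IsPlaces b p) :
    altSum β s y b = (rowMatrix β s y p).det := by
  rw [rowMatrix, det_fns (fun (i : Fin m) z =>
    (1 + β * z) ^ (m - 1 - (i : ℕ)) * initProd β z s (p i.castSucc)), altSum, (h.fns β 0 s).1]
  simp only [evalProd_ofFn, Finset.prod_mul_distrib]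

theorem altSum_eq_zero (β : A) {N : ℕ} (s : Fin N → A) {m m' : ℕ} (y : Fin m → A)
    {b : Fin N → Fin 2} {p : Fin (m' + 1) → ℕ} (h : IsPlaces b p) (hm : m' ≠ m) :
    altSum β s y b = 0 := by
  refine Finset.sum_eq_zero fun σ _ => ?_
  rw [evalProd_eq_zero, mul_zero, mul_zero]
  rw [(h.fns β 0 s).1]
  simpa using hm

/-- The factor `∏ (y i - x)` is symmetric in `y`, so it serves as the cleared denominator of every
term of the alternating sum, to which the closed form then applies. -/
theorem sum_transfer_altSum (β x : A) {N : ℕ} (s : Fin N → A) {m : ℕ} (y : Fin m → A)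
    (b : Fin N → Fin 2) (c a : Fin 2) :
    (∏ i, (y i - x)) * ∑ b', transfer β (fun j => oplus β x (s j)) b' b c a * altSum β s y b' =
      ∑ σ : Equiv.Perm (Fin m), ((Equiv.Perm.sign σ : ℤ) : A) *
        ((∏ i : Fin m, (1 + β * y (σ i)) ^ (m - 1 - (i : ℕ))) *
          (diffProd x (List.ofFn fun i => y (σ i)) *
            monodromySum β x s c a (List.ofFn fun i => y (σ i)) b)) := by
  have h1 : ∀ σ : Equiv.Perm (Fin m), diffProd x (List.ofFn fun i => y (σ i)) =
      ∏ i, (y i - x) := fun σ => by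
    rw [diffProd_ofFn]; exact Equiv.prod_comp σ fun i => y i - x
  simp only [h1, altSum, monodromySum, Finset.mul_sum]
  rw [Finset.sum_comm]
  refine Finset.sum_congr rfl fun σ _ => Finset.sum_congr rfl fun b' _ => ?_
  ring

end Amplitudes

/-! ### Determinantal formula for amplitudes and the eigenvalue equation. -/

section Amplitudes

variable {A : Type*} [CommRing A]

theorem dropLast_ofFn {B : Type*} {m : ℕ} (f : Fin (m + 1) → B) :
    (List.ofFn f).dropLast = List.ofFn fun i : Fin m => f i.castSucc := by
  rw [List.ofFn_succ', List.concat_eq_append, List.dropLast_concat]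

/-- The function `(1 + β x) ∏_{l < p'} (y ⊕ s_l) - (1 + β y) ∏_{l < p} (y ⊕ s_l)
∏_{p ≤ l < p'} (x ⊕ s_l)`. -/
def gapValue (β x : A) {N : ℕ} (s : Fin N → A) (p p' : ℕ) (y : A) : A :=
  (1 + β * x) * initProd β y s p' - (1 + β * y) * (initProd β y s p * midProd β x s p p')

/-- This explains the powers of `1 + β y` in the alternant: they drop by one from row to row,
exactly as needed for a combination of neighbouring rows to be a gap function. -/
theorem rowMatrix_gap (β x : A) {N : ℕ} (s : Fin N → A) {m : ℕ} (y : Fin (m + 1) → A)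
    (p : Fin (m + 2) → ℕ) (i : Fin m) (j : Fin (m + 1)) :
    (1 + β * x) * rowMatrix β s y p i.succ j -
        midProd β x s (p i.castSucc.castSucc) (p i.castSucc.succ) *
          rowMatrix β s y p i.castSucc j =
      (1 + β * y j) ^ (m - 1 - (i : ℕ)) *
        gapValue β x s (p i.castSucc.castSucc) (p i.castSucc.succ) (y j) := by
  have h1 : m + 1 - 1 - ((i : ℕ) + 1) = m - 1 - i := by omega
  have h2 : m + 1 - 1 - (i : ℕ) = m - 1 - i + 1 := by omega
  simp only [rowMatrix, Matrix.of_apply, Fin.val_succ, Fin.val_castSucc, h1, h2, gapValue,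
    Fin.succ_castSucc]
  ring

/-- Each gap function vanishes when its argument equals `x`, here the last variable. After the row
operations the last column therefore has only its top entry, and expansion along it leaves the
alternant of the gap functions in the other variables. The factor `(1 + β x) ^ m` is the determinant
of the row operations. -/
theorem det_rowMatrix_succ (β : A) {N : ℕ} (s : Fin N → A) {m : ℕ} (y : Fin (m + 1) → A)
    (p : Fin (m + 2) → ℕ) (hp : ∀ i : Fin m, p i.castSucc.castSucc ≤ p i.castSucc.succ) :
    (1 + β * y (Fin.last m)) ^ m * (rowMatrix β s y p).det =
      (-1) ^ m * ((1 + β * y (Fin.last m)) ^ m * initProd β (y (Fin.last m)) s (p 0)) *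
        (Matrix.of fun i j : Fin m => (1 + β * y j.castSucc) ^ (m - 1 - (i : ℕ)) *
          gapValue β (y (Fin.last m)) s (p i.castSucc.castSucc) (p i.castSucc.succ)
            (y j.castSucc)).det := by
  set x := y (Fin.last m) with hx
  let B : Matrix (Fin (m + 1)) (Fin (m + 1)) A := Matrix.of (Fin.cons (rowMatrix β s y p 0)
    fun i j => (1 + β * x) * rowMatrix β s y p i.succ j -
      midProd β x s (p i.castSucc.castSucc) (p i.castSucc.succ) *
        rowMatrix β s y p i.castSucc j)
  have hB1 : B.det = (1 + β * x) ^ m * (rowMatrix β s y p).det :=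
    det_of_lower_bidiagonal _ B _
      (fun i => midProd β x s (p i.castSucc.castSucc) (p i.castSucc.succ))
      (fun j => by simp [B]) (fun i j => by simp [B])
  have hB2 := det_of_last_col B (fun i => by
    simp only [B, Matrix.of_apply, Fin.cons_succ, rowMatrix_gap, gapValue]
    rw [← initProd_mul_midProd β (y (Fin.last m)) s (hp i)]
    ring)
  have hB3 : (Matrix.of fun i j : Fin m => B i.succ j.castSucc) =
      Matrix.of fun i j : Fin m => (1 + β * y j.castSucc) ^ (m - 1 - (i : ℕ)) *
        gapValue β x s (p i.castSucc.castSucc) (p i.castSucc.succ) (y j.castSucc) := by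
    ext i j
    simp only [B, Matrix.of_apply, Fin.cons_succ, rowMatrix_gap]
  have hB4 : B 0 (Fin.last m) = (1 + β * x) ^ m * initProd β x s (p 0) := by
    simp [B, rowMatrix, hx]
  rw [← hB1, hB2, hB3, hB4]

/-- Induction on the number of operators `C`. The closed form with `x` the last variable turns the
alternant for the first `m` variables into an alternant of gap functions, which `det_rowMatrix_succ`
recognizes as the alternant for all of them. -/
theorem vandermondeProd_mul_amplitude [IsDomain A] (β : A) {N : ℕ} (s : Fin N → A) {m : ℕ}
    (y : Fin m → A) (hy : ∀ i, 1 + β * y i ≠ 0) (b : Fin N → Fin 2) :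
    vandermondeProd y * amplitude β s y b = altSum β s y b := by
  induction m generalizing b with
  | zero =>
    obtain ⟨m', p, hp⟩ := exists_isPlaces b
    have hv : vandermondeProd y = 1 := by simp [vandermondeProd]
    rw [hv, one_mul]
    rcases Nat.eq_zero_or_pos m' with rfl | hm'
    · rw [altSum_eq_det β s y hp]
      have : b = 0 := by
        funext j
        have := hp.iff j
        simp only [IsEmpty.exists_iff, iff_false] at this
        have key : ∀ w : Fin 2, w ≠ 1 → w = 0 := by decide
        exact key _ this
      simp [amplitude, this]
    · rw [altSum_eq_zero β s y hp hm'.ne']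
      have : b ≠ 0 := by
        rintro rfl
        have hlt := hp.strictMono (Fin.castSucc_lt_last ⟨0, hm'⟩)
        rw [hp.last] at hlt
        have := (hp.iff ⟨_, hlt⟩).2 ⟨⟨0, hm'⟩, rfl⟩
        simp at this
      simp [amplitude, this]
  | succ m ih =>
    obtain ⟨m', p, hp⟩ := exists_isPlaces b
    set x := y (Fin.last m) with hx
    set y' : Fin m → A := fun i => y i.castSucc with hy'
    have step : vandermondeProd y * amplitude β s y b = (-1) ^ m *
        ∑ σ : Equiv.Perm (Fin m), ((Equiv.Perm.sign σ : ℤ) : A) *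
        ((∏ i : Fin m, (1 + β * y' (σ i)) ^ (m - 1 - (i : ℕ))) *
          (diffProd x (List.ofFn fun i => y' (σ i)) *
            monodromySum β x s 1 0 (List.ofFn fun i => y' (σ i)) b)) := by
      rw [← sum_transfer_altSum, vandermondeProd_succ, amplitude]
      have h1 : ∏ i : Fin m, (x - y' i) = (-1) ^ m * ∏ i, (y' i - x) := by
        have : ∀ i : Fin m, x - y' i = (-1) * (y' i - x) := fun i => by ring
        simp only [this, Finset.prod_mul_distrib, Finset.prod_const, Finset.card_univ,
          Fintype.card_fin]
      simp only [← ih y' (fun i => hy _)]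
      rw [← hx, h1, Finset.mul_sum, Finset.mul_sum, Finset.mul_sum]
      refine Finset.sum_congr rfl fun b' _ => ?_
      ring
    rw [step]
    by_cases hm : m' = m + 1
    · subst hm
      obtain ⟨-, h2, h3⟩ := hp.fns β x s
      have hne : gapFns β x s b ≠ [] := by rw [h3]; simp
      have hterm : ∀ σ : Equiv.Perm (Fin m), diffProd x (List.ofFn fun i => y' (σ i)) *
            monodromySum β x s 1 0 (List.ofFn fun i => y' (σ i)) b =
          initProd β x s (p 0) * ∏ i : Fin m,
            gapValue β x s (p i.castSucc.castSucc) (p i.castSucc.succ) (y' (σ i)) := by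
        intro σ
        rw [(monodromySum_one β x s b hne).1, h2, h3, dropLast_ofFn, evalProd_ofFn]
        rfl
      have hdet : ∑ σ : Equiv.Perm (Fin m), ((Equiv.Perm.sign σ : ℤ) : A) *
          ((∏ i : Fin m, (1 + β * y' (σ i)) ^ (m - 1 - (i : ℕ))) *
          (diffProd x (List.ofFn fun i => y' (σ i)) *
            monodromySum β x s 1 0 (List.ofFn fun i => y' (σ i)) b)) =
          initProd β x s (p 0) * (Matrix.of fun i j : Fin m => (1 + β * y' j) ^ (m - 1 - (i : ℕ)) *
            gapValue β x s (p i.castSucc.castSucc) (p i.castSucc.succ) (y' j)).det := by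
        rw [det_fns (fun (i : Fin m) z => (1 + β * z) ^ (m - 1 - (i : ℕ)) *
            gapValue β x s (p i.castSucc.castSucc) (p i.castSucc.succ) z), Finset.mul_sum]
        refine Finset.sum_congr rfl fun σ _ => ?_
        rw [hterm, Finset.prod_mul_distrib]
        ring
      rw [hdet, altSum_eq_det β s y hp]
      have hB := det_rowMatrix_succ β s y p
        fun i => (hp.strictMono (Fin.castSucc_lt_succ (i := i.castSucc))).le
      refine mul_left_cancel₀ (pow_ne_zero m (hy (Fin.last m))) ?_
      rw [hB, ← hx]
      ring
    · rw [altSum_eq_zero β s y hp hm, Finset.sum_eq_zero, mul_zero]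
      intro σ _
      obtain ⟨-, -, h3⟩ := hp.fns β x s
      by_cases hnil : gapFns β x s b = []
      · rw [(monodromySum_one_of_nil β x s b hnil).1]; simp
      · rw [(monodromySum_one β x s b hnil).1, evalProd_eq_zero, mul_zero, mul_zero, mul_zero]
        rw [h3]
        have hm' : m' ≠ 0 := by
          rintro rfl; exact hnil (by simpa using h3)
        simp only [List.length_dropLast, List.length_ofFn]
        omega

/-- The Bethe ansatz in determinant form. The first term comes from `A` and the second from `D`; the
first also contains the gap running to the end of the string, whose product over all sites the Bethe
equations replace by a power of `1 + β y_j`. The resulting unwanted determinant, with the row `E`,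
occurs in both terms and cancels. -/
theorem sum_transfer_mul_amplitude_aux [IsDomain A] (β x q : A) {N : ℕ} (s : Fin N → A) {m : ℕ}
    (y : Fin (m + 1) → A) (hy : ∀ i, 1 + β * y i ≠ 0)
    (hB : ∀ i, (∏ j, oplus β (y i) (s j)) * bigPi β y =
      (-1) ^ m * q * (1 + β * y i) ^ (m + 1)) {b : Fin N → Fin 2} {p : Fin (m + 2) → ℕ}
    (hp : IsPlaces b p) :
    initProd β x s (p 0) * (Matrix.of fun i j : Fin (m + 1) => (1 + β * y j) ^ (m - (i : ℕ)) *
        gapValue β x s (p i.castSucc) (p i.succ) (y j)).det +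
      q * (Matrix.of (Fin.cons (fun j => (1 + β * x) * ((1 + β * y j) ^ m *
          (initProd β (y j) s (p 0) - initProd β x s (p 0)))) fun i j =>
          (1 + β * y j) ^ (m - 1 - (i : ℕ)) *
            gapValue β x s (p i.castSucc.castSucc) (p i.castSucc.succ) (y j) :
              Fin (m + 1) → Fin (m + 1) → A)).det =
      ((-1) ^ (m + 1) * bigPi β y * (∏ j, oplus β x (s j)) + q * (1 + β * x) ^ (m + 1)) *
        (rowMatrix β s y p).det := by
  have hPi : bigPi β y ≠ 0 := Finset.prod_ne_zero_iff.2 fun i _ => hy i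
  set F := rowMatrix β s y p with hF
  set u := 1 + β * x with hu
  let Ξ : Fin (m + 1) → A := fun i => midProd β x s (p i.castSucc) (p i.succ)
  let a : Fin m → Fin (m + 1) → A := fun i j => (1 + β * y j) ^ (m - 1 - (i : ℕ)) *
            gapValue β x s (p i.castSucc.castSucc) (p i.castSucc.succ) (y j)
  have ha : ∀ i j, a i j = u * F i.succ j - Ξ i.castSucc * F i.castSucc j := fun i j =>
    (rowMatrix_gap β x s y p i j).symm
  let E : Fin (m + 1) → A := fun j => (1 + β * y j) ^ m
  have hF0 : ∀ j, F 0 j = E j * initProd β (y j) s (p 0) := fun j => by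
    simp [hF, rowMatrix, E]
  have hFl : ∀ j, F (Fin.last m) j = initProd β (y j) s (p (Fin.last m).castSucc) := fun j => by
    simp [hF, rowMatrix]
  -- the first determinant
  have hA : (Matrix.of fun i j : Fin (m + 1) => (1 + β * y j) ^ (m - (i : ℕ)) *
        gapValue β x s (p i.castSucc) (p i.succ) (y j)).det =
      (Matrix.of (Fin.snoc a (((-1) ^ m * q * u) • E + (-(bigPi β y * Ξ (Fin.last m))) •
        F (Fin.last m)) : Fin (m + 1) → Fin (m + 1) → A)).det := by
    -- The factor `Π(y)` is put into the last row on one side and distributed as `1 + β y_j` over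
    -- the columns on the other; the latter accounts for the exponents of the rows `a` being one
    -- lower.
    refine mul_left_cancel₀ hPi ?_
    have h1 := Matrix.det_mul_row (fun j => 1 + β * y j) (Matrix.of (Fin.snoc a
      (((-1) ^ m * q * u) • E + (-(bigPi β y * Ξ (Fin.last m))) •
        F (Fin.last m)) : Fin (m + 1) → Fin (m + 1) → A))
    have h2 := Matrix.det_mul_column
      (Fin.snoc (fun _ => 1) (bigPi β y) : Fin (m + 1) → A)
      (Matrix.of fun i j : Fin (m + 1) => (1 + β * y j) ^ (m - (i : ℕ)) *
        gapValue β x s (p i.castSucc) (p i.succ) (y j))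
    rw [Fin.prod_univ_castSucc] at h2
    simp only [Fin.snoc_castSucc, Finset.prod_const_one, one_mul, Fin.snoc_last] at h2
    refine h2.symm.trans (Eq.trans ?_ h1)
    congr 1
    ext i j
    rcases Fin.eq_castSucc_or_eq_last i with ⟨i, rfl⟩ | rfl
    · have h3 : m - (i : ℕ) = m - 1 - i + 1 := by omega
      simp only [Matrix.of_apply, Fin.snoc_castSucc, Fin.val_castSucc, h3, a]
      ring
    · have h4 := hB j
      simp only [Matrix.of_apply, Fin.snoc_last, Fin.val_last, Nat.sub_self, pow_zero, one_mul,
        Pi.add_apply, Pi.smul_apply, smul_eq_mul, gapValue, hFl, E, Ξ, Fin.succ_last]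
      rw [hp.last, initProd_length]
      change bigPi β y * _ = _
      -- The only use of the Bethe equations.
      linear_combination u * h4
  have hD : (Fin.cons (fun j => u * ((1 + β * y j) ^ m *
          (initProd β (y j) s (p 0) - initProd β x s (p 0)))) a : Fin (m + 1) → Fin (m + 1) → A) =
      Fin.cons (u • F 0 + (-(u * initProd β x s (p 0))) • E) a := by
    congr 1
    funext j
    simp only [Pi.add_apply, Pi.smul_apply, smul_eq_mul, hF0, E]
    ring
  have h0 : (Matrix.of (Fin.cons (F 0) a : Fin (m + 1) → Fin (m + 1) → A)).det = u ^ m * F.det :=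
    det_of_lower_bidiagonal F _ u (fun i => Ξ i.castSucc) (fun j => by simp)
      (fun i j => by simp [ha])
  have hl : (Matrix.of (Fin.snoc a (F (Fin.last m)) : Fin (m + 1) → Fin (m + 1) → A)).det =
      (∏ i : Fin m, -Ξ i.castSucc) * F.det :=
    det_of_upper_bidiagonal F _ u (fun i => Ξ i.castSucc) (fun j => by simp)
      (fun i j => by simp [ha])
  rw [det_snoc_eq] at hl
  -- The gaps between consecutive places, together with the initial segment, exhaust the sites; the
  -- partial products telescope.
  have hprod : ∏ j, oplus β x (s j) = initProd β x s (p 0) * ∏ i, Ξ i := by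
    have key : ∀ k : ℕ, ∀ hk : k < m + 2, initProd β x s (p 0) *
        (∏ i : Fin (m + 1), if (i : ℕ) < k then Ξ i else 1) = initProd β x s (p ⟨k, hk⟩) := by
      intro k
      induction k with
      | zero => intro hk; simp
      | succ k ih =>
        intro hk
        have hk' : k < m + 1 := by omega
        have h1 := ih (by omega)
        have h2 : (∏ i : Fin (m + 1), if (i : ℕ) < k + 1 then Ξ i else 1) =
            (∏ i : Fin (m + 1), if (i : ℕ) < k then Ξ i else 1) * Ξ ⟨k, hk'⟩ := by
          have : Ξ ⟨k, hk'⟩ = ∏ i : Fin (m + 1), if i = ⟨k, hk'⟩ then Ξ i else 1 := by simp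
          rw [this, ← Finset.prod_mul_distrib]
          refine Finset.prod_congr rfl fun i _ => ?_
          by_cases h3 : i = ⟨k, hk'⟩
          · subst h3; simp
          · have h4 : (i : ℕ) ≠ k := fun h => h3 (Fin.ext h)
            have h5 : (i : ℕ) < k + 1 ↔ (i : ℕ) < k := by omega
            simp [h3, h5]
        rw [h2, ← mul_assoc, h1]
        exact initProd_mul_midProd β x s
          (hp.strictMono (Fin.castSucc_lt_succ (i := (⟨k, hk'⟩ : Fin (m + 1))))).le
    have h1 := key (m + 1) (by omega)
    have h2 : p ⟨m + 1, by omega⟩ = N := hp.last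
    rw [h2, initProd_length] at h1
    rw [← h1]
    congr 1
    refine Finset.prod_congr rfl fun i _ => ?_
    rw [if_pos i.2]
  have hneg : ∏ i : Fin m, -Ξ i.castSucc = (-1) ^ m * ∏ i : Fin m, Ξ i.castSucc := by
    rw [Finset.prod_neg]; simp
  rw [hA, det_snoc_eq, hD, det_cons_lin, det_cons_lin, h0, hprod, Fin.prod_univ_castSucc]
  have hsq : ((-1 : A) ^ m) * (-1) ^ m = 1 := by rw [← mul_pow]; simp
  rw [hneg] at hl
  set dE := (Matrix.of (Fin.cons E a : Fin (m + 1) → Fin (m + 1) → A)).det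
  set dF := (Matrix.of (Fin.cons (F (Fin.last m)) a : Fin (m + 1) → Fin (m + 1) → A)).det
  set P := ∏ i : Fin m, Ξ i.castSucc
  have hl' : dF = P * F.det := by
    linear_combination (-1 : A) ^ m * hl + (P * F.det - dF) * hsq
  rw [hl', pow_succ (-1 : A) m]
  -- The two occurrences of `dE` have opposite signs once `(-1) ^ m * (-1) ^ m` is replaced by `1`.
  linear_combination (initProd β x s (p 0) * q * u * dE) * hsq

/-- The operator `A(x) + q D(x)` has the functional `b ↦ ⟨0|C(y_1) ⋯ C(y_n)|b⟩` as a left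
eigenvector when `y` solves the Bethe equations. -/
theorem sum_transfer_mul_amplitude [IsDomain A] (β x q : A) {N : ℕ} (s : Fin N → A) {m : ℕ}
    (y : Fin (m + 1) → A) (hinj : Function.Injective y) (hy : ∀ i, 1 + β * y i ≠ 0)
    (hB : ∀ i, (∏ j, oplus β (y i) (s j)) * bigPi β y =
      (-1) ^ m * q * (1 + β * y i) ^ (m + 1)) (b : Fin N → Fin 2) :
    (∏ i, (y i - x)) * ∑ b', (transfer β (fun j => oplus β x (s j)) b' b 0 0 +
        q * transfer β (fun j => oplus β x (s j)) b' b 1 1) * amplitude β s y b' =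
      ((-1) ^ (m + 1) * bigPi β y * (∏ j, oplus β x (s j)) + q * (1 + β * x) ^ (m + 1)) *
        amplitude β s y b := by
  refine mul_left_cancel₀ (vandermondeProd_ne_zero hinj) ?_
  have hsplit : vandermondeProd y * ((∏ i, (y i - x)) *
      ∑ b', (transfer β (fun j => oplus β x (s j)) b' b 0 0 +
        q * transfer β (fun j => oplus β x (s j)) b' b 1 1) * amplitude β s y b') =
      (∏ i, (y i - x)) * ∑ b', transfer β (fun j => oplus β x (s j)) b' b 0 0 * altSum β s y b' +
      q * ((∏ i, (y i - x)) *
        ∑ b', transfer β (fun j => oplus β x (s j)) b' b 1 1 * altSum β s y b') := by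
    simp only [← vandermondeProd_mul_amplitude β s y hy, Finset.mul_sum]
    rw [← Finset.sum_add_distrib]
    exact Finset.sum_congr rfl fun b' _ => by ring
  rw [hsplit, sum_transfer_altSum, sum_transfer_altSum]
  obtain ⟨m', p, hp⟩ := exists_isPlaces b
  have hR : ∀ E : A, vandermondeProd y * (E * amplitude β s y b) = E * altSum β s y b := by
    intro E; rw [← vandermondeProd_mul_amplitude β s y hy]; ring
  rw [hR]
  obtain ⟨-, h2, h3⟩ := hp.fns β x s
  have hcons : ∀ σ : Equiv.Perm (Fin (m + 1)), (List.ofFn fun i => y (σ i)) =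
      y (σ 0) :: List.ofFn fun i : Fin m => y (σ i.succ) := fun σ => List.ofFn_succ
  by_cases hm : m' = m + 1
  · subst hm
    rw [altSum_eq_det β s y hp, ← sum_transfer_mul_amplitude_aux β x q s y hy hB hp]
    congr 1
    · rw [det_fns (fun (i : Fin (m + 1)) z => (1 + β * z) ^ (m - (i : ℕ)) *
        gapValue β x s (p i.castSucc) (p i.succ) z), Finset.mul_sum]
      refine Finset.sum_congr rfl fun σ _ => ?_
      rw [(monodromySum_zero β x s b).1, h2, h3, evalProd_ofFn, Finset.prod_mul_distrib]
      simp only [gapValue, Nat.add_sub_cancel]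
      ring
    · congr 1
      have hne : gapFns β x s b ≠ [] := by rw [h3]; simp
      have hcongr : (Matrix.of (Fin.cons (fun j => (1 + β * x) * ((1 + β * y j) ^ m *
          (initProd β (y j) s (p 0) - initProd β x s (p 0)))) fun i j =>
          (1 + β * y j) ^ (m - 1 - (i : ℕ)) *
            gapValue β x s (p i.castSucc.castSucc) (p i.castSucc.succ) (y j) :
              Fin (m + 1) → Fin (m + 1) → A)) =
          Matrix.of fun i j => (Fin.cons (fun z => (1 + β * x) * ((1 + β * z) ^ m *
          (initProd β z s (p 0) - initProd β x s (p 0)))) (fun i z =>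
          (1 + β * z) ^ (m - 1 - (i : ℕ)) *
            gapValue β x s (p i.castSucc.castSucc) (p i.castSucc.succ) z) :
              Fin (m + 1) → A → A) i (y j) := by
        ext i j
        rcases Fin.eq_zero_or_eq_succ i with rfl | ⟨i, rfl⟩ <;> simp
      rw [hcongr, det_fns]
      refine Finset.sum_congr rfl fun σ _ => ?_
      rw [hcons, (monodromySum_one β x s b hne).2, h2, h2, h3, dropLast_ofFn, evalProd_ofFn,
        Fin.prod_univ_succ, Fin.prod_univ_succ]
      simp only [Fin.cons_zero, Fin.cons_succ, Finset.prod_mul_distrib, Fin.val_zero, Fin.val_succ,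
        Nat.add_sub_cancel, Nat.sub_zero, gapValue]
      have h5 : ∀ i : Fin m, m - ((i : ℕ) + 1) = m - 1 - i := fun i => by omega
      simp only [h5]
      ring
  -- `A` and `D` preserve the number of letters `1`, so with the wrong number both sides vanish.
  · rw [altSum_eq_zero β s y hp hm, mul_zero, Finset.sum_eq_zero, Finset.sum_eq_zero]
    · simp
    · intro σ _
      rw [hcons]
      by_cases hnil : gapFns β x s b = []
      · rw [(monodromySum_one_of_nil β x s b hnil).2]; simp
      · rw [(monodromySum_one β x s b hnil).2, evalProd_eq_zero, mul_zero, mul_zero, mul_zero]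
        rw [h3]
        have hm' : m' ≠ 0 := by
          rintro rfl; exact hnil (by simpa using h3)
        simp only [List.length_dropLast, List.length_ofFn]
        omega
    · intro σ _
      rw [(monodromySum_zero β x s b).1, evalProd_eq_zero, mul_zero, mul_zero, mul_zero]
      rw [h3]
      simpa using hm

end Amplitudes

/-! ### Transposition of the `L`-operators and reversal of the chain. -/

section Reversal

variable {A : Type*} [CommRing A]

theorem transfer_last (β : A) {N : ℕ} (X : Fin (N + 1) → A) (b' b : Fin (N + 1) → Fin 2) :
    transfer β X b' b = localWeight β (X (Fin.last N)) (b' (Fin.last N)) (b (Fin.last N)) *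
      transfer β (fun i : Fin N => X i.castSucc) (fun i => b' i.castSucc)
        (fun i => b i.castSucc) := by
  induction N with
  | zero => simp [transfer]
  | succ N ih =>
    rw [transfer, ih, transfer, mul_assoc]
    rfl

/-- The weights are symmetric under simultaneous transposition of the site and the auxiliary space,
except for the entry `1 + β (x ⊕ s) = (1 + β x)(1 + β s)`. Its two factors are absorbed by diagonal
rescalings of the two spaces. -/
theorem localWeight_transpose (β x s : A) (b' b c a : Fin 2) :
    (if b = 1 then 1 + β * s else 1) * (1 + β * x) ^ (c : ℕ) *
        localWeight β (oplus β x s) b' b c a =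
      (if b' = 1 then 1 + β * s else 1) * (1 + β * x) ^ (a : ℕ) *
        localWeight β (oplus β x s) b b' a c := by
  have key : ∀ w : Fin 2, w = 0 ∨ w = 1 := by decide
  rcases key b with rfl | rfl <;> rcases key b' with rfl | rfl <;> rcases key c with rfl | rfl <;>
    rcases key a with rfl | rfl <;> simp [localWeight, oplus] <;> ring

/-- `∏ (1 + β s_j)` over the places `j` of the letter `1`. -/
def placeProd (β : A) {N : ℕ} (s : Fin N → A) (b : Fin N → Fin 2) : A :=
  ∏ j, if b j = 1 then 1 + β * s j else 1

/-- Transposing a product reverses its order, hence the reversed sites. The auxiliary rescalings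
telescope and survive only at the two ends. -/
theorem transfer_rev (β x : A) {N : ℕ} (s : Fin N → A) (b' b : Fin N → Fin 2) (c a : Fin 2) :
    placeProd β s b * (1 + β * x) ^ (c : ℕ) *
        transfer β (fun j => oplus β x (s j)) b' b c a =
      placeProd β s b' * (1 + β * x) ^ (a : ℕ) *
        transfer β (fun j => oplus β x (s (Fin.rev j))) (fun j => b (Fin.rev j))
          (fun j => b' (Fin.rev j)) a c := by
  induction N generalizing c a with
  | zero =>
    by_cases h : c = a
    · subst h; simp [placeProd, transfer]
    · simp [placeProd, transfer, h, Ne.symm h]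
  | succ N ih =>
    rw [transfer_last β (fun j => oplus β x (s (Fin.rev j)))]
    simp only [transfer, Fin.rev_last, Fin.rev_castSucc, Matrix.mul_apply, Finset.mul_sum]
    refine Finset.sum_congr rfl fun e _ => ?_
    have h1 := ih (Fin.tail s) (Fin.tail b') (Fin.tail b) c e
    have h2 := localWeight_transpose β x (s 0) (b' 0) (b 0) e a
    have hp : ∀ b : Fin (N + 1) → Fin 2, placeProd β s b =
        (if b 0 = 1 then 1 + β * s 0 else 1) * placeProd β (Fin.tail s) (Fin.tail b) := fun b => by
      rw [placeProd, Fin.prod_univ_succ]; rfl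
    rw [hp, hp]
    simp only [Fin.tail_def] at h1 ⊢
    linear_combination (if b 0 = 1 then 1 + β * s 0 else 1) *
        localWeight β (oplus β x (s 0)) (b' 0) (b 0) e a * h1 +
      placeProd β (fun i : Fin N => s i.succ) (fun i => b' i.succ) *
        transfer β (fun j : Fin N => oplus β x (s (Fin.rev j).succ)) (fun j => b (Fin.rev j).succ)
          (fun j => b' (Fin.rev j).succ) e c * h2

theorem sum_rev {M : Type*} [AddCommMonoid M] {N : ℕ} (F : (Fin N → Fin 2) → M) :
    ∑ b : Fin N → Fin 2, F (fun j => b (Fin.rev j)) = ∑ b, F b :=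
  Equiv.sum_comp (Equiv.arrowCongr Fin.revPerm (Equiv.refl (Fin 2))) F

/-- The coefficient of `v_b` in `B(y_m) ⋯ B(y_1) v_0`, with weights `y ⊕ s_j`. -/
def creation (β : A) {N : ℕ} (s : Fin N → A) : {m : ℕ} → (Fin m → A) → (Fin N → Fin 2) → A
  | 0, _, b => if b = 0 then 1 else 0
  | m + 1, y, b => ∑ b', transfer β (fun j => oplus β (y (Fin.last m)) (s j)) b b' 0 1 *
      creation β s (fun i : Fin m => y i.castSucc) b'

/-- Transposition exchanges `B` and `C`, so creating on the chain is annihilating on the reversed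
one. Each `B(y_i)` contributes a factor `1 + β y_i`. -/
theorem creation_eq (β : A) {N : ℕ} (s : Fin N → A) {m : ℕ} (y : Fin m → A) (b : Fin N → Fin 2) :
    creation β s y b = bigPi β y * placeProd β s b *
      amplitude β (fun j => s (Fin.rev j)) y (fun j => b (Fin.rev j)) := by
  induction m generalizing b with
  | zero =>
    by_cases h : b = 0
    · subst h
      have : (fun _ => 0 : Fin N → Fin 2) = 0 := rfl
      simp [creation, amplitude, bigPi, placeProd, this]
    · have : (fun j => b (Fin.rev j)) ≠ 0 := fun h' => h (by
        funext j; simpa using congrFun h' (Fin.rev j))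
      simp [creation, amplitude, h, this]
  | succ m ih =>
    rw [creation, amplitude, ← sum_rev, Finset.mul_sum]
    refine Finset.sum_congr rfl fun b' _ => ?_
    rw [ih]
    have h := transfer_rev β (y (Fin.last m)) s b (fun j => b' (Fin.rev j)) 0 1
    simp only [Fin.val_zero, pow_zero, mul_one, Fin.val_one, pow_one, Fin.rev_rev] at h
    have hPi : bigPi β y = bigPi β (fun i : Fin m => y i.castSucc) * (1 + β * y (Fin.last m)) := by
      rw [bigPi, Fin.prod_univ_castSucc]; rfl
    rw [hPi]
    simp only [Fin.rev_rev]
    linear_combination bigPi β (fun i : Fin m => y i.castSucc) *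
      amplitude β (fun j => s (Fin.rev j)) (fun i : Fin m => y i.castSucc) b' * h

theorem sum_transfer_mul_creation [IsDomain A] (β x q : A) (hx : 1 + β * x ≠ 0) {N : ℕ}
    (s : Fin N → A) {m : ℕ}
    (y : Fin (m + 1) → A) (hinj : Function.Injective y) (hy : ∀ i, 1 + β * y i ≠ 0)
    (hB : ∀ i, (∏ j, oplus β (y i) (s j)) * bigPi β y =
      (-1) ^ m * q * (1 + β * y i) ^ (m + 1)) (b' : Fin N → Fin 2) :
    (∏ i, (y i - x)) * ∑ b, (transfer β (fun j => oplus β x (s j)) b' b 0 0 +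
        q * transfer β (fun j => oplus β x (s j)) b' b 1 1) * creation β s y b =
      ((-1) ^ (m + 1) * bigPi β y * (∏ j, oplus β x (s j)) + q * (1 + β * x) ^ (m + 1)) *
        creation β s y b' := by
  have hrev : ∀ z, ∏ j, oplus β z (s (Fin.rev j)) = ∏ j, oplus β z (s j) := fun z =>
    Equiv.prod_comp Fin.revPerm fun j => oplus β z (s j)
  have h := sum_transfer_mul_amplitude β x q (fun j => s (Fin.rev j)) y hinj hy
    (fun i => by rw [hrev]; exact hB i) (fun j => b' (Fin.rev j))
  rw [hrev, ← sum_rev] at h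
  have hterm : ∀ b, (transfer β (fun j => oplus β x (s j)) b' b 0 0 +
        q * transfer β (fun j => oplus β x (s j)) b' b 1 1) * creation β s y b =
      bigPi β y * placeProd β s b' *
        ((transfer β (fun j => oplus β x (s (Fin.rev j))) (fun j => b (Fin.rev j))
          (fun j => b' (Fin.rev j)) 0 0 +
        q * transfer β (fun j => oplus β x (s (Fin.rev j))) (fun j => b (Fin.rev j))
          (fun j => b' (Fin.rev j)) 1 1) * amplitude β (fun j => s (Fin.rev j)) y
            (fun j => b (Fin.rev j))) := by
    intro b
    have h0 := transfer_rev β x s b' b 0 0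
    have h1 := transfer_rev β x s b' b 1 1
    simp only [Fin.val_zero, pow_zero, mul_one, Fin.val_one, pow_one] at h0 h1
    have h1' : placeProd β s b * transfer β (fun j => oplus β x (s j)) b' b 1 1 =
        placeProd β s b' * transfer β (fun j => oplus β x (s (Fin.rev j)))
          (fun j => b (Fin.rev j)) (fun j => b' (Fin.rev j)) 1 1 :=
      mul_left_cancel₀ hx (by linear_combination h1)
    rw [creation_eq]
    linear_combination bigPi β y * amplitude β (fun j => s (Fin.rev j)) y
      (fun j => b (Fin.rev j)) * (h0 + q * h1')
  rw [Finset.sum_congr rfl fun b _ => hterm b, ← Finset.mul_sum, creation_eq]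
  linear_combination bigPi β y * placeProd β s b' * h

/-- The usual argument for eigenvectors with distinct eigenvalues, with denominators cleared. At
this `x` the cleared eigenvalue reduces to `q (1 + β x) ^ (m + 1)`, the same for `y` and `y'`.
Evaluating the matrix element of `A + q D` from the left and from the right then shows that it is
killed by the difference of the two products, hence is zero, and with it the pairing. -/
theorem sum_amplitude_mul_creation_eq_zero [IsDomain A] (β x q : A) (hx : 1 + β * x ≠ 0)
    (hq : q ≠ 0) {N : ℕ} (s : Fin N → A) (hs : ∏ j, oplus β x (s j) = 0) {m : ℕ}
    (y y' : Fin (m + 1) → A)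
    (hinj : Function.Injective y) (hy : ∀ i, 1 + β * y i ≠ 0)
    (hB : ∀ i, (∏ j, oplus β (y i) (s j)) * bigPi β y =
      (-1) ^ m * q * (1 + β * y i) ^ (m + 1))
    (hinj' : Function.Injective y') (hy' : ∀ i, 1 + β * y' i ≠ 0)
    (hB' : ∀ i, (∏ j, oplus β (y' i) (s j)) * bigPi β y' =
      (-1) ^ m * q * (1 + β * y' i) ^ (m + 1))
    (hne : ∏ i, (y i - x) ≠ ∏ i, (y' i - x)) :
    ∑ b, amplitude β s y b * creation β s y' b = 0 := by
  have h1 := sum_transfer_mul_amplitude β x q s y hinj hy hB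
  have h2 := sum_transfer_mul_creation β x q hx s y' hinj' hy' hB'
  rw [hs, mul_zero, zero_add] at h1 h2
  set T : (Fin N → Fin 2) → (Fin N → Fin 2) → A := fun b' b =>
    transfer β (fun j => oplus β x (s j)) b' b 0 0 +
        q * transfer β (fun j => oplus β x (s j)) b' b 1 1 with hT
  have hμ : q * (1 + β * x) ^ (m + 1) ≠ 0 := mul_ne_zero hq (pow_ne_zero _ hx)
  have e1 : (∏ i, (y i - x)) * ∑ b', ∑ b, amplitude β s y b' * T b' b * creation β s y' b =
      q * (1 + β * x) ^ (m + 1) * ∑ b, amplitude β s y b * creation β s y' b := by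
    rw [Finset.sum_comm, Finset.mul_sum, Finset.mul_sum]
    refine Finset.sum_congr rfl fun b _ => ?_
    rw [← mul_assoc, ← h1 b, mul_assoc, Finset.sum_mul]
    congr 1
    exact Finset.sum_congr rfl fun b' _ => by ring
  have e2 : (∏ i, (y' i - x)) * ∑ b', ∑ b, amplitude β s y b' * T b' b * creation β s y' b =
      q * (1 + β * x) ^ (m + 1) * ∑ b, amplitude β s y b * creation β s y' b := by
    rw [Finset.mul_sum, Finset.mul_sum]
    refine Finset.sum_congr rfl fun b' _ => ?_
    rw [mul_left_comm, ← h2 b', Finset.mul_sum, Finset.mul_sum, Finset.mul_sum]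
    exact Finset.sum_congr rfl fun b _ => by ring
  have e3 : ((∏ i, (y i - x)) - ∏ i, (y' i - x)) *
      ∑ b', ∑ b, amplitude β s y b' * T b' b * creation β s y' b = 0 := by
    linear_combination e1 - e2
  rcases mul_eq_zero.1 e3 with h | h
  · exact absurd (sub_eq_zero.1 h) hne
  · rw [h, mul_zero] at e1
    exact (mul_eq_zero.1 e1.symm).resolve_left hμ

theorem ominus_eq_oplus_oneg (β x t : A) (ht : IsUnit (1 + β * t)) :
    ominus β x t = oplus β x (oneg β t) := by
  have h := Ring.mul_inverse_cancel _ ht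
  simp only [ominus, oplus, oneg, quo]
  linear_combination (x) * h

theorem one_add_mul_oneg (β t : A) (ht : IsUnit (1 + β * t)) :
    (1 + β * oneg β t) * (1 + β * t) = 1 := by
  have h := Ring.mul_inverse_cancel _ ht
  simp only [oneg, ominus, quo]
  linear_combination (-β * t) * h

theorem betheVector_eq_creation (β : A) (N : ℕ) (t : ℤ → A) (ht : ∀ j, IsUnit (1 + β * t j))
    {m : ℕ} (y : Fin m → A) (b : Fin N → Fin 2) :
    betheVector β N t y b = creation β (fun j : Fin N => oneg β (t ((j : ℕ) + 1))) y b := by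
  induction m generalizing b with
  | zero =>
    have h0 : (fun _ => 0 : Fin N → Fin 2) = 0 := rfl
    simp [betheVector, creation, tensorVec, Pi.single_apply, h0]
  | succ m ih =>
    rw [betheVector, List.ofFn_succ_last, List.reverse_append, List.prod_append, creation]
    simp only [List.reverse_cons, List.reverse_nil, List.nil_append, List.prod_cons, List.prod_nil,
      mul_one, Module.End.mul_apply]
    rw [opB, monodromy_apply]
    refine Finset.sum_congr rfl fun b' _ => ?_
    rw [← ih]
    simp only [ominus_eq_oplus_oneg β _ _ (ht _)]
    rfl

theorem prod_opC_apply (β : A) (N : ℕ) (t : ℤ → A) (ht : ∀ j, IsUnit (1 + β * t j))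
    {m : ℕ} (x : Fin m → A) (v : QuantumSpace N A) :
    (List.ofFn fun i => opC β N t (x i)).prod v (fun _ => 0) =
      ∑ b, amplitude β (fun j : Fin N => oneg β (t ((j : ℕ) + 1))) x b * v b := by
  induction m generalizing v with
  | zero =>
    have h0 : (fun _ => 0 : Fin N → Fin 2) = 0 := rfl
    simp [amplitude, h0]
  | succ m ih =>
    rw [List.ofFn_succ_last, List.prod_append]
    simp only [List.prod_cons, List.prod_nil, mul_one, Module.End.mul_apply]
    rw [ih]
    simp only [amplitude, opC, monodromy_apply, Finset.mul_sum, Finset.sum_mul]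
    rw [Finset.sum_comm]
    refine Finset.sum_congr rfl fun b _ => Finset.sum_congr rfl fun b' _ => ?_
    simp only [ominus_eq_oplus_oneg β _ _ (ht _)]
    ring

theorem normElement_eq_sum (β : A) (N : ℕ) (t : ℤ → A) (ht : ∀ j, IsUnit (1 + β * t j))
    {m : ℕ} (x y : Fin m → A) :
    normElement β N t x y =
      ∑ b, amplitude β (fun j : Fin N => oneg β (t ((j : ℕ) + 1))) x b *
        creation β (fun j : Fin N => oneg β (t ((j : ℕ) + 1))) y b := by
  rw [normElement, prod_opC_apply β N t ht]
  simp only [betheVector_eq_creation β N t ht]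

end Reversal

/-! ### Set-valued tableaux and the branching rule. -/

section Tableaux

open Classical in
theorem prod_fin_ite {A : Type*} [CommMonoid A] (K : ℕ) (f : ℕ → A) (a b : ℕ) (hb : b ≤ K) :
    ∏ j : Fin K, (if a ≤ (j : ℕ) ∧ (j : ℕ) < b then f j else 1) = ∏ j ∈ Finset.Ico a b, f j := by
  rw [Fin.prod_univ_eq_prod_range (fun j => if a ≤ j ∧ j < b then f j else 1) K,
    ← Finset.prod_filter]
  refine Finset.prod_congr ?_ fun _ _ => rfl
  ext j
  simp only [Finset.mem_filter, Finset.mem_range, Finset.mem_Ico]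
  omega

variable {n k : ℕ}

/-- The row below row `i`; it is empty for the last row. -/
def rowBelow (l : Fin n → ℕ) (i : Fin n) : ℕ := if h : (i : ℕ) + 1 < n then l ⟨i + 1, h⟩ else 0

theorem rowBelow_eq (l : Fin n → ℕ) {i i' : Fin n} (h : (i' : ℕ) = i + 1) :
    rowBelow l i = l i' := by
  have h1 : (i : ℕ) + 1 < n := h ▸ i'.2
  rw [rowBelow, dif_pos h1]
  congr 1
  exact Fin.ext h.symm

/-- Set-valued tableaux of shape `l` whose entries are among the first `m` letters. -/
structure IsTableau (m : ℕ) (l : Fin n → ℕ) (T : Fin n → Fin k → Finset (Fin n)) : Prop where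
  shape : ∀ i j, (T i j).Nonempty ↔ (j : ℕ) < l i
  row : ∀ (i : Fin n) (j j' : Fin k), (j' : ℕ) = j + 1 → ∀ a ∈ T i j, ∀ b ∈ T i j', a ≤ b
  col : ∀ (i i' : Fin n) (j : Fin k), (i' : ℕ) = i + 1 → ∀ a ∈ T i j, ∀ b ∈ T i' j, a < b
  lt : ∀ i j, ∀ r ∈ T i j, (r : ℕ) < m

/-- The tableau obtained from `T` of shape `μ` by putting the letter `L` into the boxes of `l / μ`
and into the last boxes of the rows in `c`. -/
def addLetter (L : Fin n) (l μ : Fin n → ℕ) (T : Fin n → Fin k → Finset (Fin n))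
    (c : Finset (Fin n)) (i : Fin n) (j : Fin k) : Finset (Fin n) :=
  if (μ i ≤ j ∧ (j : ℕ) < l i) ∨ (i ∈ c ∧ (j : ℕ) + 1 = μ i) then insert L (T i j) else T i j

theorem mem_addLetter {L : Fin n} {l μ : Fin n → ℕ} {T : Fin n → Fin k → Finset (Fin n)}
    {c : Finset (Fin n)} {i : Fin n} {j : Fin k} {a : Fin n} :
    a ∈ addLetter L l μ T c i j ↔
      (a = L ∧ ((μ i ≤ j ∧ (j : ℕ) < l i) ∨ (i ∈ c ∧ (j : ℕ) + 1 = μ i))) ∨ a ∈ T i j := by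
  unfold addLetter
  split_ifs with h <;> simp [h]

/-- The rows of `μ` to whose last box a letter larger than all entries can be added. -/
def corners (l μ : Fin n → ℕ) : Finset (Fin n) := Finset.univ.filter fun i => rowBelow l i < μ i

/-- The interlacing of `l` and `μ` says that no two boxes of `l / μ` lie in one column. A row in
`corners` has no box of `l` below its last box of `μ`, so the largest letter may be added there as
well. -/
theorem IsTableau.addLetter {m : ℕ} {L : Fin n} (hL : (L : ℕ) = m) {l μ : Fin n → ℕ}
    {T : Fin n → Fin k → Finset (Fin n)} (hT : IsTableau m μ T) {c : Finset (Fin n)}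
    (hμ : ∀ i, rowBelow l i ≤ μ i ∧ μ i ≤ l i) (hc : c ⊆ corners l μ) :
    IsTableau (m + 1) l (addLetter L l μ T c) := by
  have hshape : ∀ i j, (BetheSchubert.addLetter L l μ T c i j).Nonempty ↔ (j : ℕ) < l i := by
    intro i j
    have h1 := hT.shape i j
    have h2 := hμ i
    unfold BetheSchubert.addLetter
    split_ifs with h
    · simp only [Finset.insert_nonempty, true_iff]; omega
    · rw [h1]; push Not at h; omega
  refine ⟨hshape, ?_, ?_, ?_⟩
  · intro i j j' hj a ha b hb
    rw [mem_addLetter] at ha hb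
    rcases hb with ⟨rfl, -⟩ | hb
    · rcases ha with ⟨rfl, -⟩ | ha
      · exact le_rfl
      · have := hT.lt i j a ha
        rw [Fin.le_def]; omega
    · have h1 := (hT.shape i j').1 ⟨b, hb⟩
      rcases ha with ⟨rfl, h⟩ | ha
      · omega
      · exact hT.row i j j' hj a ha b hb
  · intro i i' j hi a ha b hb
    have hb' := (hshape i' j).1 ⟨b, hb⟩
    rw [mem_addLetter] at ha hb
    have h1 := rowBelow_eq l hi
    have h2 := hμ i
    rcases ha with ⟨rfl, h | ⟨h, h'⟩⟩ | ha
    · omega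
    · have := (Finset.mem_filter.1 (hc h)).2
      omega
    · rcases hb with ⟨rfl, -⟩ | hb
      · have := hT.lt i j a ha
        rw [Fin.lt_def]; omega
      · exact hT.col i i' j hi a ha b hb
  · intro i j r hr
    rw [mem_addLetter] at hr
    rcases hr with ⟨rfl, -⟩ | hr
    · omega
    · have := hT.lt i j r hr; omega

theorem exists_lt_iff (P : Fin k → Prop) (hP : ∀ j j' : Fin k, (j' : ℕ) = j + 1 → P j' → P j) :
    ∃ μ, μ ≤ k ∧ ∀ j, P j ↔ (j : ℕ) < μ := by
  classical
  by_cases h : ∃ μ, ∃ hμ : μ < k, ¬ P ⟨μ, hμ⟩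
  · refine ⟨Nat.find h, (Nat.find_spec h).1.le, fun j => ⟨fun hj => ?_, fun hj => ?_⟩⟩
    · by_contra hlt
      push Not at hlt
      have key : ∀ d : ℕ, ∀ j : Fin k, (j : ℕ) = Nat.find h + d → ¬ P j := by
        intro d
        induction d with
        | zero =>
          intro j hj hPj
          obtain ⟨h1, h2⟩ := Nat.find_spec h
          exact h2 (by convert hPj using 1; exact Fin.ext hj.symm)
        | succ d ih =>
          intro j hj hPj
          exact ih ⟨Nat.find h + d, by omega⟩ rfl (hP _ j (by simp only; omega) hPj)
      exact key (j - Nat.find h) j (by omega) hj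
    · have := Nat.find_min h hj
      push Not at this
      exact this j.2
  · push Not at h
    exact ⟨k, le_rfl, fun j => ⟨fun _ => j.2, fun _ => h j j.2⟩⟩

/-- Erasing the largest letter everywhere inverts the construction: `μ` is the shape of the boxes
that stay nonempty, and `c` records the rows in which the erased letter shared a box with smaller
ones. -/
theorem IsTableau.exists_addLetter {m : ℕ} {L : Fin n} (hL : (L : ℕ) = m) {l : Fin n → ℕ}
    (hl : Antitone l) (hk : ∀ i, l i ≤ k)
    {T : Fin n → Fin k → Finset (Fin n)} (hT : IsTableau (m + 1) l T) :
    ∃ (μ : Fin n → ℕ) (T' : Fin n → Fin k → Finset (Fin n)) (c : Finset (Fin n)),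
      (∀ i, rowBelow l i ≤ μ i ∧ μ i ≤ l i) ∧ IsTableau m μ T' ∧ c ⊆ corners l μ ∧
        BetheSchubert.addLetter L l μ T' c = T := by
  have hle : ∀ i j, ∀ r ∈ T i j, r ≤ L := fun i j r hr => by
    have := hT.lt i j r hr; rw [Fin.le_def]; omega
  have hmem : ∀ i j r, r ∈ (T i j).erase L ↔ r ∈ T i j ∧ (r : ℕ) < m := by
    intro i j r
    rw [Finset.mem_erase]
    constructor
    · rintro ⟨h1, h2⟩
      have h3 := hle i j r h2
      have h4 : (r : ℕ) ≠ L := fun h => h1 (Fin.ext h)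
      rw [Fin.le_def] at h3
      exact ⟨h2, by omega⟩
    · rintro ⟨h1, h2⟩
      exact ⟨fun h => by subst h; omega, h1⟩
  -- A letter smaller than `L` forces smaller letters in the box to its left, so the surviving boxes
  -- of a row form an initial segment.
  have hex : ∀ i, ∃ μ, μ ≤ k ∧ ∀ j : Fin k, ((T i j).erase L).Nonempty ↔ (j : ℕ) < μ := by
    intro i
    refine exists_lt_iff _ fun j j' hj => ?_
    rintro ⟨b, hb⟩
    rw [hmem] at hb
    have h1 := (hT.shape i j').1 ⟨b, hb.1⟩
    obtain ⟨a, ha⟩ := (hT.shape i j).2 (by omega)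
    have h2 := hT.row i j j' hj a ha b hb.1
    rw [Fin.le_def] at h2
    exact ⟨a, (hmem i j a).2 ⟨ha, by omega⟩⟩
  choose μ hμk hμ using hex
  have hbounds : ∀ i, rowBelow l i ≤ μ i ∧ μ i ≤ l i := by
    intro i
    constructor
    · by_contra hlt
      push Not at hlt
      have hi : (i : ℕ) + 1 < n := by
        by_contra h
        rw [rowBelow, dif_neg h] at hlt
        omega
      have h1 : rowBelow l i = l ⟨i + 1, hi⟩ := rowBelow_eq l rfl
      have h2 := hl (show i ≤ ⟨i + 1, hi⟩ from by rw [Fin.le_def]; simp)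
      have h3 := hk ⟨i + 1, hi⟩
      have hj : μ i < k := by omega
      obtain ⟨b, hb⟩ := (hT.shape ⟨i + 1, hi⟩ ⟨μ i, hj⟩).2 (by simp only; omega)
      obtain ⟨a, ha⟩ := (hT.shape i ⟨μ i, hj⟩).2 (by simp only; omega)
      have h4 := hT.col i ⟨i + 1, hi⟩ ⟨μ i, hj⟩ rfl a ha b hb
      have h5 := hT.lt _ _ b hb
      rw [Fin.lt_def] at h4
      have := (hμ i ⟨μ i, hj⟩).1 ⟨a, (hmem _ _ a).2 ⟨ha, by omega⟩⟩
      simp at this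
    · by_contra hlt
      push Not at hlt
      have h1 := hμk i
      obtain ⟨a, ha⟩ := (hμ i ⟨l i, by omega⟩).2 hlt
      have := (hT.shape i ⟨l i, by omega⟩).1 ⟨a, ((hmem _ _ a).1 ha).1⟩
      simp at this
  let c : Finset (Fin n) := Finset.univ.filter fun i => ∃ j : Fin k, (j : ℕ) + 1 = μ i ∧ L ∈ T i j
  refine ⟨μ, fun i j => (T i j).erase L, c, hbounds, ⟨hμ, ?_, ?_, ?_⟩, ?_, ?_⟩
  · intro i j j' hj a ha b hb
    exact hT.row i j j' hj a (Finset.mem_of_mem_erase ha) b (Finset.mem_of_mem_erase hb)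
  · intro i i' j hi a ha b hb
    exact hT.col i i' j hi a (Finset.mem_of_mem_erase ha) b (Finset.mem_of_mem_erase hb)
  · intro i j r hr
    exact ((hmem i j r).1 hr).2
  · intro i hi
    obtain ⟨j, hj, hLj⟩ := (Finset.mem_filter.1 hi).2
    refine Finset.mem_filter.2 ⟨Finset.mem_univ _, ?_⟩
    by_contra hlt
    push Not at hlt
    have hi' : (i : ℕ) + 1 < n := by
      by_contra h
      rw [rowBelow, dif_neg h] at hlt
      omega
    have h1 : rowBelow l i = l ⟨i + 1, hi'⟩ := rowBelow_eq l rfl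
    obtain ⟨b, hb⟩ := (hT.shape ⟨i + 1, hi'⟩ j).2 (by omega)
    have h4 := hT.col i ⟨i + 1, hi'⟩ j rfl L hLj b hb
    exact absurd (hle _ _ b hb) (not_le.2 h4)
  · funext i j
    ext a
    rw [mem_addLetter]
    by_cases ha : a = L
    · subst ha
      simp only [true_and, Finset.mem_erase, ne_eq, not_true_eq_false, false_and, or_false]
      constructor
      · rintro (⟨h1, h2⟩ | ⟨h1, h2⟩)
        · obtain ⟨b, hb⟩ := (hT.shape i j).2 h2
          by_cases hba : b = a
          · exact hba ▸ hb
          · have := (hμ i j).1 ⟨b, Finset.mem_erase.2 ⟨hba, hb⟩⟩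
            omega
        · obtain ⟨j', hj', h3⟩ := (Finset.mem_filter.1 h1).2
          obtain rfl : j' = j := Fin.ext (by omega)
          exact h3
      · intro h
        have h1 := (hT.shape i j).1 ⟨a, h⟩
        by_cases h2 : μ i ≤ j
        · exact Or.inl ⟨h2, h1⟩
        · have h3 : (j : ℕ) + 1 = μ i := by
            by_contra hne
            have h4 := hμk i
            obtain ⟨b, hb⟩ := (hμ i ⟨j + 1, by omega⟩).2 (by simp only; omega)
            obtain ⟨hb1, hb2⟩ := (hmem _ _ _).1 hb
            have h5 := hT.row i j ⟨j + 1, by omega⟩ rfl a h b hb1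
            rw [Fin.le_def] at h5
            omega
          exact Or.inr ⟨Finset.mem_filter.2 ⟨Finset.mem_univ _, j, h3, h⟩, h3⟩
    · simp [ha]

variable {A : Type*} [CommRing A]

/-- The weight of a set-valued tableau, box by box. -/
def tableauWeight (β : A) (X : Fin n → Fin n → ℕ → A) (T : Fin n → Fin k → Finset (Fin n)) : A :=
  ∏ i, ∏ j : Fin k, (β ^ ((T i j).card - 1) * ∏ r ∈ T i j, X r i j)

open Classical in
/-- The sum of the weights of the set-valued tableaux of shape `l` in the first `m` letters. -/
noncomputable def tableauSum (β : A) (X : Fin n → Fin n → ℕ → A) (k m : ℕ) (l : Fin n → ℕ) : A :=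
  ∑ T ∈ Finset.univ.filter (fun T : Fin n → Fin k → Finset (Fin n) => IsTableau m l T),
    tableauWeight β X T

/-- A box of `l / μ` holds the new letter alone and costs no `β`; a box selected by `c` gains one
entry beyond its first and costs one. -/
theorem tableauWeight_addLetter (β : A) (X : Fin n → Fin n → ℕ → A) {m : ℕ} {L : Fin n}
    (hL : (L : ℕ) = m) {l μ : Fin n → ℕ} {T : Fin n → Fin k → Finset (Fin n)}
    (hT : IsTableau m μ T) {c : Finset (Fin n)}
    (hμ : ∀ i, rowBelow l i ≤ μ i ∧ μ i ≤ l i) (hk : ∀ i, l i ≤ k) (hc : c ⊆ corners l μ) :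
    tableauWeight β X (addLetter L l μ T c) = tableauWeight β X T *
      (∏ i, ∏ j ∈ Finset.Ico (μ i) (l i), X L i j) * ∏ i ∈ c, β * X L i (μ i - 1) := by
  have hLT : ∀ i j, L ∉ T i j := fun i j h => by have := hT.lt i j L h; omega
  have hbox : ∀ i (j : Fin k), β ^ ((addLetter L l μ T c i j).card - 1) *
      ∏ r ∈ addLetter L l μ T c i j, X r i j =
      (β ^ ((T i j).card - 1) * ∏ r ∈ T i j, X r i j) *
        (if μ i ≤ (j : ℕ) ∧ (j : ℕ) < l i then X L i j else 1) *
        (if i ∈ c ∧ (j : ℕ) + 1 = μ i then β * X L i j else 1) := by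
    intro i j
    have hs := hT.shape i j
    by_cases h1 : μ i ≤ (j : ℕ) ∧ (j : ℕ) < l i
    · have h2 : ¬ (i ∈ c ∧ (j : ℕ) + 1 = μ i) := fun h => by omega
      have h3 : T i j = ∅ := by
        rw [← Finset.not_nonempty_iff_eq_empty, hs]; omega
      simp [addLetter, h1, h2, h3]
    · by_cases h2 : i ∈ c ∧ (j : ℕ) + 1 = μ i
      · have h3 : (T i j).Nonempty := hs.2 (by omega)
        have h4 : (T i j).card = (T i j).card - 1 + 1 := by
          have := h3.card_pos; omega
        rw [addLetter, if_pos (Or.inr h2), if_neg h1, if_pos h2,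
          Finset.card_insert_of_notMem (hLT i j), Finset.prod_insert (hLT i j),
          Nat.add_sub_cancel]
        nth_rw 1 [h4]
        rw [pow_succ]
        ring
      · rw [addLetter, if_neg (not_or.2 ⟨h1, h2⟩), if_neg h1, if_neg h2, mul_one, mul_one]
  have hcor : ∀ i, ∏ j : Fin k, (if i ∈ c ∧ (j : ℕ) + 1 = μ i then β * X L i j else 1) =
      if i ∈ c then β * X L i (μ i - 1) else 1 := by
    intro i
    split_ifs with hi
    · have h1 := (Finset.mem_filter.1 (hc hi)).2
      have h2 := hμ i
      have h3 := hk i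
      rw [Finset.prod_eq_single (⟨μ i - 1, by omega⟩ : Fin k)]
      · rw [if_pos ⟨hi, by simp only; omega⟩]
      · intro j _ hj
        rw [if_neg]
        rintro ⟨-, h⟩
        exact hj (Fin.ext (by simp only; omega))
      · simp
    · simp [hi]
  unfold tableauWeight
  simp only [hbox, Finset.prod_mul_distrib, hcor, prod_fin_ite k (X L _) _ _ (hk _)]
  congr 1
  rw [Finset.prod_ite_mem, Finset.univ_inter, Finset.prod_mul_distrib]

/-- The weight of a row with `a` boxes filled by smaller letters in the branching rule. -/
def rowWeight (β : A) (X : Fin n → Fin n → ℕ → A) (L : Fin n) (l : Fin n → ℕ) (i : Fin n)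
    (a : ℕ) : A :=
  (∏ j ∈ Finset.Ico a (l i), X L i j) * if rowBelow l i < a then 1 + β * X L i (a - 1) else 1

/-- The interlacing bounds on the rows of `μ` are independent of each other, so the sum runs over a
product of intervals and the weight factors over rows. This is what later lets the sum be taken
inside a determinant. -/
theorem tableauSum_succ (β : A) (X : Fin n → Fin n → ℕ → A) {m : ℕ} {L : Fin n}
    (hL : (L : ℕ) = m) {l : Fin n → ℕ} (hl : Antitone l) (hk : ∀ i, l i ≤ k) :
    tableauSum β X k (m + 1) l =
      ∑ μ ∈ Fintype.piFinset fun i => Finset.Icc (rowBelow l i) (l i),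
        (∏ i, rowWeight β X L l i (μ i)) * tableauSum β X k m μ := by
  classical
  have hmem : ∀ μ, (μ ∈ Fintype.piFinset fun i => Finset.Icc (rowBelow l i) (l i)) ↔
      ∀ i, rowBelow l i ≤ μ i ∧ μ i ≤ l i := by
    intro μ; simp [Fintype.mem_piFinset]
  have hrhs : ∀ μ ∈ Fintype.piFinset fun i => Finset.Icc (rowBelow l i) (l i),
      (∏ i, rowWeight β X L l i (μ i)) * tableauSum β X k m μ =
      ∑ Tc ∈ (Finset.univ.filter (fun T : Fin n → Fin k → Finset (Fin n) => IsTableau m μ T)) ×ˢ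
        (corners l μ).powerset, tableauWeight β X Tc.1 *
      (∏ i, ∏ j ∈ Finset.Ico (μ i) (l i), X L i j) * ∏ i ∈ Tc.2, β * X L i (μ i - 1) := by
    intro μ _
    rw [Finset.sum_product, tableauSum, Finset.mul_sum]
    refine Finset.sum_congr rfl fun T _ => ?_
    simp only
    -- Summing over the subsets `c` of the corners turns each factor `β X` into `1 + β X`.
    rw [← Finset.mul_sum, ← Finset.prod_one_add]
    simp only [rowWeight, Finset.prod_mul_distrib, corners, Finset.prod_filter]
    ring
  rw [Finset.sum_congr rfl hrhs, Finset.sum_sigma', tableauSum]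
  symm
  refine Finset.sum_bij (fun z _ => addLetter L l z.1 z.2.1 z.2.2) ?_ ?_ ?_ ?_
  · rintro ⟨μ, T, c⟩ h
    simp only [Finset.mem_sigma, Finset.mem_product, Finset.mem_filter, Finset.mem_univ, true_and,
      Finset.mem_powerset, hmem] at h ⊢
    exact h.2.1.addLetter hL h.1 h.2.2
  · rintro ⟨μ, T, c⟩ h ⟨μ', T', c'⟩ h' heq
    simp only [Finset.mem_sigma, Finset.mem_product, Finset.mem_filter, Finset.mem_univ, true_and,
      Finset.mem_powerset, hmem] at h h' heq
    have hT : T = T' := by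
      funext i j
      ext a
      have h1 : a ∈ addLetter L l μ T c i j ↔ a ∈ addLetter L l μ' T' c' i j := by rw [heq]
      rw [mem_addLetter, mem_addLetter] at h1
      by_cases ha : a = L
      · subst ha
        have h2 : a ∉ T i j := fun h3 => by have := h.2.1.lt i j a h3; omega
        have h3 : a ∉ T' i j := fun h3 => by have := h'.2.1.lt i j a h3; omega
        simp [h2, h3]
      · simpa [ha] using h1
    subst hT
    have hμ : μ = μ' := by
      funext i
      have h3 : ∀ j : Fin k, (j : ℕ) < μ i ↔ (j : ℕ) < μ' i := fun j => by
        rw [← h.2.1.shape, ← h'.2.1.shape]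
      have h4 := h.1 i
      have h5 := h'.1 i
      have h6 := hk i
      by_contra hne
      rcases Nat.lt_or_gt_of_ne hne with h7 | h7
      · have := h3 ⟨μ i, by omega⟩; simp only at this; omega
      · have := h3 ⟨μ' i, by omega⟩; simp only at this; omega
    subst hμ
    have hcc : ∀ c c' : Finset (Fin n), c ⊆ corners l μ →
        addLetter L l μ T c = addLetter L l μ T c' → c ⊆ c' := by
      intro c c' hc heq i hi
      have h1 := (Finset.mem_filter.1 (hc hi)).2
      have h4 := h.1 i
      have h6 := hk i
      have h2 : L ∈ addLetter L l μ T c i ⟨μ i - 1, by omega⟩ := by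
        rw [mem_addLetter]
        exact Or.inl ⟨rfl, Or.inr ⟨hi, by simp only; omega⟩⟩
      rw [heq, mem_addLetter] at h2
      rcases h2 with ⟨-, h2 | h2⟩ | h2
      · simp only at h2; omega
      · exact h2.1
      · have := h.2.1.lt _ _ _ h2; omega
    have : c = c' := Finset.Subset.antisymm (hcc c c' h.2.2 heq) (hcc c' c h'.2.2 heq.symm)
    subst this
    rfl
  · intro T hT
    simp only [Finset.mem_filter, Finset.mem_univ, true_and] at hT
    obtain ⟨μ, T', c, h1, h2, h3, h4⟩ := hT.exists_addLetter hL hl hk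
    refine ⟨⟨μ, T', c⟩, ?_, h4⟩
    simp only [Finset.mem_sigma, Finset.mem_product, Finset.mem_filter, Finset.mem_univ, true_and,
      Finset.mem_powerset, hmem]
    exact ⟨h1, h2, h3⟩
  · rintro ⟨μ, T, c⟩ h
    simp only [Finset.mem_sigma, Finset.mem_product, Finset.mem_filter, Finset.mem_univ, true_and,
      Finset.mem_powerset, hmem] at h
    exact (tableauWeight_addLetter β X hL h.2.1 h.1 hk h.2.2).symm

theorem grothendieck_eq_tableauSum (β : A) (l : BoxedPartition n k) (x : Fin n → A) (t : ℤ → A) :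
    grothendieck β l x t = tableauSum β (fun r i j =>
      oplus β (x r) (t (((r : ℕ) + 1 : ℤ) + ((j : ℕ) + 1 : ℤ) - ((i : ℕ) + 1 : ℤ)))) k n l.part := by
  classical
  have hiff : ∀ T : Fin n → Fin k → Finset (Fin n),
      IsSetValuedTableau l T ↔ IsTableau n l.part T := fun T =>
    ⟨fun h => ⟨h.1, h.2.1, h.2.2, fun _ _ r _ => r.2⟩, fun h => ⟨h.shape, h.row, h.col⟩⟩
  unfold grothendieck tableauSum
  refine Finset.sum_congr (Finset.filter_congr fun T _ => hiff T) fun T hT => ?_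
  have hT := (Finset.mem_filter.1 hT).2
  have hsize : l.size = ∑ i, ∑ j : Fin k, if (j : ℕ) < l.part i then 1 else 0 := by
    refine Finset.sum_congr rfl fun i _ => ?_
    rw [Fin.sum_univ_eq_sum_range (fun j => if j < l.part i then 1 else 0) k,
      ← Finset.sum_filter, Finset.sum_const, smul_eq_mul, mul_one]
    have h1 : l.part i ≤ k := Nat.lt_succ_iff.1 (l.1 i).2
    have : Finset.filter (fun j => j < l.part i) (Finset.range k) = Finset.range (l.part i) := by
      ext j; simp only [Finset.mem_filter, Finset.mem_range]; omega
    rw [this, Finset.card_range]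
  -- The truncated subtraction contributes nothing at an empty box, so the excess may be counted box
  -- by box.
  have hexp : (∑ i, ∑ j, (T i j).card) - l.size = ∑ i, ∑ j, ((T i j).card - 1) := by
    have : ∑ i, ∑ j, (T i j).card = ∑ i, ∑ j, ((T i j).card - 1) + l.size := by
      rw [hsize, ← Finset.sum_add_distrib]
      refine Finset.sum_congr rfl fun i _ => ?_
      rw [← Finset.sum_add_distrib]
      refine Finset.sum_congr rfl fun j _ => ?_
      have h1 := hT.shape i j
      split_ifs with h
      · have := (h1.2 h).card_pos; omega
      · have : T i j = ∅ := by rw [← Finset.not_nonempty_iff_eq_empty, h1]; exact h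
        simp [this]
    omega
  rw [hexp, tableauWeight, ← Finset.prod_pow_eq_pow_sum]
  simp only [← Finset.prod_pow_eq_pow_sum, Finset.prod_mul_distrib]

end Tableaux

/-! ### Determinantal formula for factorial Grothendieck polynomials. -/

section TableauDeterminant

variable {A : Type*} [CommRing A]

/-- The meeting point of tableaux and lattice model: branching a single row yields the same gap
function as the action of the monodromy matrix. The sum telescopes in `P'`; the term `q = P` carries
no corner factor. -/
theorem sum_Ico_branching (β x y : A) (σ : ℕ → A) {P P' : ℕ} (h : P < P') :
    (y - x) * ∑ q ∈ Finset.Ico P P', ((∏ l ∈ Finset.Ico (q + 1) P', oplus β x (σ l)) *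
        if P < q then 1 + β * oplus β x (σ q) else 1) * ∏ l ∈ Finset.range q, oplus β y (σ l) =
      (1 + β * x) * (∏ l ∈ Finset.range P', oplus β y (σ l)) -
        (1 + β * y) * ((∏ l ∈ Finset.range P, oplus β y (σ l)) *
          ∏ l ∈ Finset.Ico P P', oplus β x (σ l)) := by
  induction P', h using Nat.le_induction with
  | base =>
    simp only [Nat.succ_eq_add_one, Nat.Ico_succ_singleton, Finset.sum_singleton, Finset.Ico_self,
      Finset.prod_empty, lt_irrefl, if_false, mul_one, one_mul, Finset.prod_range_succ,
      Finset.prod_singleton, oplus]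
    ring
  | succ P' hP ih =>
    have hP : P < P' := hP
    rw [Finset.sum_Ico_succ_top hP.le, Finset.prod_Ico_succ_top hP.le, Finset.prod_range_succ]
    have h1 : ∀ q ∈ Finset.Ico P P', ((∏ l ∈ Finset.Ico (q + 1) (P' + 1), oplus β x (σ l)) *
        if P < q then 1 + β * oplus β x (σ q) else 1) * ∏ l ∈ Finset.range q, oplus β y (σ l) =
        (((∏ l ∈ Finset.Ico (q + 1) P', oplus β x (σ l)) *
        if P < q then 1 + β * oplus β x (σ q) else 1) * ∏ l ∈ Finset.range q, oplus β y (σ l)) *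
          oplus β x (σ P') := by
      intro q hq
      rw [Finset.prod_Ico_succ_top (Finset.mem_Ico.1 hq).2]
      ring
    rw [Finset.sum_congr rfl h1, ← Finset.sum_mul, if_pos hP, Finset.Ico_self, Finset.prod_empty]
    simp only [oplus] at ih ⊢
    linear_combination (x + σ P' + β * x * σ P') * ih

theorem initProd_eq_range (β y : A) {N : ℕ} (σ : ℕ → A) {p : ℕ} (hp : p ≤ N) :
    initProd β y (fun j : Fin N => σ j) p = ∏ l ∈ Finset.range p, oplus β y (σ l) := by
  have := prod_fin_ite N (fun l => oplus β y (σ l)) 0 p hp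
  simpa [initProd] using this

theorem midProd_eq_Ico (β y : A) {N : ℕ} (σ : ℕ → A) {p p' : ℕ} (hp : p' ≤ N) :
    midProd β y (fun j : Fin N => σ j) p p' = ∏ l ∈ Finset.Ico p p', oplus β y (σ l) := by
  have := prod_fin_ite N (fun l => oplus β y (σ l)) p p' hp
  rw [← this, midProd]

theorem prod_castLE {n m : ℕ} (h : m ≤ n) (f : Fin n → A) (hf : ∀ r : Fin n, m ≤ r → f r = 1) :
    ∏ r, f r = ∏ i : Fin m, f (Fin.castLE h i) := by
  obtain ⟨d, rfl⟩ := Nat.exists_eq_add_of_le h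
  rw [Fin.prod_univ_add]
  have : ∀ i : Fin d, f (Fin.natAdd m i) = 1 := fun i => hf _ (by simp)
  simp only [this, Finset.prod_const_one, mul_one]
  rfl

variable {n k : ℕ}

/-- The row lengths of a partition, extended by zero. -/
def extRow (l : Fin n → ℕ) (r : ℕ) : ℕ := if h : r < n then l ⟨r, h⟩ else 0

theorem extRow_val (l : Fin n → ℕ) (r : Fin n) : extRow l r = l r := by simp [extRow]

theorem rowBelow_eq_extRow (l : Fin n → ℕ) (i : Fin n) : rowBelow l i = extRow l (i + 1) := rfl

/-- The places of the letter `1` in the string of a partition with `m` rows. -/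
def rowPlaces (l : Fin n → ℕ) (m : ℕ) (i : Fin (m + 1)) : ℕ := extRow l (m - 1 - i) + i

/-- Rows are numbered from the top and places from the left, so row `r` is matched with place `i`
where `i + r + 1 = m`. The condition `i ≤ r` in `hX` ensures that the truncated subtraction `r - i`
is the true one; only such weights occur. -/
theorem sum_rowWeight_mul (β : A) (X : Fin n → Fin n → ℕ → A) (x : Fin n → A) (σ : ℕ → A)
    (hX : ∀ (r i : Fin n) (j : ℕ), (i : ℕ) ≤ r → X r i j = oplus β (x r) (σ (r - i + j))) {m N : ℕ} {L : Fin n}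
    (hL : (L : ℕ) = m) (hN : n + k ≤ N) {l : Fin n → ℕ} (hl : Antitone l) (hk : ∀ i, l i ≤ k)
    (r : Fin n) {i : ℕ} (hi : i + r + 1 = m) (y : A) :
    (y - x L) * ∑ a ∈ Finset.Icc (rowBelow l r) (l r),
        rowWeight β X L l r a * initProd β y (fun j : Fin N => σ j) (a + i) =
      gapValue β (x L) (fun j : Fin N => σ j) (rowBelow l r + i) (l r + i + 1) y := by
  have hb : rowBelow l r ≤ l r := by
    unfold rowBelow
    split_ifs with h
    · exact hl (by rw [Fin.le_def]; simp)
    · exact Nat.zero_le _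
  have hkr := hk r
  have hLn := L.2
  have key := sum_Ico_branching β (x L) y σ (show rowBelow l r + i < l r + 1 + i by omega)
  rw [← Finset.sum_Ico_add' _ (rowBelow l r) (l r + 1) i] at key
  have hIcc : Finset.Icc (rowBelow l r) (l r) = Finset.Ico (rowBelow l r) (l r + 1) := by
    ext a; simp only [Finset.mem_Icc, Finset.mem_Ico]; omega
  rw [hIcc, gapValue, initProd_eq_range β y σ (by omega), initProd_eq_range β y σ (by omega),
    midProd_eq_Ico β (x L) σ (by omega)]
  have e1 : l r + i + 1 = l r + 1 + i := by omega
  rw [e1, ← key]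
  congr 1
  refine Finset.sum_congr rfl fun a ha => ?_
  obtain ⟨ha1, ha2⟩ := Finset.mem_Ico.1 ha
  rw [initProd_eq_range β y σ (by omega), rowWeight]
  congr 2
  · have e2 : l r + 1 + i = l r + (i + 1) := by omega
    rw [e2, add_assoc a i 1, ← Finset.prod_Ico_add' _ a (l r) (i + 1)]
    refine Finset.prod_congr rfl fun j _ => ?_
    rw [hX L r j (by omega)]
    congr 2
    omega
  · by_cases h : rowBelow l r < a
    · rw [if_pos h, if_pos (by omega), hX L r _ (by omega)]
      congr 4
      omega
    · rw [if_neg h, if_neg (by omega)]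

/-- Induction on the number of letters. The vanishing statement is carried along because the
branching sum also meets shapes `μ` with more rows than letters. For the others the Leibniz
expansion and the branching sum both factor over rows, each row gives a gap function, and
`det_rowMatrix_succ` closes the step. -/
theorem vandermondeProd_mul_tableauSum [IsDomain A] (β : A) (X : Fin n → Fin n → ℕ → A)
    (x : Fin n → A) (σ : ℕ → A) (hx : ∀ i, 1 + β * x i ≠ 0)
    (hX : ∀ (r i : Fin n) (j : ℕ), (i : ℕ) ≤ r → X r i j = oplus β (x r) (σ (r - i + j))) {N : ℕ}
    (hN : n + k ≤ N) {m : ℕ} (hm : m ≤ n) :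
    ∀ l : Fin n → ℕ, Antitone l → (∀ i, l i ≤ k) →
      ((∃ i : Fin n, m ≤ i ∧ l i ≠ 0) → tableauSum β X k m l = 0) ∧
      ((∀ i : Fin n, m ≤ i → l i = 0) →
        vandermondeProd (fun i : Fin m => x (Fin.castLE hm i)) * tableauSum β X k m l =
          (rowMatrix β (fun j : Fin N => σ j) (fun i : Fin m => x (Fin.castLE hm i))
            (rowPlaces l m)).det) := by
  induction m with
  | zero =>
    classical
    intro l hl hk
    constructor
    · rintro ⟨i, -, hi⟩
      refine Finset.sum_eq_zero fun T hT => ?_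
      exfalso
      have hT := (Finset.mem_filter.1 hT).2
      have h1 := hk i
      obtain ⟨a, ha⟩ := (hT.shape i ⟨0, by omega⟩).2 (Nat.pos_of_ne_zero hi)
      exact absurd (hT.lt _ _ a ha) (Nat.not_lt_zero _)
    · intro h0
      have h1 : tableauSum β X k 0 l = 1 := by
        rw [tableauSum, Finset.sum_eq_single (fun _ _ => ∅)]
        · simp [tableauWeight]
        · intro T hT hne
          exfalso
          have hT := (Finset.mem_filter.1 hT).2
          refine hne ?_
          funext i j
          rw [← Finset.not_nonempty_iff_eq_empty, hT.shape, h0 i (Nat.zero_le _)]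
          omega
        · intro h
          exfalso
          refine h (Finset.mem_filter.2 ⟨Finset.mem_univ _, ?_, ?_, ?_, ?_⟩)
          · intro i j; simp [h0 i (Nat.zero_le _)]
          all_goals simp
      rw [h1]
      simp [vandermondeProd]
  | succ m ih =>
    intro l hl hk
    have hm' : m ≤ n := by omega
    let L : Fin n := ⟨m, by omega⟩
    have hL : (L : ℕ) = m := rfl
    have hpi : ∀ μ, (μ ∈ Fintype.piFinset fun i => Finset.Icc (rowBelow l i) (l i)) →
        (∀ i, rowBelow l i ≤ μ i ∧ μ i ≤ l i) ∧ Antitone μ ∧ ∀ i, μ i ≤ k := by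
      intro μ hμ
      have h1 : ∀ i, rowBelow l i ≤ μ i ∧ μ i ≤ l i := by
        intro i
        have := Fintype.mem_piFinset.1 hμ i
        exact Finset.mem_Icc.1 this
      refine ⟨h1, fun i j hij => ?_, fun i => (h1 i).2.trans (hk i)⟩
      rcases eq_or_lt_of_le hij with rfl | hlt
      · exact le_rfl
      · have h2 : (i : ℕ) + 1 < n := by have := j.2; rw [Fin.lt_def] at hlt; omega
        have h3 : rowBelow l i = l ⟨i + 1, h2⟩ := rowBelow_eq l rfl
        have h4 : l j ≤ l ⟨i + 1, h2⟩ := hl (by rw [Fin.le_def]; rw [Fin.lt_def] at hlt; simpa)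
        have h5 := h1 i
        have h6 := h1 j
        omega
    rw [tableauSum_succ β X hL hl hk]
    constructor
    · rintro ⟨i, hi, hli⟩
      refine Finset.sum_eq_zero fun μ hμ => ?_
      obtain ⟨h1, h2, h3⟩ := hpi μ hμ
      rw [((ih hm' μ h2 h3).1 ⟨⟨i - 1, by omega⟩, by simp only; omega, ?_⟩), mul_zero]
      have h4 : rowBelow l ⟨(i : ℕ) - 1, by omega⟩ = l i := rowBelow_eq l (by simp only; omega)
      have h5 := h1 ⟨(i : ℕ) - 1, by omega⟩
      omega
    · intro h0
      set s : Fin N → A := fun j => σ j with hs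
      set y : Fin m → A := fun i => x (Fin.castLE hm' i) with hy
      -- The factor of row `r` in the Leibniz term of `τ`. For the rows beyond the available letters
      -- it is the indicator of an empty row, so one product over all rows covers both cases of the
      -- induction hypothesis.
      let g : Equiv.Perm (Fin m) → Fin n → ℕ → A := fun τ r a =>
        if h : (r : ℕ) < m then (1 + β * y (τ (Fin.rev ⟨r, h⟩))) ^ (r : ℕ) *
          initProd β (y (τ (Fin.rev ⟨r, h⟩))) s (a + (m - 1 - r))
        else if a = 0 then 1 else 0
      have hg : ∀ μ, (μ ∈ Fintype.piFinset fun i => Finset.Icc (rowBelow l i) (l i)) →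
          vandermondeProd y * tableauSum β X k m μ =
            ∑ τ : Equiv.Perm (Fin m), ((Equiv.Perm.sign τ : ℤ) : A) * ∏ r, g τ r (μ r) := by
        intro μ hμ
        obtain ⟨h1, h2, h3⟩ := hpi μ hμ
        by_cases hz : ∃ i : Fin n, m ≤ i ∧ μ i ≠ 0
        · rw [(ih hm' μ h2 h3).1 hz, mul_zero, Finset.sum_eq_zero]
          intro τ _
          obtain ⟨i, hi, hne⟩ := hz
          rw [Finset.prod_eq_zero (Finset.mem_univ i), mul_zero]
          simp only [g]
          rw [dif_neg (by omega), if_neg hne]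
        · push Not at hz
          rw [(ih hm' μ h2 h3).2 hz, rowMatrix, det_fns (fun (i : Fin m) z =>
            (1 + β * z) ^ (m - 1 - (i : ℕ)) * initProd β z s (rowPlaces μ m i.castSucc))]
          refine Finset.sum_congr rfl fun τ _ => ?_
          congr 1
          rw [prod_castLE hm' (fun r => g τ r (μ r)) (fun r hr => by
            simp only [g]; rw [dif_neg (by omega), if_pos (hz r hr)]),
            ← Equiv.prod_comp Fin.revPerm]
          refine Finset.prod_congr rfl fun i _ => ?_
          have hi := i.2
          have h4 : m - 1 - ((Fin.rev i : Fin m) : ℕ) = i := by rw [Fin.val_rev]; omega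
          have h5 : μ (Fin.castLE hm' i) = extRow μ (i : ℕ) := (extRow_val μ (Fin.castLE hm' i)).symm
          simp only [g, Fin.revPerm_apply, Fin.val_castLE, dif_pos hi, rowPlaces, Fin.val_castSucc,
            h4, h5]
          congr 2
          rw [Fin.val_rev]
          omega
      set p := rowPlaces l (m + 1) with hp
      have hrow : ∀ (τ : Equiv.Perm (Fin m)) (i : Fin m),
          (y (τ i) - x L) * ∑ a ∈ Finset.Icc (rowBelow l (Fin.castLE hm' (Fin.rev i)))
            (l (Fin.castLE hm' (Fin.rev i))),
            rowWeight β X L l (Fin.castLE hm' (Fin.rev i)) a *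
              g τ (Fin.castLE hm' (Fin.rev i)) a =
          (1 + β * y (τ i)) ^ (m - 1 - (i : ℕ)) *
            gapValue β (x L) s (p i.castSucc.castSucc) (p i.castSucc.succ) (y (τ i)) := by
        intro τ i
        have hi := i.2
        have hri : ((Fin.castLE hm' (Fin.rev i) : Fin n) : ℕ) = m - 1 - i := by
          rw [Fin.val_castLE, Fin.val_rev]; omega
        have h1 := sum_rowWeight_mul β X x σ hX hL hN hl hk (Fin.castLE hm' (Fin.rev i))
          (show (i : ℕ) + _ + 1 = m by rw [hri]; omega) (y (τ i))
        have h2 : p i.castSucc.castSucc = rowBelow l (Fin.castLE hm' (Fin.rev i)) + i := by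
          rw [rowBelow_eq_extRow, hri, hp, rowPlaces, Fin.val_castSucc, Fin.val_castSucc]
          congr 2; omega
        have h3 : p i.castSucc.succ = l (Fin.castLE hm' (Fin.rev i)) + i + 1 := by
          rw [← extRow_val l, hri, hp, rowPlaces, Fin.val_succ, Fin.val_castSucc, ← add_assoc]
          congr 3
        rw [h2, h3, ← h1, Finset.mul_sum, Finset.mul_sum, Finset.mul_sum]
        refine Finset.sum_congr rfl fun a _ => ?_
        have h4 : g τ (Fin.castLE hm' (Fin.rev i)) a =
            (1 + β * y (τ i)) ^ (m - 1 - (i : ℕ)) * initProd β (y (τ i)) s (a + i) := by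
          have h5 : ((Fin.rev i : Fin m) : ℕ) < m := (Fin.rev i).2
          have h6 : m - 1 - ((Fin.rev i : Fin m) : ℕ) = i := by rw [Fin.val_rev]; omega
          simp only [g, Fin.val_castLE, dif_pos h5, Fin.rev_rev, Fin.eta, h6]
          congr 2
        rw [h4]
        ring
      have hlast : ∀ τ, ∑ a ∈ Finset.Icc (rowBelow l L) (l L), rowWeight β X L l L a * g τ L a =
          initProd β (x L) s (p 0) := by
        intro τ
        have hb : rowBelow l L = 0 := by
          unfold rowBelow
          split_ifs with h
          · exact h0 _ le_rfl
          · rfl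
        have h1 : p 0 = l L := by
          rw [hp, rowPlaces, ← extRow_val l L]; simp [hL]
        have h2 := hk L
        have h3 := L.2
        rw [hb, Finset.sum_eq_single 0]
        · simp only [g]
          rw [dif_neg (by omega), if_pos trivial, mul_one, rowWeight, if_neg (by omega), mul_one, h1,
            initProd_eq_range β _ σ (by omega), Finset.range_eq_Ico]
          refine Finset.prod_congr rfl fun j _ => ?_
          rw [hX L L j le_rfl]; simp
        · intro a _ ha
          simp only [g]
          rw [dif_neg (by omega), if_neg ha, mul_zero]
        · intro h; simp at h
      have hrest : ∀ τ (r : Fin n), m + 1 ≤ r →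
          ∑ a ∈ Finset.Icc (rowBelow l r) (l r), rowWeight β X L l r a * g τ r a = 1 := by
        intro τ r hr
        have hb : rowBelow l r = 0 := by
          unfold rowBelow
          split_ifs with h
          · exact h0 _ (by simp only; omega)
          · rfl
        rw [hb, h0 r hr, Finset.Icc_self, Finset.sum_singleton]
        simp only [g]
        rw [dif_neg (by omega), if_pos trivial, rowWeight, h0 r hr, hb]
        simp
      have hsum : vandermondeProd (fun i : Fin (m + 1) => x (Fin.castLE hm i)) *
          ∑ μ ∈ Fintype.piFinset fun i => Finset.Icc (rowBelow l i) (l i),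
            (∏ i, rowWeight β X L l i (μ i)) * tableauSum β X k m μ =
          (-1) ^ m * initProd β (x L) s (p 0) *
            (Matrix.of fun i j : Fin m => (1 + β * y j) ^ (m - 1 - (i : ℕ)) *
              gapValue β (x L) s (p i.castSucc.castSucc) (p i.castSucc.succ) (y j)).det := by
        have hV : vandermondeProd (fun i : Fin (m + 1) => x (Fin.castLE hm i)) =
            vandermondeProd y * ((-1) ^ m * ∏ i, (y i - x L)) := by
          rw [vandermondeProd_succ]
          have : ∀ i : Fin m, x (Fin.castLE hm (Fin.last m)) - x (Fin.castLE hm i.castSucc) =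
              (-1) * (y i - x L) := fun i => by
            have e1 : Fin.castLE hm (Fin.last m) = L := rfl
            have e2 : Fin.castLE hm i.castSucc = Fin.castLE hm' i := rfl
            rw [e1, e2]; ring
          simp only [this, Finset.prod_mul_distrib, Finset.prod_const, Finset.card_univ,
            Fintype.card_fin]
          rfl
        -- The sum over `μ` is exchanged with the sum over permutations and distributed over the
        -- rows.
        have hexp : ∑ μ ∈ Fintype.piFinset fun i => Finset.Icc (rowBelow l i) (l i),
            (∏ i, rowWeight β X L l i (μ i)) * (vandermondeProd y * tableauSum β X k m μ) =
            ∑ τ : Equiv.Perm (Fin m), ((Equiv.Perm.sign τ : ℤ) : A) *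
              ∏ r, ∑ a ∈ Finset.Icc (rowBelow l r) (l r), rowWeight β X L l r a * g τ r a := by
          rw [Finset.sum_congr rfl fun μ hμ => by rw [hg μ hμ]]
          simp only [Finset.prod_univ_sum, Finset.mul_sum]
          rw [Finset.sum_comm]
          refine Finset.sum_congr rfl fun τ _ => Finset.sum_congr rfl fun μ _ => ?_
          rw [Finset.prod_mul_distrib]
          ring
        have hτ : ∀ τ : Equiv.Perm (Fin m), (∏ i, (y i - x L)) *
            ∏ r, ∑ a ∈ Finset.Icc (rowBelow l r) (l r), rowWeight β X L l r a * g τ r a =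
            initProd β (x L) s (p 0) * ∏ i : Fin m, (1 + β * y (τ i)) ^ (m - 1 - (i : ℕ)) *
            gapValue β (x L) s (p i.castSucc.castSucc) (p i.castSucc.succ) (y (τ i)) := by
          intro τ
          rw [prod_castLE hm _ (hrest τ), Fin.prod_univ_castSucc]
          have e1 : Fin.castLE hm (Fin.last m) = L := rfl
          have e2 : ∀ i : Fin m, Fin.castLE hm i.castSucc = Fin.castLE hm' i := fun i => rfl
          simp only [e1, e2, hlast, ← hrow]
          rw [Finset.prod_mul_distrib, Equiv.prod_comp τ fun i => y i - x L,
            ← Equiv.prod_comp Fin.revPerm fun i => ∑ a ∈ Finset.Icc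
              (rowBelow l (Fin.castLE hm' i)) (l (Fin.castLE hm' i)),
              rowWeight β X L l (Fin.castLE hm' i) a * g τ (Fin.castLE hm' i) a]
          simp only [Fin.revPerm_apply]
          ring
        rw [hV, det_fns (fun (i : Fin m) z => (1 + β * z) ^ (m - 1 - (i : ℕ)) *
          gapValue β (x L) s (p i.castSucc.castSucc) (p i.castSucc.succ) z)]
        have hcomm : vandermondeProd y * ((-1) ^ m * ∏ i, (y i - x L)) *
            ∑ μ ∈ Fintype.piFinset fun i => Finset.Icc (rowBelow l i) (l i),
              (∏ i, rowWeight β X L l i (μ i)) * tableauSum β X k m μ =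
            (-1) ^ m * ((∏ i, (y i - x L)) *
            ∑ μ ∈ Fintype.piFinset fun i => Finset.Icc (rowBelow l i) (l i),
              (∏ i, rowWeight β X L l i (μ i)) * (vandermondeProd y * tableauSum β X k m μ)) := by
          simp only [Finset.mul_sum]
          exact Finset.sum_congr rfl fun μ _ => by ring
        rw [hcomm, hexp, mul_assoc]
        congr 1
        rw [Finset.mul_sum, Finset.mul_sum]
        refine Finset.sum_congr rfl fun τ _ => ?_
        rw [mul_left_comm, hτ τ]
        ring
      rw [hsum]
      refine mul_left_cancel₀ (pow_ne_zero m (hx L)) ?_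
      have hdet := det_rowMatrix_succ β s (fun i : Fin (m + 1) => x (Fin.castLE hm i)) p (by
        intro i
        simp only [hp, rowPlaces, Fin.val_castSucc, Fin.val_succ]
        have h1 : extRow l (m + 1 - 1 - i) ≤ extRow l (m + 1 - 1 - (i + 1)) := by
          unfold extRow
          split_ifs with h2 h3 h3
          · exact hl (by rw [Fin.le_def]; simp only; omega)
          · omega
          · exact Nat.zero_le _
          · exact le_rfl
        omega)
      have e1 : Fin.castLE hm (Fin.last m) = L := rfl
      have e2 : ∀ i : Fin m, Fin.castLE hm i.castSucc = Fin.castLE hm' i := fun i => rfl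
      simp only [e1, e2] at hdet
      rw [hdet]
      ring

/-- The determinantal formula for factorial Grothendieck polynomials. -/
theorem vandermondeProd_mul_grothendieck [IsDomain A] (β : A) (l : BoxedPartition n k)
    (x : Fin n → A) (hx : ∀ i, 1 + β * x i ≠ 0) (t : ℤ → A) :
    vandermondeProd x * grothendieck β l x t =
      (Matrix.of fun i j : Fin n => (1 + β * x j) ^ (n - 1 - (i : ℕ)) *
        initProd β (x j) (fun j : Fin (n + k) => t ((j : ℕ) + 1)) (l.pos i - 1)).det := by
  have h := (vandermondeProd_mul_tableauSum β (fun r i j =>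
      oplus β (x r) (t (((r : ℕ) + 1 : ℤ) + ((j : ℕ) + 1 : ℤ) - ((i : ℕ) + 1 : ℤ)))) x
      (fun j => t ((j : ℕ) + 1)) hx (fun r i j hij => by congr 2; omega) (le_refl (n + k))
      (le_refl n) l.part (fun i j hij => l.2 hij)
      (fun i => Nat.lt_succ_iff.1 (l.1 i).2)).2 (fun i hi => absurd i.2 (by omega))
  rw [grothendieck_eq_tableauSum]
  refine h.trans ?_
  congr 1
  ext i j
  have hi := i.2
  have h1 : n - 1 - (i : ℕ) = (Fin.rev i : Fin n) := by rw [Fin.val_rev]; omega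
  simp only [rowMatrix, Matrix.of_apply, rowPlaces, Fin.val_castSucc, BoxedPartition.pos,
    Nat.add_sub_cancel, Fin.castLE_rfl, id]
  rw [h1, extRow_val]

end TableauDeterminant

/-! ### Fixed points and deformation of roots in power series rings. -/

section FixedPoints

variable {R : Type*} [CommRing R]

/-- Reduction of power series modulo `X ^ d`. -/
noncomputable abbrev truncMod (R : Type*) [CommRing R] (d : ℕ) :
    PowerSeries R →+* PowerSeries R ⧸ Ideal.span {(PowerSeries.X : PowerSeries R) ^ d} :=
  Ideal.Quotient.mk _

theorem truncMod_eq_iff {d : ℕ} {f g : PowerSeries R} :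
    truncMod R d f = truncMod R d g ↔ ∀ e < d, PowerSeries.coeff e f = PowerSeries.coeff e g := by
  rw [truncMod, Ideal.Quotient.mk_eq_mk_iff_sub_mem, Ideal.mem_span_singleton,
    PowerSeries.X_pow_dvd_iff]
  simp only [map_sub, sub_eq_zero]

/-- Since `Φ` respects congruence modulo `X ^ d`, the map `a + X Φ` improves it to `X ^ (d + 1)` and
is a contraction; the coefficients of its iterates stabilize. The hypothesis is restricted to series
with constant terms `a`, because the application involves inverses that exist only there. -/
theorem existsUnique_fixedPoint {m : ℕ} (a : Fin m → R)
    (Φ : (Fin m → PowerSeries R) → Fin m → PowerSeries R)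
    (hΦ : ∀ d y y', (∀ i, PowerSeries.constantCoeff (y i) = a i) →
      (∀ i, PowerSeries.constantCoeff (y' i) = a i) →
      (∀ i, truncMod R d (y i) = truncMod R d (y' i)) →
        ∀ i, truncMod R d (Φ y i) = truncMod R d (Φ y' i)) :
    ∃! y : Fin m → PowerSeries R, (∀ i, PowerSeries.constantCoeff (y i) = a i) ∧
      ∀ i, y i = PowerSeries.C (a i) + PowerSeries.X * Φ y i := by
  obtain ⟨F, hFdef⟩ : ∃ F : (Fin m → PowerSeries R) → Fin m → PowerSeries R, ∀ y i,
      F y i = PowerSeries.C (a i) + PowerSeries.X * Φ y i := ⟨_, fun _ _ => rfl⟩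
  simp only [← hFdef]
  have hF0 : ∀ y i, PowerSeries.constantCoeff (F y i) = a i := by
    intro y i; simp [hFdef]
  have hF : ∀ d y y', (∀ i, PowerSeries.constantCoeff (y i) = a i) →
      (∀ i, PowerSeries.constantCoeff (y' i) = a i) →
      (∀ i, truncMod R d (y i) = truncMod R d (y' i)) →
        ∀ i, truncMod R (d + 1) (F y i) = truncMod R (d + 1) (F y' i) := by
    intro d y y' hy hy' h i
    have h1 := truncMod_eq_iff.1 (hΦ d y y' hy hy' h i)
    rw [truncMod_eq_iff]
    rintro (_ | e) he
    · simp [hFdef]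
    · simp only [hFdef, map_add, PowerSeries.coeff_succ_X_mul]
      rw [h1 e (by omega)]
  obtain ⟨u, hu_zero, hu⟩ : ∃ u : ℕ → Fin m → PowerSeries R,
      (u 0 = fun i => PowerSeries.C (a i)) ∧ ∀ d, u (d + 1) = F (u d) :=
    ⟨fun d => F^[d] fun i => PowerSeries.C (a i), rfl, fun d => Function.iterate_succ_apply' F d _⟩
  have hu0 : ∀ d i, PowerSeries.constantCoeff (u d i) = a i := by
    rintro (_ | d) i
    · simp [hu_zero]
    · rw [hu]; exact hF0 _ _
  have hstep : ∀ d i, truncMod R d (u d i) = truncMod R d (u (d + 1) i) := by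
    intro d
    induction d with
    | zero => intro i; rw [truncMod_eq_iff]; intro e he; omega
    | succ d ih => intro i; rw [hu, hu (d + 1)]; exact hF d _ _ (hu0 _) (hu0 _) ih i
  have hstab : ∀ d c i e, e < d →
      PowerSeries.coeff e (u (d + c) i) = PowerSeries.coeff e (u d i) := by
    intro d c i e he
    induction c with
    | zero => rfl
    | succ c ih => rw [← ih]; exact (truncMod_eq_iff.1 (hstep (d + c) i) e (by omega)).symm
  obtain ⟨y, hydef⟩ : ∃ y : Fin m → PowerSeries R, ∀ i,
      y i = PowerSeries.mk fun e => PowerSeries.coeff e (u (e + 1) i) := ⟨_, fun _ => rfl⟩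
  have hyu : ∀ d i, truncMod R d (y i) = truncMod R d (u d i) := by
    intro d i
    rw [truncMod_eq_iff]
    intro e he
    obtain ⟨c, rfl⟩ := Nat.exists_eq_add_of_le (Nat.succ_le_of_lt he)
    rw [hydef, PowerSeries.coeff_mk]
    exact (hstab (e + 1) c i e (by omega)).symm
  have hy0 : ∀ i, PowerSeries.constantCoeff (y i) = a i := by
    intro i
    rw [← hu0 1 i, ← PowerSeries.coeff_zero_eq_constantCoeff_apply,
      ← PowerSeries.coeff_zero_eq_constantCoeff_apply]
    exact truncMod_eq_iff.1 (hyu 1 i) 0 (by omega)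
  refine ⟨y, ⟨hy0, fun i => ?_⟩, ?_⟩
  · ext e
    have h1 := truncMod_eq_iff.1 (hyu (e + 1) i) e (by omega)
    have h2 := truncMod_eq_iff.1 (hF e y (u e) hy0 (hu0 e) (hyu e) i) e (by omega)
    rw [h1, hu, ← h2]
  · rintro y' ⟨hy', hy'F⟩
    have hd : ∀ d i, truncMod R d (y' i) = truncMod R d (y i) := by
      intro d
      induction d with
      | zero => intro i; rw [truncMod_eq_iff]; intro e he; omega
      | succ d ih =>
        intro i
        have h1 : y' i = F y' i := hy'F i
        rw [h1, hF d y' (u d) hy' (hu0 d) (fun i => (ih i).trans (hyu d i)) i, ← hu,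
          ← hyu (d + 1) i]
    funext i
    ext e
    exact truncMod_eq_iff.1 (hd (e + 1) i) e (by omega)

theorem map_ringInverse {A B : Type*} [CommRing A] [CommRing B] (f : A →+* B) {a : A}
    (ha : IsUnit a) : f (Ring.inverse a) = Ring.inverse (f a) := by
  obtain ⟨u, rfl⟩ := ha
  have h : f u = ((Units.map (f : A →* B) u : Bˣ) : B) := rfl
  rw [Ring.inverse_unit, h, Ring.inverse_unit]
  rfl

/-- Deformation of the simple roots of `∏_j (x - τ_j)`. -/
theorem existsUnique_deformation {m N : ℕ} (b : R) (τ : Fin N → R)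
    (hτ : ∀ i j, i ≠ j → IsUnit (τ i - τ j)) (P : Fin m → Fin N) (e : ℕ)
    (Ψ : (Fin m → PowerSeries R) → PowerSeries R)
    (hΨ : ∀ d y y', (∀ i, PowerSeries.constantCoeff (y i) = τ (P i)) →
      (∀ i, PowerSeries.constantCoeff (y' i) = τ (P i)) →
      (∀ i, truncMod R d (y i) = truncMod R d (y' i)) → truncMod R d (Ψ y) = truncMod R d (Ψ y')) :
    ∃! y : Fin m → PowerSeries R, (∀ i, PowerSeries.constantCoeff (y i) = τ (P i)) ∧
      ∀ i, ∏ j, (y i - PowerSeries.C (τ j)) =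
        PowerSeries.X * (1 + PowerSeries.C b * y i) ^ e * Ψ y := by
  let D : (Fin m → PowerSeries R) → Fin m → PowerSeries R := fun y i =>
    ∏ j ∈ Finset.univ.erase (P i), (y i - PowerSeries.C (τ j))
  have hD : ∀ y, (∀ i, PowerSeries.constantCoeff (y i) = τ (P i)) → ∀ i, IsUnit (D y i) := by
    intro y hy i
    rw [PowerSeries.isUnit_iff_constantCoeff, map_prod, IsUnit.prod_iff]
    intro j hj
    rw [map_sub, hy, PowerSeries.constantCoeff_C]
    exact hτ _ _ (Finset.ne_of_mem_erase hj).symm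
  have key := existsUnique_fixedPoint (fun i => τ (P i))
    (fun y i => (1 + PowerSeries.C b * y i) ^ e * Ψ y * Ring.inverse (D y i)) (by
      intro d y y' hy hy' h i
      have h1 : truncMod R d (D y i) = truncMod R d (D y' i) := by
        simp only [D, map_prod, map_sub, h]
      simp only [map_mul, map_pow, map_add, map_one, map_ringInverse _ (hD y hy i),
        map_ringInverse _ (hD y' hy' i), h1, h i, hΨ d y y' hy hy' h])
  -- Near `τ (P i)` all factors of the product but one are units; dividing by them gives the fixed
  -- point form.
  have hiff : ∀ y : Fin m → PowerSeries R, ((∀ i, PowerSeries.constantCoeff (y i) = τ (P i)) ∧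
      ∀ i, y i = PowerSeries.C (τ (P i)) + PowerSeries.X *
        ((1 + PowerSeries.C b * y i) ^ e * Ψ y * Ring.inverse (D y i))) ↔
      ((∀ i, PowerSeries.constantCoeff (y i) = τ (P i)) ∧
      ∀ i, ∏ j, (y i - PowerSeries.C (τ j)) =
        PowerSeries.X * (1 + PowerSeries.C b * y i) ^ e * Ψ y) := by
    intro y
    refine and_congr_right fun hy => forall_congr' fun i => ?_
    have h1 : ∏ j, (y i - PowerSeries.C (τ j)) = (y i - PowerSeries.C (τ (P i))) * D y i :=
      (Finset.mul_prod_erase _ _ (Finset.mem_univ _)).symm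
    have h2 := Ring.inverse_mul_cancel _ (hD y hy i)
    rw [h1]
    constructor
    · intro h
      linear_combination D y i * h +
        PowerSeries.X * (1 + PowerSeries.C b * y i) ^ e * Ψ y * h2
    · intro h
      linear_combination Ring.inverse (D y i) * h - (y i - PowerSeries.C (τ (P i))) * h2
  simpa only [hiff] using key

end FixedPoints

/-! ### Units of the coefficient ring. -/

section CoefficientRing

variable {N : ℕ}

/-- The parameters in `RT N`. -/
noncomputable def betaR (N : ℕ) : RT N :=
  algebraMap (MvPolynomial (Option (Fin N)) ℤ) (RT N) (MvPolynomial.X none)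

/-- The equivariant parameters in `RT N`, numbered from `0`. -/
noncomputable def tR (N : ℕ) (j : Fin N) : RT N :=
  algebraMap (MvPolynomial (Option (Fin N)) ℤ) (RT N) (MvPolynomial.X (some j))

theorem mem_denominators {p : MvPolynomial (Option (Fin N)) ℤ} :
    p ∈ denominators N ↔ substBeta N 0 p ≠ 0 ∧ substBeta N (-1) p ≠ 0 := by
  rw [denominators, Submonoid.mem_inf, Submonoid.mem_comap, Submonoid.mem_comap,
    mem_nonZeroDivisors_iff_ne_zero, mem_nonZeroDivisors_iff_ne_zero]

theorem denominators_le : denominators N ≤ nonZeroDivisors _ := by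
  intro p hp
  rw [mem_nonZeroDivisors_iff_ne_zero]
  rintro rfl
  exact (mem_denominators.1 hp).1 (map_zero _)

instance : IsDomain (RT N) :=
  IsLocalization.isDomain_of_le_nonZeroDivisors (M := denominators N) (RT N) denominators_le

theorem isUnit_algebraMap {p : MvPolynomial (Option (Fin N)) ℤ} (h0 : substBeta N 0 p ≠ 0)
    (h1 : substBeta N (-1) p ≠ 0) : IsUnit (algebraMap _ (RT N) p) :=
  IsLocalization.map_units (RT N) (⟨p, mem_denominators.2 ⟨h0, h1⟩⟩ : denominators N)

theorem isUnit_one_add_betaR_mul (j : Fin N) : IsUnit (1 + betaR N * tR N j) := by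
  have h : 1 + betaR N * tR N j = algebraMap (MvPolynomial (Option (Fin N)) ℤ) (RT N)
      (1 + MvPolynomial.X none * MvPolynomial.X (some j)) := by simp [betaR, tR]
  rw [h]
  refine isUnit_algebraMap ?_ ?_ <;>
  · intro h
    have := congrArg MvPolynomial.constantCoeff h
    simp [substBeta] at this

theorem isUnit_tR_sub {i j : Fin N} (hij : i ≠ j) : IsUnit (tR N i - tR N j) := by
  have h : tR N i - tR N j = algebraMap (MvPolynomial (Option (Fin N)) ℤ) (RT N)
      (MvPolynomial.X (some i) - MvPolynomial.X (some j)) := by simp [tR]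
  rw [h]
  refine isUnit_algebraMap ?_ ?_ <;>
  · simp only [substBeta, map_sub, MvPolynomial.aeval_X, Option.elim, ne_eq, sub_eq_zero]
    exact fun h => hij (MvPolynomial.X_injective h)

theorem betaR_ne_zero : betaR N ≠ 0 := by
  intro h
  have := IsLocalization.injective (RT N) (denominators_le (N := N))
    (h.trans (map_zero (algebraMap (MvPolynomial (Option (Fin N)) ℤ) (RT N))).symm)
  exact MvPolynomial.X_ne_zero _ this

theorem beta_eq : beta N = PowerSeries.C (betaR N) := rfl

theorem tParam_eq (j : Fin N) : tParam N ((j : ℕ) + 1) = PowerSeries.C (tR N j) := by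
  have h : (1 : ℤ) ≤ (j : ℕ) + 1 ∧ ((j : ℕ) : ℤ) + 1 ≤ N := by have := j.2; omega
  rw [tParam, dif_pos h, tR]
  congr 4
  ext
  simp

theorem isUnit_one_add_beta_mul_tParam (j : ℤ) : IsUnit (1 + beta N * tParam N j) := by
  by_cases h : 1 ≤ j ∧ j ≤ N
  · obtain ⟨i, rfl⟩ : ∃ i : Fin N, j = (i : ℕ) + 1 :=
      ⟨⟨(j - 1).toNat, by omega⟩, by simp only; omega⟩
    rw [tParam_eq, beta_eq, PowerSeries.isUnit_iff_constantCoeff]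
    simpa using isUnit_one_add_betaR_mul i
  · rw [tParam, dif_neg h]; simp

theorem isUnit_one_add_beta_mul {y : RTq N} {j : Fin N}
    (h : PowerSeries.constantCoeff y = tR N j) : IsUnit (1 + beta N * y) := by
  rw [beta_eq, PowerSeries.isUnit_iff_constantCoeff]
  simpa [h] using isUnit_one_add_betaR_mul j

end CoefficientRing

/-! ### Existence and uniqueness of the Bethe roots. -/

section Roots

variable {n k : ℕ} {R : Type*} [CommRing R]

/-- The places of the letters `1`, numbered from `0`. -/
def BoxedPartition.place (l : BoxedPartition n k) (i : Fin n) : Fin (n + k) :=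
  ⟨l.pos i - 1, by have := l.pos_le i; have : 0 < l.pos i := Nat.succ_pos _; omega⟩

theorem BoxedPartition.val_place (l : BoxedPartition n k) (i : Fin n) :
    (l.place i : ℕ) + 1 = l.pos i := by
  have : 0 < l.pos i := Nat.succ_pos _
  simp only [BoxedPartition.place]; omega

theorem BoxedPartition.place_strictMono (l : BoxedPartition n k) : StrictMono l.place := by
  intro i j hij
  have h1 := l.pos_strictMono hij
  have h2 := l.val_place i
  have h3 := l.val_place j
  rw [Fin.lt_def]; omega

theorem specialize_eq {N : ℕ} (l : BoxedPartition n k) (hN : n + k = N) (i : Fin n) :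
    specialize (tParam N) l i = PowerSeries.C (tR N (Fin.cast hN (l.place i))) := by
  subst hN
  rw [specialize, ← tParam_eq]
  congr 1

theorem quo_mul_cancel {A : Type*} [CommRing A] (a : A) {b : A} (hb : IsUnit b) :
    quo a b * b = a := by
  rw [quo, mul_assoc, Ring.inverse_mul_cancel _ hb, mul_one]

theorem injective_of_constantCoeff {m N : ℕ} {y : Fin m → RTq N} {P : Fin m → Fin N}
    (hP : Function.Injective P) (hy : ∀ i, PowerSeries.constantCoeff (y i) = tR N (P i)) :
    Function.Injective y := by
  intro i j hij
  by_contra hne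
  have h1 := isUnit_tR_sub (hP.ne hne)
  rw [← hy i, ← hy j, hij, sub_self] at h1
  exact not_isUnit_zero h1

/-- Clearing denominators exhibits the system as a deformation of `∏_j (u - t_j) = 0`, in which the
coupling between the unknowns enters only through a factor independent of `i`. Distinctness is
automatic from the constant terms. -/
theorem isBetheRoot_iff (α : BoxedPartition n k) (y : Fin n → RTq (n + k)) :
    IsBetheRoot α y ↔ (∀ i, PowerSeries.constantCoeff (y i) = tR (n + k) (α.place i)) ∧
      ∀ i, ∏ j, (y i - PowerSeries.C (tR (n + k) j)) =
        PowerSeries.X * (1 + PowerSeries.C (betaR (n + k)) * y i) ^ n *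
          (-(-1) ^ n * (∏ j, (1 + PowerSeries.C (betaR (n + k)) * PowerSeries.C (tR (n + k) j))) *
            Ring.inverse (bigPi (PowerSeries.C (betaR (n + k))) y)) := by
  have hs : ∀ i, PowerSeries.constantCoeff (specialize (tParam (n + k)) α i) =
      tR (n + k) (α.place i) := fun i => by
    rw [specialize_eq α rfl, PowerSeries.constantCoeff_C]; rfl
  rw [IsBetheRoot]
  simp only [hs]
  suffices key : (∀ i, PowerSeries.constantCoeff (y i) = tR (n + k) (α.place i)) → ∀ i, (_ ↔ _) from
    ⟨fun ⟨_, h2, h3⟩ => ⟨h3, fun i => (key h3 i).1 (h2 i)⟩, fun ⟨h3, h2⟩ =>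
      ⟨injective_of_constantCoeff α.place_strictMono.injective h3,
        fun i => (key h3 i).2 (h2 i), h3⟩⟩
  intro hy i
  have hu : ∀ i, IsUnit (1 + beta (n + k) * y i) := fun i => isUnit_one_add_beta_mul (hy i)
  have hPi : IsUnit (bigPi (beta (n + k)) y) := IsUnit.prod_univ_iff.2 hu
  have ht : ∀ j : Fin (n + k), IsUnit (1 + beta (n + k) * PowerSeries.C (tR (n + k) j)) :=
    fun j => isUnit_one_add_beta_mul (j := j) (by simp)
  have hT : IsUnit (∏ j : Fin (n + k), (1 + beta (n + k) * PowerSeries.C (tR (n + k) j))) :=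
    IsUnit.prod_univ_iff.2 ht
  rw [← beta_eq]
  set β := beta (n + k)
  have h1 := quo_mul_cancel (bigPi β y) ((hu i).pow n)
  have h2 : (∏ j : Fin (n + k), ominus β (y i) (tParam (n + k) ((j : ℕ) + 1))) *
      ∏ j : Fin (n + k), (1 + β * PowerSeries.C (tR (n + k) j)) =
      ∏ j : Fin (n + k), (y i - PowerSeries.C (tR (n + k) j)) := by
    rw [← Finset.prod_mul_distrib]
    refine Finset.prod_congr rfl fun j _ => ?_
    rw [tParam_eq, ominus, quo_mul_cancel _ (ht j)]
  have h3 := Ring.inverse_mul_cancel _ hPi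
  have hsq : ((-1 : RTq (n + k)) ^ n) * (-1) ^ n = 1 := by rw [← mul_pow]; simp
  set T := ∏ j : Fin (n + k), (1 + β * PowerSeries.C (tR (n + k) j))
  set E := ∏ j : Fin (n + k), (y i - PowerSeries.C (tR (n + k) j))
  set O := ∏ j : Fin (n + k), ominus β (y i) (tParam (n + k) ((j : ℕ) + 1))
  set u := (1 + β * y i) ^ n with hudef
  set Q := quo (bigPi β y) u
  set I := Ring.inverse (bigPi β y)
  have hun : IsUnit u := (hu i).pow n
  constructor
  · intro h
    refine hPi.mul_left_cancel ?_
    linear_combination (-1) ^ n * u * T * h - O * T * u * Q * hsq - O * T * h1 -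
      bigPi β y * h2 + PowerSeries.X * u * (-1) ^ n * T * h3
  · intro h
    refine (hun.mul hT).mul_right_cancel ?_
    linear_combination (-1) ^ n * bigPi β y * h + (-1) ^ n * O * T * h1 +
      (-1) ^ n * bigPi β y * h2 - PowerSeries.X * u * T * ((-1) ^ n * (-1) ^ n) * h3 - PowerSeries.X * u * T * hsq

/-- Passing from `⊖w` to `w`, the `n + k` linear factors contribute `(1 + β w_i) ^ (n + k)` to the
denominator and the prefactor returns `k` of these powers. The exponent becomes `n`, as for the
other system, and only the common factor differs. -/
theorem isComplementaryRoot_iff (α : BoxedPartition n k) (w : Fin k → RTq (n + k)) :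
    IsComplementaryRoot α w ↔ (∀ i, PowerSeries.constantCoeff (w i) =
        tR (n + k) (Fin.cast (Nat.add_comm k n) (α.star.place i))) ∧
      ∀ i, ∏ j, (w i - PowerSeries.C (tR (n + k) j)) =
        PowerSeries.X * (1 + PowerSeries.C (betaR (n + k)) * w i) ^ n *
          (-(-1) ^ n * bigPi (PowerSeries.C (betaR (n + k))) w) := by
  have hs : ∀ i, PowerSeries.constantCoeff (specialize (tParam (n + k)) α.star i) =
      tR (n + k) (Fin.cast (Nat.add_comm k n) (α.star.place i)) := fun i => by
    rw [specialize_eq α.star (Nat.add_comm k n), PowerSeries.constantCoeff_C]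
  rw [IsComplementaryRoot]
  simp only [hs]
  suffices key : (∀ i, PowerSeries.constantCoeff (w i) =
      tR (n + k) (Fin.cast (Nat.add_comm k n) (α.star.place i))) → ∀ i, (_ ↔ _) from
    ⟨fun ⟨_, h2, h3⟩ => ⟨h3, fun i => (key h3 i).1 (h2 i)⟩, fun ⟨h3, h2⟩ =>
      ⟨injective_of_constantCoeff
        ((Fin.cast_injective _).comp α.star.place_strictMono.injective) h3,
        fun i => (key h3 i).2 (h2 i), h3⟩⟩
  intro hw i
  have hu : ∀ i, IsUnit (1 + beta (n + k) * w i) := fun i => isUnit_one_add_beta_mul (hw i)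
  rw [← beta_eq]
  set β := beta (n + k)
  have hv : ∀ i, (1 + β * oneg β (w i)) * (1 + β * w i) = 1 := fun i => one_add_mul_oneg _ _ (hu i)
  have hPi : IsUnit (bigPi β w) := IsUnit.prod_univ_iff.2 hu
  have hVU : bigPi β (fun l => oneg β (w l)) * bigPi β w = 1 := by
    rw [bigPi, bigPi, ← Finset.prod_mul_distrib]
    exact Finset.prod_eq_one fun i _ => hv i
  have hvi : IsUnit (1 + β * oneg β (w i)) := IsUnit.of_mul_eq_one _ (hv i)
  have h1 := quo_mul_cancel (bigPi β fun l => oneg β (w l)) (hvi.pow k)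
  have hk : (1 + β * oneg β (w i)) ^ k * (1 + β * w i) ^ k = 1 := by
    rw [← mul_pow, hv, one_pow]
  have h2 : (∏ j : Fin (n + k), oplus β (oneg β (w i)) (tParam (n + k) ((j : ℕ) + 1))) *
      (1 + β * w i) ^ (n + k) =
      (-1) ^ (n + k) * ∏ j : Fin (n + k), (w i - PowerSeries.C (tR (n + k) j)) := by
    have hc : ∀ a : RTq (n + k), a ^ (n + k) = ∏ _j : Fin (n + k), a := fun a => by simp
    rw [hc, hc, ← Finset.prod_mul_distrib, ← Finset.prod_mul_distrib]
    refine Finset.prod_congr rfl fun j _ => ?_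
    have h3 : oneg β (w i) * (1 + β * w i) = 0 - w i := quo_mul_cancel _ (hu i)
    rw [tParam_eq, oplus]
    linear_combination (1 + β * PowerSeries.C (tR (n + k) j)) * h3
  have hsqn : ((-1 : RTq (n + k)) ^ n) * (-1) ^ n = 1 := by rw [← mul_pow]; simp
  have hsqk : ((-1 : RTq (n + k)) ^ k) * (-1) ^ k = 1 := by rw [← mul_pow]; simp
  rw [pow_add, pow_add] at h2
  set E := ∏ j : Fin (n + k), (w i - PowerSeries.C (tR (n + k) j))
  set O := ∏ j : Fin (n + k), oplus β (oneg β (w i)) (tParam (n + k) ((j : ℕ) + 1))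
  set Q := quo (bigPi β fun l => oneg β (w l)) ((1 + β * oneg β (w i)) ^ k)
  have h4 : Q = bigPi β (fun l => oneg β (w l)) * (1 + β * w i) ^ k := by
    rw [← h1, mul_assoc, hk, mul_one]
  have h5 : ((-1) ^ k * Q * O + PowerSeries.X) * (bigPi β w * (1 + β * w i) ^ n) =
      (-1) ^ n * (E - PowerSeries.X * (1 + β * w i) ^ n * (-(-1) ^ n * bigPi β w)) := by
    rw [h4]
    linear_combination (-1) ^ k * (1 + β * w i) ^ k * O * (1 + β * w i) ^ n * hVU +
      (-1) ^ k * h2 + (-1) ^ n * E * hsqk -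
      PowerSeries.X * (1 + β * w i) ^ n * bigPi β w * hsqn
  have hn : IsUnit ((-1 : RTq (n + k)) ^ n) := isUnit_one.neg.pow n
  rw [← (hPi.mul ((hu i).pow n)).mul_left_eq_zero, h5, hn.mul_right_eq_zero, sub_eq_zero]

theorem truncMod_bigPi {m d : ℕ} (b : PowerSeries R) {y y' : Fin m → PowerSeries R}
    (h : ∀ i, truncMod R d (y i) = truncMod R d (y' i)) :
    truncMod R d (bigPi b y) = truncMod R d (bigPi b y') := by
  simp only [bigPi, map_prod, map_add, map_mul, h]

theorem existsUnique_isBetheRoot (α : BoxedPartition n k) :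
    ∃! y : Fin n → RTq (n + k), IsBetheRoot α y := by
  simp only [isBetheRoot_iff]
  refine existsUnique_deformation (betaR (n + k)) (tR (n + k)) (fun i j => isUnit_tR_sub) _ n
    (fun y => -(-1) ^ n *
      (∏ j, (1 + PowerSeries.C (betaR (n + k)) * PowerSeries.C (tR (n + k) j))) *
        Ring.inverse (bigPi (PowerSeries.C (betaR (n + k))) y)) ?_
  intro d y y' hy hy' h
  have hu : ∀ y : Fin n → RTq (n + k),
      (∀ i, PowerSeries.constantCoeff (y i) = tR (n + k) (α.place i)) →
      IsUnit (bigPi (PowerSeries.C (betaR (n + k))) y) := fun y hy =>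
    IsUnit.prod_univ_iff.2 fun i => isUnit_one_add_beta_mul (hy i)
  rw [map_mul, map_mul _ _ (Ring.inverse _), map_ringInverse _ (hu y hy),
    map_ringInverse _ (hu y' hy'), truncMod_bigPi _ h]

theorem existsUnique_isComplementaryRoot (α : BoxedPartition n k) :
    ∃! w : Fin k → RTq (n + k), IsComplementaryRoot α w := by
  simp only [isComplementaryRoot_iff]
  refine existsUnique_deformation (betaR (n + k)) (tR (n + k)) (fun i j => isUnit_tR_sub)
    (fun i => Fin.cast (Nat.add_comm k n) (α.star.place i)) n
    (fun w => -(-1) ^ n * bigPi (PowerSeries.C (betaR (n + k))) w) ?_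
  intro d y y' hy hy' h
  rw [map_mul, map_mul, truncMod_bigPi _ h]

end Roots

/-! ### Counting places below a given site. -/

section Counting

variable {n k m N : ℕ}

/-- The number of values of `p` below `i`. -/
def countBelow (p : Fin m → Fin N) (i : Fin N) : ℕ := (Finset.univ.filter fun a => p a < i).card

theorem countBelow_self {p : Fin m → Fin N} (hp : StrictMono p) (a : Fin m) :
    countBelow p (p a) = a := by
  rw [countBelow]
  simp only [hp.lt_iff_lt]
  have : (Finset.univ.filter fun b : Fin m => b < a) = Finset.Iio a := by ext; simp
  rw [this, Fin.card_Iio]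

theorem countBelow_mono (p : Fin m → Fin N) : Monotone (countBelow p) := fun _ _ h =>
  Finset.card_le_card fun _ ha => by
    simp only [Finset.mem_filter, Finset.mem_univ, true_and] at ha ⊢
    exact ha.trans_le h

/-- The strict inequality supplies the drop in degree that makes the off-diagonal residue sums
vanish. -/
theorem countBelow_lt {p : Fin m → Fin N} {i j : Fin N} (h : i < j) (hi : ∃ a, p a = i) :
    countBelow p i < countBelow p j := by
  obtain ⟨a, rfl⟩ := hi
  refine Finset.card_lt_card (Finset.ssubset_iff_of_subset (fun b hb => ?_) |>.2 ⟨a, ?_, ?_⟩)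
  · simp only [Finset.mem_filter, Finset.mem_univ, true_and] at hb ⊢
    exact hb.trans h
  · simpa using h
  · simp

theorem countBelow_le (p : Fin m → Fin N) (i : Fin N) : countBelow p i ≤ m :=
  (Finset.card_le_univ _).trans (Fintype.card_fin m).le

theorem countBelow_apply_lt (p : Fin m → Fin N) (a : Fin m) : countBelow p (p a) < m := by
  have h := Finset.card_lt_univ_of_notMem (s := Finset.univ.filter fun b => p b < p a) (x := a)
    (by simp)
  rwa [Fintype.card_fin] at h

theorem countBelow_add (e : Fin n ⊕ Fin k ≃ Fin N) (i : Fin N) :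
    countBelow (fun a => e (Sum.inl a)) i + countBelow (fun a => e (Sum.inr a)) i = i := by
  have h : ((Finset.univ.filter fun j : Fin N => j < i).card : ℕ) = i := by
    have : (Finset.univ.filter fun b : Fin N => b < i) = Finset.Iio i := by ext; simp
    rw [this, Fin.card_Iio]
  rw [← h, countBelow, countBelow, Finset.card_filter, Finset.card_filter, Finset.card_filter,
    ← Equiv.sum_comp e, Fintype.sum_sum_type]

end Counting

/-! ### Vandermonde products and alternants of polynomials. -/

section Vandermonde

variable {A : Type*} [CommRing A]

/-- The product of the `y i - y j` over `i < j`. -/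
def revVandermondeProd {m : ℕ} (y : Fin m → A) : A :=
  ∏ i, ∏ j ∈ Finset.Ioi i, (y i - y j)

theorem revVandermondeProd_eq {m : ℕ} (y : Fin m → A) :
    revVandermondeProd y = (∏ i : Fin m, ∏ _j ∈ Finset.Ioi i, (-1 : A)) * vandermondeProd y := by
  simp only [revVandermondeProd, vandermondeProd, ← Finset.prod_mul_distrib]
  refine Finset.prod_congr rfl fun i _ => Finset.prod_congr rfl fun j _ => by ring

theorem prod_prod_neg_one (m : ℕ) : ∏ i : Fin m, ∏ _j ∈ Finset.Ioi i, (-1 : A) =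
    ∏ i : Fin m, (-1) ^ (i : ℕ) := by
  simp only [Finset.prod_const, Fin.card_Ioi]
  rw [← Equiv.prod_comp Fin.revPerm]
  refine Finset.prod_congr rfl fun i _ => ?_
  rw [Fin.revPerm_apply, Fin.val_rev]
  congr 1
  omega

theorem prod_erase_sub {m : ℕ} (y : Fin m → A) :
    ∏ i, ∏ j ∈ Finset.univ.erase i, (y i - y j) = vandermondeProd y * revVandermondeProd y := by
  have h : ∀ i, ∏ j ∈ Finset.univ.erase i, (y i - y j) =
      (∏ j, if j < i then y i - y j else 1) * ∏ j ∈ Finset.Ioi i, (y i - y j) := by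
    intro i
    rw [← Finset.prod_filter, ← Finset.prod_union]
    · refine Finset.prod_congr ?_ fun _ _ => rfl
      ext j; simp [lt_or_lt_iff_ne]
    · rw [Finset.disjoint_left]
      intro j hj hj'
      simp only [Finset.mem_filter, Finset.mem_univ, true_and, Finset.mem_Ioi] at hj hj'
      exact lt_asymm hj hj'
  simp only [h, Finset.prod_mul_distrib]
  rw [Finset.prod_comm, vandermondeProd, revVandermondeProd]
  congr 1
  refine Finset.prod_congr rfl fun i _ => ?_
  rw [← Finset.prod_filter]
  refine Finset.prod_congr ?_ fun _ _ => rfl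
  ext; simp

/-- Within each block `e` preserves the order, so only mixed pairs can change sign; the exponent
counts, for each `b`, those in which the first block precedes. -/
theorem revVandermondeProd_sumElim {n k N : ℕ} (e : Fin n ⊕ Fin k ≃ Fin N)
    (hp : StrictMono fun a => e (Sum.inl a)) (hs : StrictMono fun a => e (Sum.inr a))
    (y : Fin n → A) (w : Fin k → A) :
    revVandermondeProd (fun i => Sum.elim y w (e.symm i)) =
      revVandermondeProd y * revVandermondeProd w * (∏ b, ∏ a, (w b - y a)) *
        ∏ b, (-1) ^ countBelow (fun a => e (Sum.inl a)) (e (Sum.inr b)) := by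
  have h1 : ∀ {m : ℕ} (v : Fin m → A), revVandermondeProd v =
      ∏ i, ∏ j, if i < j then v i - v j else 1 := by
    intro m v
    rw [revVandermondeProd]
    refine Finset.prod_congr rfl fun i _ => ?_
    rw [← Finset.prod_filter]
    refine Finset.prod_congr ?_ fun _ _ => rfl
    ext; simp
  rw [h1, ← Equiv.prod_comp e]
  have h2 : ∀ x, (∏ j, if e x < j then Sum.elim y w (e.symm (e x)) - Sum.elim y w (e.symm j)
      else 1) = ∏ z, if e x < e z then Sum.elim y w x - Sum.elim y w z else 1 := by
    intro x
    rw [← Equiv.prod_comp e]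
    simp
  simp only [h2]
  rw [Fintype.prod_sum_type]
  simp only [Fintype.prod_sum_type, Sum.elim_inl, Sum.elim_inr, Finset.prod_mul_distrib]
  simp only [hp.lt_iff_lt, hs.lt_iff_lt]
  rw [← h1, ← h1]
  have h3 : ∀ b, (-1 : A) ^ countBelow (fun a => e (Sum.inl a)) (e (Sum.inr b)) =
      ∏ a, if e (Sum.inl a) < e (Sum.inr b) then -1 else 1 := by
    intro b
    rw [← Finset.prod_filter, Finset.prod_const, countBelow]
  simp only [h3]
  have h4 : (∏ a, ∏ b, if e (Sum.inl a) < e (Sum.inr b) then y a - w b else 1) *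
      (∏ b, ∏ a, if e (Sum.inr b) < e (Sum.inl a) then w b - y a else 1) =
      (∏ b, ∏ a, (w b - y a)) *
        ∏ b, ∏ a, if e (Sum.inl a) < e (Sum.inr b) then (-1 : A) else 1 := by
    rw [Finset.prod_comm, ← Finset.prod_mul_distrib, ← Finset.prod_mul_distrib]
    refine Finset.prod_congr rfl fun b _ => ?_
    rw [← Finset.prod_mul_distrib, ← Finset.prod_mul_distrib]
    refine Finset.prod_congr rfl fun a _ => ?_
    have hne : e (Sum.inl a) ≠ e (Sum.inr b) := e.injective.ne Sum.inl_ne_inr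
    rcases hne.lt_or_gt with h | h
    · simp [h, h.not_gt]
    · simp [h, h.not_gt]
  linear_combination revVandermondeProd y * revVandermondeProd w * h4

-- The rows are polynomials of degree less than `N`, so the determinant is a constant, that of their
-- coefficient matrix, times the Vandermonde product of `u`. The constant is found at `u = τ`, where
-- the matrix is triangular.
open Polynomial in
theorem det_rows_eq_revVandermondeProd [IsDomain A] (β : A) {N : ℕ} {τ : Fin N → A}
    (hτ : Function.Injective τ) (m : Fin N → ℕ) (hm : ∀ i, m i ≤ i) (u : Fin N → A) :
    (Matrix.of fun i j => (∏ l ∈ Finset.Ioi i, (u j - τ l)) * (1 + β * u j) ^ m i).det =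
      revVandermondeProd u * ∏ i, (1 + β * τ i) ^ m i := by
  let f : Fin N → A[X] := fun i => (∏ l ∈ Finset.Ioi i, (X - C (τ l))) * (1 + C β * X) ^ m i
  have hf : ∀ i x, (∏ l ∈ Finset.Ioi i, (x - τ l)) * (1 + β * x) ^ m i = (f i).eval x := by
    intro i x; simp [f, eval_prod]
  have hdeg : ∀ i, (f i).natDegree < N := by
    intro i
    have h1 : (1 + C β * X : A[X]).natDegree ≤ 1 := by compute_degree
    have h2 := natDegree_mul_le (p := ∏ l ∈ Finset.Ioi i, (X - C (τ l)))
      (q := (1 + C β * X : A[X]) ^ m i)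
    rw [natDegree_finsetProd_X_sub_C_eq_card, Fin.card_Ioi] at h2
    have h3 := natDegree_pow_le_of_le (m i) h1
    have := hm i
    have := i.2
    refine lt_of_le_of_lt h2 ?_
    omega
  let K : Matrix (Fin N) (Fin N) A := Matrix.of fun i r => (f i).coeff r
  have hK : ∀ v : Fin N → A,
      (Matrix.of fun i j => (∏ l ∈ Finset.Ioi i, (v j - τ l)) * (1 + β * v j) ^ m i).det =
        K.det * vandermondeProd v := by
    intro v
    rw [vandermondeProd, ← Matrix.det_vandermonde, ← Matrix.det_transpose (Matrix.vandermonde v),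
      ← Matrix.det_mul]
    congr 1
    ext i j
    rw [Matrix.of_apply, hf, eval_eq_sum_range' (hdeg i), Matrix.mul_apply, Finset.sum_range]
    simp [K, Matrix.vandermonde]
  have h1 : (Matrix.of fun i j => (∏ l ∈ Finset.Ioi i, (τ j - τ l)) * (1 + β * τ j) ^ m i).det =
      revVandermondeProd τ * ∏ i, (1 + β * τ i) ^ m i := by
    rw [Matrix.det_of_isLowerTriangular]
    · simp only [Matrix.of_apply, Finset.prod_mul_distrib]
      rfl
    · intro i j hij
      have hij : i < j := hij
      rw [Matrix.of_apply, Finset.prod_eq_zero (Finset.mem_Ioi.2 hij) (sub_self _), zero_mul]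
  rw [hK, revVandermondeProd_eq] at h1
  rw [hK, revVandermondeProd_eq]
  have h2 : K.det = (∏ i : Fin N, ∏ _j ∈ Finset.Ioi i, (-1 : A)) * ∏ i, (1 + β * τ i) ^ m i :=
    mul_right_cancel₀ (vandermondeProd_ne_zero hτ) (by linear_combination h1)
  rw [h2]
  ring

end Vandermonde

/-! ### Orthogonality of row functions over the roots. -/

section Residues

variable {K : Type*} [Field K]

-- On the roots, each summand is `g(u_a) / ∏_{v ≠ a} (u_a - u_v)` for one polynomial `g` of degree
-- less than `N`, so the sum is the coefficient of degree `N - 1` in `g`. It is `1` on the diagonal,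
-- where `g` is monic of that degree, and `0` elsewhere, where the degree is smaller.
open Polynomial in
theorem sum_residues {n k N : ℕ} (hN : n + k = N) (β κ : K) (τ : Fin N → K)
    (e : Fin n ⊕ Fin k ≃ Fin N) (u : Fin n ⊕ Fin k → K) (hu : Function.Injective u)
    (hβ : ∀ a, 1 + β * u a ≠ 0) (hroot : ∀ a, ∏ j, (u a - τ j) = κ * (1 + β * u a) ^ n)
    (i : Fin N) (b : Fin k) :
    ∑ a, ((∏ l ∈ Finset.Ioi i, (u a - τ l)) *
        (1 + β * u a) ^ countBelow (fun c => e (Sum.inl c)) i) *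
      ((∏ l ∈ Finset.Iio (e (Sum.inr b)), (u a - τ l)) *
        (1 + β * u a) ^ (n - countBelow (fun c => e (Sum.inl c)) (e (Sum.inr b)))) /
      ((1 + β * u a) ^ n * ∏ v ∈ Finset.univ.erase a, (u a - u v)) =
    if i = e (Sum.inr b) then 1 else 0 := by
  set s := e (Sum.inr b) with hs
  set m := countBelow (fun c => e (Sum.inl c)) with hm
  have hcard : (Finset.univ : Finset (Fin n ⊕ Fin k)).card = N := by
    rw [Finset.card_univ]; simp [hN]
  have hsum : ∀ g : K[X], g.natDegree < N →
      (∀ a, ((∏ l ∈ Finset.Ioi i, (u a - τ l)) * (1 + β * u a) ^ m i) *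
        ((∏ l ∈ Finset.Iio s, (u a - τ l)) * (1 + β * u a) ^ (n - m s)) =
          g.eval (u a) * (1 + β * u a) ^ n) →
      ∑ a, ((∏ l ∈ Finset.Ioi i, (u a - τ l)) * (1 + β * u a) ^ m i) *
        ((∏ l ∈ Finset.Iio s, (u a - τ l)) * (1 + β * u a) ^ (n - m s)) /
      ((1 + β * u a) ^ n * ∏ v ∈ Finset.univ.erase a, (u a - u v)) = g.coeff (N - 1) := by
    intro g hg h
    have h1 := Lagrange.coeff_eq_sum (s := Finset.univ) (v := u) hu.injOn (P := g)
      (by rw [hcard]; exact degree_le_natDegree.trans_lt (by exact_mod_cast hg))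
    rw [hcard] at h1
    rw [h1]
    refine Finset.sum_congr rfl fun a _ => ?_
    rw [h a, mul_comm (g.eval _), mul_div_mul_left _ _ (pow_ne_zero _ (hβ a))]
  have hms : m s ≤ n := countBelow_le _ _
  have hadds := countBelow_add e s
  have haddi := countBelow_add e i
  set z := countBelow (fun c => e (Sum.inr c))
  rw [← hm] at hadds haddi
  have h1 : (1 + C β * X : K[X]).natDegree ≤ 1 := by compute_degree
  have hi := i.2
  have hs2 := s.2
  rcases le_or_gt s i with hsi | his
  · have hmle : m s ≤ m i := countBelow_mono _ hsi
    have hev : ∀ a, ((∏ l ∈ Finset.Ioi i, (u a - τ l)) * (1 + β * u a) ^ m i) *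
        ((∏ l ∈ Finset.Iio s, (u a - τ l)) * (1 + β * u a) ^ (n - m s)) =
          ((∏ l ∈ Finset.Ioi i, (X - C (τ l))) * (∏ l ∈ Finset.Iio s, (X - C (τ l))) *
            (1 + C β * X) ^ (m i - m s)).eval (u a) * (1 + β * u a) ^ n := by
      intro a
      obtain ⟨d, hd⟩ := Nat.exists_eq_add_of_le hmle
      obtain ⟨d', hd'⟩ := Nat.exists_eq_add_of_le hms
      simp only [eval_mul, eval_prod, eval_sub, eval_X, eval_C, eval_pow, eval_add, eval_one]
      rw [hd, Nat.add_sub_cancel_left, hd', Nat.add_sub_cancel_left]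
      ring
    have h3 := natDegree_pow_le_of_le (m i - m s) h1
    have h2 := natDegree_mul_le (p := (∏ l ∈ Finset.Ioi i, (X - C (τ l))) *
      (∏ l ∈ Finset.Iio s, (X - C (τ l)))) (q := (1 + C β * X : K[X]) ^ (m i - m s))
    rw [((monic_prod_X_sub_C τ _).natDegree_mul (monic_prod_X_sub_C τ _)),
      natDegree_finsetProd_X_sub_C_eq_card, natDegree_finsetProd_X_sub_C_eq_card, Fin.card_Ioi,
      Fin.card_Iio] at h2
    rcases hsi.eq_or_lt with hsi' | hsi'
    · rw [if_pos hsi'.symm, hsum _ (by rw [← hsi'] at h2 h3 ⊢; omega) hev, ← hsi', Nat.sub_self,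
        pow_zero, mul_one]
      have hmon := (monic_prod_X_sub_C τ (Finset.Ioi s)).mul (monic_prod_X_sub_C τ (Finset.Iio s))
      have hd : ((∏ l ∈ Finset.Ioi s, (X - C (τ l))) *
          (∏ l ∈ Finset.Iio s, (X - C (τ l)))).natDegree = N - 1 := by
        rw [((monic_prod_X_sub_C τ _).natDegree_mul (monic_prod_X_sub_C τ _)),
          natDegree_finsetProd_X_sub_C_eq_card, natDegree_finsetProd_X_sub_C_eq_card, Fin.card_Ioi,
          Fin.card_Iio]
        omega
      rw [← hd]
      exact hmon.coeff_natDegree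
    -- The degree falls short of `N - 1` by `z i - z s`, and `s` itself is counted in this
    -- difference.
    · have hlt : z s < z i := countBelow_lt hsi' ⟨b, rfl⟩
      have hsi2 : (s : ℕ) < i := hsi'
      rw [if_neg hsi'.ne', hsum _ (by omega) hev]
      exact coeff_eq_zero_of_natDegree_lt (by omega)
  · have hmle : m i ≤ m s := countBelow_mono _ his.le
    have hzle : z i ≤ z s := countBelow_mono _ his.le
    have hzs : z s < k := countBelow_apply_lt _ b
    have his2 : (i : ℕ) < s := his
    have hev : ∀ a, ((∏ l ∈ Finset.Ioi i, (u a - τ l)) * (1 + β * u a) ^ m i) *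
        ((∏ l ∈ Finset.Iio s, (u a - τ l)) * (1 + β * u a) ^ (n - m s)) =
          (C κ * (∏ l ∈ Finset.Ioo i s, (X - C (τ l))) *
            (1 + C β * X) ^ (n - (m s - m i))).eval (u a) * (1 + β * u a) ^ n := by
      intro a
      obtain ⟨d, hd⟩ := Nat.exists_eq_add_of_le hmle
      obtain ⟨d', hd'⟩ := Nat.exists_eq_add_of_le hms
      -- For `i < s` the two products cover all sites, overlapping in the open interval. The
      -- equation satisfied by the roots turns the full product into `κ (1 + β u) ^ n`, which
      -- cancels the denominator.
      have hprod := Finset.prod_union_inter (s₁ := Finset.Ioi i) (s₂ := Finset.Iio s)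
        (f := fun l => u a - τ l)
      have hunion : Finset.Ioi i ∪ Finset.Iio s = Finset.univ := by
        ext l
        simp only [Finset.mem_union, Finset.mem_Ioi, Finset.mem_Iio, Finset.mem_univ, iff_true]
        rcases lt_or_ge i l with h | h
        · exact Or.inl h
        · exact Or.inr (h.trans_lt his)
      have hinter : Finset.Ioi i ∩ Finset.Iio s = Finset.Ioo i s := by ext; simp
      rw [hunion, hinter, hroot] at hprod
      simp only [eval_mul, eval_prod, eval_sub, eval_X, eval_C, eval_pow, eval_add, eval_one]
      rw [show n - m s = d' by omega, show n - (m s - m i) = m i + d' by omega]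
      linear_combination (-(1 + β * u a) ^ (m i) * (1 + β * u a) ^ d') * hprod
    have h3 := natDegree_pow_le_of_le (n - (m s - m i)) h1
    have h2 := natDegree_mul_le (p := C κ * ∏ l ∈ Finset.Ioo i s, (X - C (τ l)))
      (q := (1 + C β * X : K[X]) ^ (n - (m s - m i)))
    have h4 := natDegree_C_mul_le κ (∏ l ∈ Finset.Ioo i s, (X - C (τ l)))
    rw [natDegree_finsetProd_X_sub_C_eq_card, Fin.card_Ioo] at h4
    rw [if_neg his.ne, hsum _ (by omega) hev]
    exact coeff_eq_zero_of_natDegree_lt (by omega)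

end Residues

/-! ### Complementary minors. -/

section ComplementaryMinors

/-- Jacobi's theorem on complementary minors. `EE` contains all row functions at all `N` roots, and
by `sum_residues` the functions `F` divided by `c` give the columns of its inverse at the places in
the second block. Multiplying by `Φ` leaves the minor in `y` next to an identity block, and the
determinant of `EE` is a known Vandermonde product. -/
theorem det_complementary_of_field {K : Type*} [Field K] {n k N : ℕ} (hN : n + k = N) (β κ : K)
    {τ : Fin N → K} (hτ : Function.Injective τ) (e : Fin n ⊕ Fin k ≃ Fin N)
    (hp : StrictMono fun a => e (Sum.inl a)) (hs : StrictMono fun a => e (Sum.inr a))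
    (y : Fin n → K) (w : Fin k → K) (hu : Function.Injective (Sum.elim y w))
    (hβ : ∀ a, 1 + β * Sum.elim y w a ≠ 0)
    (hroot : ∀ a, ∏ j, (Sum.elim y w a - τ j) = κ * (1 + β * Sum.elim y w a) ^ n) :
    (Matrix.of fun a b => (∏ l ∈ Finset.Ioi (e (Sum.inl a)), (y b - τ l)) *
        (1 + β * y b) ^ countBelow (fun c => e (Sum.inl c)) (e (Sum.inl a))).det *
      vandermondeProd w * bigPi β w ^ n =
    revVandermondeProd y * (∏ i, (1 + β * τ i) ^ countBelow (fun c => e (Sum.inl c)) i) *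
      (∏ b, (-1) ^ countBelow (fun a => e (Sum.inl a)) (e (Sum.inr b))) *
      (Matrix.of fun a b => (∏ l ∈ Finset.Iio (e (Sum.inr a)), (w b - τ l)) *
        (1 + β * w b) ^ (n - countBelow (fun c => e (Sum.inl c)) (e (Sum.inr a)))).det := by
  set m := countBelow (fun c => e (Sum.inl c)) with hm
  set u := Sum.elim y w with hudef
  let E : Fin N → K → K := fun i x => (∏ l ∈ Finset.Ioi i, (x - τ l)) * (1 + β * x) ^ m i
  let F : Fin k → K → K := fun b x =>
    (∏ l ∈ Finset.Iio (e (Sum.inr b)), (x - τ l)) * (1 + β * x) ^ (n - m (e (Sum.inr b)))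
  let c : Fin n ⊕ Fin k → K := fun a => (1 + β * u a) ^ n * ∏ v ∈ Finset.univ.erase a, (u a - u v)
  have hsum : ∀ i b, ∑ a, E i (u a) * F b (u a) / c a = if i = e (Sum.inr b) then 1 else 0 :=
    fun i b => sum_residues hN β κ τ e u hu hβ hroot i b
  let EE : Matrix (Fin n ⊕ Fin k) (Fin n ⊕ Fin k) K := Matrix.of fun a b => E (e a) (u b)
  let G : Matrix (Fin k) (Fin k) K := Matrix.of fun a b => F b (w a) / c (Sum.inr a)
  let Φ : Matrix (Fin n ⊕ Fin k) (Fin n ⊕ Fin k) K := Matrix.fromBlocks 1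
    (Matrix.of fun a b => F b (y a) / c (Sum.inl a)) 0 G
  have hmul : EE * Φ = Matrix.fromBlocks (Matrix.of fun a b => E (e (Sum.inl a)) (y b)) 0
      (Matrix.of fun a b => E (e (Sum.inr a)) (y b)) 1 := by
    have hcol : ∀ a b, (EE * Φ) a (Sum.inr b) = if e a = e (Sum.inr b) then 1 else 0 := by
      intro a b
      rw [← hsum, Matrix.mul_apply, Fintype.sum_sum_type, Fintype.sum_sum_type]
      simp only [Φ, G, EE, Matrix.fromBlocks_apply₁₂, Matrix.fromBlocks_apply₂₂, Matrix.of_apply,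
        hudef, Sum.elim_inl, Sum.elim_inr, mul_div_assoc]
    have hcol' : ∀ a b, (EE * Φ) a (Sum.inl b) = E (e a) (y b) := by
      intro a b
      rw [Matrix.mul_apply, Fintype.sum_sum_type]
      simp [Φ, EE, Matrix.one_apply, hudef]
    ext a b
    rcases b with b | b
    · rw [hcol']; rcases a with a | a <;> rfl
    · rw [hcol]
      rcases a with a | a
      · simp
      · simp [Matrix.one_apply]
  have hdet := congrArg Matrix.det hmul
  rw [Matrix.det_mul, Matrix.det_fromBlocks_zero₂₁, Matrix.det_fromBlocks_zero₁₂, Matrix.det_one,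
    one_mul, Matrix.det_one, mul_one] at hdet
  have hEE : EE.det = revVandermondeProd (fun i => u (e.symm i)) * ∏ i, (1 + β * τ i) ^ m i := by
    rw [← det_rows_eq_revVandermondeProd β hτ m (fun i => by
      have := countBelow_add e i; rw [← hm] at this; omega) fun i => u (e.symm i),
      ← Matrix.det_submatrix_equiv_self e.symm]
    congr 1
    ext a b
    simp [EE, E]
  rw [revVandermondeProd_sumElim e hp hs] at hEE
  have hc : ∏ b, c (Sum.inr b) = bigPi β w ^ n * ((∏ b, ∏ a, (w b - y a)) *
      (vandermondeProd w * revVandermondeProd w)) := by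
    rw [← prod_erase_sub, bigPi, ← Finset.prod_pow, ← Finset.prod_mul_distrib,
      ← Finset.prod_mul_distrib]
    refine Finset.prod_congr rfl fun b _ => ?_
    simp only [c, hudef, Sum.elim_inr]
    congr 1
    have : (Finset.univ : Finset (Fin n ⊕ Fin k)).erase (Sum.inr b) =
        Finset.disjSum Finset.univ (Finset.univ.erase b) := by
      ext x; rcases x with x | x <;> simp
    rw [this, Finset.prod_disjSum]
    rfl
  have hc0 : ∏ b, c (Sum.inr b) ≠ 0 := by
    refine Finset.prod_ne_zero_iff.2 fun b _ => mul_ne_zero (pow_ne_zero _ (hβ _)) ?_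
    exact Finset.prod_ne_zero_iff.2 fun v hv =>
      sub_ne_zero.2 (hu.ne (Finset.ne_of_mem_erase hv).symm)
  have hG : (∏ b, c (Sum.inr b)) * G.det = (Matrix.of fun a b => F a (w b)).det := by
    rw [← Matrix.det_mul_column, ← Matrix.det_transpose]
    congr 1
    ext a b
    have : c (Sum.inr b) ≠ 0 := Finset.prod_ne_zero_iff.1 hc0 b (Finset.mem_univ _)
    simp only [G, Matrix.transpose_apply, Matrix.of_apply]
    field_simp
  rw [hc] at hc0 hG
  have hcancel : (∏ b, ∏ a, (w b - y a)) * revVandermondeProd w ≠ 0 := by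
    intro h
    apply hc0
    linear_combination bigPi β w ^ n * vandermondeProd w * h
  refine mul_right_cancel₀ hcancel ?_
  rw [hEE] at hdet
  change (Matrix.of fun a b => E (e (Sum.inl a)) (y b)).det * _ * _ * _ = _ * _ * _ *
    (Matrix.of fun a b => F a (w b)).det * _
  rw [← hdet, ← hG]
  ring

theorem det_complementary {A : Type*} [CommRing A] [IsDomain A] {n k N : ℕ} (hN : n + k = N)
    (β κ : A) {τ : Fin N → A} (hτ : Function.Injective τ) (e : Fin n ⊕ Fin k ≃ Fin N)
    (hp : StrictMono fun a => e (Sum.inl a)) (hs : StrictMono fun a => e (Sum.inr a))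
    (y : Fin n → A) (w : Fin k → A) (hu : Function.Injective (Sum.elim y w))
    (hβ : ∀ a, 1 + β * Sum.elim y w a ≠ 0)
    (hroot : ∀ a, ∏ j, (Sum.elim y w a - τ j) = κ * (1 + β * Sum.elim y w a) ^ n) :
    (Matrix.of fun a b => (∏ l ∈ Finset.Ioi (e (Sum.inl a)), (y b - τ l)) *
        (1 + β * y b) ^ countBelow (fun c => e (Sum.inl c)) (e (Sum.inl a))).det *
      vandermondeProd w * bigPi β w ^ n =
    revVandermondeProd y * (∏ i, (1 + β * τ i) ^ countBelow (fun c => e (Sum.inl c)) i) *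
      (∏ b, (-1) ^ countBelow (fun a => e (Sum.inl a)) (e (Sum.inr b))) *
      (Matrix.of fun a b => (∏ l ∈ Finset.Iio (e (Sum.inr a)), (w b - τ l)) *
        (1 + β * w b) ^ (n - countBelow (fun c => e (Sum.inl c)) (e (Sum.inr a)))).det := by
  have hφ := IsFractionRing.injective A (FractionRing A)
  set φ := algebraMap A (FractionRing A)
  have helim : ∀ a, Sum.elim (φ ∘ y) (φ ∘ w) a = φ (Sum.elim y w a) := by
    rintro (a | a) <;> rfl
  have h := det_complementary_of_field hN (φ β) (φ κ) (τ := φ ∘ τ) (hφ.comp hτ) e hp hs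
    (φ ∘ y) (φ ∘ w)
    (fun a b hab => hu (hφ (by rwa [helim, helim] at hab)))
    (fun a => by
      rw [helim, ← map_mul, ← map_one φ, ← map_add]
      exact fun h => hβ a (hφ (h.trans (map_zero φ).symm)))
    (fun a => by
      have := congrArg φ (hroot a)
      rw [helim]
      simpa only [map_prod, map_sub, map_mul, map_pow, map_add, map_one, Function.comp_apply] using this)
  have hmap : ∀ {m : ℕ} (f : Fin m → Fin m → A),
      (Matrix.of f).map φ = Matrix.of fun a b => φ (f a b) := fun f => rfl
  apply hφ
  simpa only [map_mul, RingHom.map_det, map_prod, map_pow, map_neg, map_one, map_add,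
    vandermondeProd, revVandermondeProd, bigPi, map_sub, RingHom.mapMatrix_apply, hmap,
    Function.comp_apply] using h

end ComplementaryMinors

/-! ### From complementary minors to amplitudes. -/

section Translation

variable {A : Type*} [CommRing A]

theorem revVandermondeProd_eq_sign {m : ℕ} (y : Fin m → A) :
    revVandermondeProd y = ((Equiv.Perm.sign (Fin.revPerm (n := m)) : ℤ) : A) *
      vandermondeProd y := by
  rw [vandermondeProd, ← Matrix.det_vandermonde, ← Matrix.det_permute]
  have h1 : (Matrix.vandermonde y).submatrix Fin.revPerm id =
      Matrix.vandermonde fun i => y (Fin.rev i) := by ext i j; rfl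
  rw [h1, Matrix.det_vandermonde, revVandermondeProd]
  have h : ∀ f : Fin m → Fin m → A, ∏ i, ∏ j ∈ Finset.Ioi i, f i j =
      ∏ i, ∏ j, if i < j then f i j else 1 := by
    intro f
    refine Finset.prod_congr rfl fun i _ => ?_
    rw [← Finset.prod_filter]
    refine Finset.prod_congr ?_ fun _ _ => rfl
    ext j; simp
  rw [h, h, ← Equiv.prod_comp Fin.revPerm]
  rw [Finset.prod_comm, ← Equiv.prod_comp Fin.revPerm, Finset.prod_comm]
  rw [Finset.prod_comm]
  simp only [Fin.revPerm_apply, Fin.rev_lt_rev]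

/-- On the reversed chain the sites before the place of row `a` are those above `p a`. Each `y ⊕
(⊖τ_l)` has denominator `1 + β τ_l`, and site `l` occurs in `countBelow p l` rows, which explains
the clearing factor. -/
theorem revVandermondeProd_mul_amplitude [IsDomain A] (β : A) {m N : ℕ} {τ : Fin N → A}
    (hτ : ∀ j, IsUnit (1 + β * τ j)) {p : Fin m → Fin N} (hp : StrictMono p) (y : Fin m → A)
    (hy : ∀ i, 1 + β * y i ≠ 0) {b : Fin N → Fin 2} (hb : ∀ j, b j = 1 ↔ ∃ a, p a = j) :
    revVandermondeProd y *
        amplitude β (fun j => oneg β (τ (Fin.rev j))) y (fun j => b (Fin.rev j)) *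
      ∏ i, (1 + β * τ i) ^ countBelow p i =
    (Matrix.of fun a c => (∏ l ∈ Finset.Ioi (p a), (y c - τ l)) *
      (1 + β * y c) ^ countBelow p (p a)).det := by
  let q : Fin (m + 1) → ℕ := Fin.snoc (α := fun _ => ℕ) (fun i => (Fin.rev (p (Fin.rev i)) : ℕ)) N
  have hq : ∀ i : Fin m, q i.castSucc = (Fin.rev (p (Fin.rev i)) : ℕ) := fun i => by
    simp [q, -Fin.val_rev]
  have hplaces : IsPlaces (fun j => b (Fin.rev j)) q := by
    refine ⟨?_, by simp [q], fun j => ?_⟩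
    · intro i j hij
      rcases Fin.eq_castSucc_or_eq_last j with ⟨j, rfl⟩ | rfl
      · obtain ⟨i, rfl⟩ : ∃ i', i = Fin.castSucc i' := ⟨i.castPred (ne_of_lt
          (hij.trans (Fin.castSucc_lt_last j))), by simp⟩
        rw [hq, hq, Fin.val_fin_lt, Fin.rev_lt_rev]
        exact hp (Fin.rev_lt_rev.2 (Fin.castSucc_lt_castSucc_iff.1 hij))
      · obtain ⟨i, rfl⟩ : ∃ i', i = Fin.castSucc i' := ⟨i.castPred (ne_of_lt hij), by simp⟩
        rw [hq]
        simpa only [q, Fin.snoc_last] using Fin.is_lt _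
    · rw [hb]
      constructor
      · rintro ⟨a, ha⟩
        exact ⟨Fin.rev a, by rw [hq, Fin.rev_rev, ha, Fin.rev_rev]⟩
      · rintro ⟨i, hi⟩
        rw [hq] at hi
        exact ⟨Fin.rev i, by rw [← Fin.rev_inj, Fin.rev_rev]; exact Fin.ext hi⟩
  rw [revVandermondeProd_eq_sign, mul_assoc (_ : A) (vandermondeProd y),
    vandermondeProd_mul_amplitude β _ y hy, altSum_eq_det β _ y hplaces, ← Matrix.det_permute]
  have h1 : ∏ i, (1 + β * τ i) ^ countBelow p i = ∏ a, ∏ l ∈ Finset.Ioi (p a), (1 + β * τ l) := by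
    have h2 : ∀ i, (1 + β * τ i) ^ countBelow p i = ∏ a, if p a < i then 1 + β * τ i else 1 := by
      intro i; rw [← Finset.prod_filter, Finset.prod_const, countBelow]
    simp only [h2]
    rw [Finset.prod_comm]
    refine Finset.prod_congr rfl fun a _ => ?_
    rw [← Finset.prod_filter]
    refine Finset.prod_congr ?_ fun _ _ => rfl
    ext; simp
  rw [h1, mul_comm, ← Matrix.det_mul_column]
  congr 1
  ext a c
  have h3 : initProd β (y c) (fun j => oneg β (τ (Fin.rev j))) (Fin.rev (p a) : ℕ) =
      ∏ l ∈ Finset.Ioi (p a), oplus β (y c) (oneg β (τ l)) := by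
    rw [initProd, ← Equiv.prod_comp Fin.revPerm]
    simp only [Fin.revPerm_apply, Fin.rev_rev, Fin.val_fin_lt, Fin.rev_lt_rev]
    rw [← Finset.prod_filter]
    refine Finset.prod_congr ?_ fun _ _ => rfl
    ext; simp
  simp only [Matrix.of_apply, Matrix.submatrix_apply, rowMatrix, Fin.revPerm_apply, id, hq,
    Fin.rev_rev]
  rw [h3, countBelow_self hp, show m - 1 - (Fin.rev a : ℕ) = a by rw [Fin.val_rev]; omega,
    mul_left_comm, ← Finset.prod_mul_distrib, mul_comm]
  congr 1
  refine Finset.prod_congr rfl fun l _ => ?_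
  have h4 := one_add_mul_oneg _ _ (hτ l)
  have h5 : oneg β (τ l) * (1 + β * τ l) = 0 - τ l := quo_mul_cancel _ (hτ l)
  rw [oplus]
  linear_combination (1 + β * y c) * h5

/-- Both sides are compared entry by entry. Since `s a = a + m a`, the exponent `n + (k - 1)` splits
as `s a + (k - 1 - a) + (n - m a)`: the first part clears the product, the second the power, and the
third remains. -/
theorem bigPi_pow_mul_det_oneg (β : A) {n k N : ℕ} (hN : n + k = N) (τ : Fin N → A)
    {s : Fin k → Fin N} (m : Fin k → ℕ) (hm : ∀ b, (s b : ℕ) = b + m b) (hmn : ∀ b, m b ≤ n)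
    (w : Fin k → A) (hw : ∀ i, IsUnit (1 + β * w i)) :
    bigPi β w ^ (n + (k - 1)) * (Matrix.of fun a b : Fin k => (1 + β * oneg β (w b)) ^ (k - 1 - (a : ℕ)) *
        initProd β (oneg β (w b)) τ (s a)).det =
      (∏ a, (-1) ^ (s a : ℕ)) * (Matrix.of fun a b : Fin k => (∏ l ∈ Finset.Iio (s a), (w b - τ l)) *
        (1 + β * w b) ^ (n - m a)).det := by
  rw [bigPi, ← Finset.prod_pow, ← Matrix.det_mul_row, ← Matrix.det_mul_column]
  congr 1
  ext a b
  simp only [Matrix.of_apply]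
  have h1 := one_add_mul_oneg _ _ (hw b)
  have h2 : oneg β (w b) * (1 + β * w b) = 0 - w b := quo_mul_cancel _ (hw b)
  have h3 : (1 + β * w b) ^ (s a : ℕ) * initProd β (oneg β (w b)) τ (s a) =
      (-1) ^ (s a : ℕ) * ∏ l ∈ Finset.Iio (s a), (w b - τ l) := by
    have h4 : initProd β (oneg β (w b)) τ (s a) =
        ∏ l ∈ Finset.Iio (s a), oplus β (oneg β (w b)) (τ l) := by
      rw [initProd, ← Finset.prod_filter]
      refine Finset.prod_congr ?_ fun _ _ => rfl
      ext; simp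
    have h5 : ∀ x : A, x ^ (s a : ℕ) = ∏ _l ∈ Finset.Iio (s a), x := fun x => by
      rw [Finset.prod_const, Fin.card_Iio]
    rw [h4, h5, h5, ← Finset.prod_mul_distrib, ← Finset.prod_mul_distrib]
    refine Finset.prod_congr rfl fun l _ => ?_
    rw [oplus]
    linear_combination (1 + β * τ l) * h2
  have h6 : (1 + β * oneg β (w b)) ^ (k - 1 - (a : ℕ)) * (1 + β * w b) ^ (k - 1 - (a : ℕ)) = 1 := by
    rw [← mul_pow, h1, one_pow]
  have h7 : n + (k - 1) = (s a : ℕ) + (k - 1 - (a : ℕ)) + (n - m a) := by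
    have := hm a; have := hmn a; have := a.2; omega
  rw [h7, pow_add, pow_add]
  linear_combination (1 + β * w b) ^ (n - m a) * h3 + (1 + β * w b) ^ (n - m a) *
    (1 + β * w b) ^ (s a : ℕ) * initProd β (oneg β (w b)) τ (s a) * h6

/-- Each difference `⊖w_j - ⊖w_i` equals `(w_i - w_j) / ((1 + β w_i)(1 + β w_j))`, and every index
occurs in `k - 1` pairs. -/
theorem bigPi_pow_mul_vandermondeProd_oneg (β : A) {k : ℕ} (w : Fin k → A)
    (hw : ∀ i, IsUnit (1 + β * w i)) :
    bigPi β w ^ (k - 1) * vandermondeProd (fun i => oneg β (w i)) = revVandermondeProd w := by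
  have h1 : bigPi β w ^ (k - 1) =
      ∏ i, ∏ j ∈ Finset.Ioi i, (1 + β * w i) * (1 + β * w j) := by
    have h2 : ∀ i : Fin k, ∏ j ∈ Finset.Ioi i, (1 + β * w i) * (1 + β * w j) =
        (1 + β * w i) ^ (k - 1 - (i : ℕ)) * ∏ j, if i < j then 1 + β * w j else 1 := by
      intro i
      rw [Finset.prod_mul_distrib, Finset.prod_const, Fin.card_Ioi, ← Finset.prod_filter]
      congr 1
      refine Finset.prod_congr ?_ fun _ _ => rfl
      ext; simp
    simp only [h2]
    rw [Finset.prod_mul_distrib, Finset.prod_comm, ← Finset.prod_mul_distrib, bigPi,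
      ← Finset.prod_pow]
    refine Finset.prod_congr rfl fun i _ => ?_
    rw [← Finset.prod_filter, Finset.prod_const]
    have : (Finset.univ.filter fun b : Fin k => b < i) = Finset.Iio i := by ext; simp
    rw [this, Fin.card_Iio, ← pow_add]
    congr 1
    omega
  rw [h1, vandermondeProd, revVandermondeProd, ← Finset.prod_mul_distrib]
  refine Finset.prod_congr rfl fun i _ => ?_
  rw [← Finset.prod_mul_distrib]
  refine Finset.prod_congr rfl fun j _ => ?_
  have h3 : oneg β (w i) * (1 + β * w i) = 0 - w i := quo_mul_cancel _ (hw i)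
  have h4 : oneg β (w j) * (1 + β * w j) = 0 - w j := quo_mul_cancel _ (hw j)
  linear_combination (1 + β * w i) * h4 - (1 + β * w j) * h3

/-- Complementary amplitudes agree on shell. -/
theorem amplitude_eq_of_complementary [IsDomain A] {n k N : ℕ} (hN : n + k = N) (β κ : A)
    {τ : Fin N → A} (hτ : Function.Injective τ) (hτu : ∀ j, IsUnit (1 + β * τ j))
    (e : Fin n ⊕ Fin k ≃ Fin N) (hp : StrictMono fun a => e (Sum.inl a))
    (hs : StrictMono fun a => e (Sum.inr a)) (y : Fin n → A) (w : Fin k → A)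
    (hu : Function.Injective (Sum.elim y w)) (hβ : ∀ a, IsUnit (1 + β * Sum.elim y w a))
    (hroot : ∀ a, ∏ j, (Sum.elim y w a - τ j) = κ * (1 + β * Sum.elim y w a) ^ n)
    {b : Fin N → Fin 2} (hb : ∀ j, b j = 1 ↔ ∃ a, e (Sum.inl a) = j) {G : A}
    (hG : vandermondeProd (fun i => oneg β (w i)) * G =
      (Matrix.of fun i j : Fin k => (1 + β * oneg β (w j)) ^ (k - 1 - (i : ℕ)) *
        initProd β (oneg β (w j)) τ (e (Sum.inr i))).det) :
    amplitude β (fun j => oneg β (τ (Fin.rev j))) y (fun j => b (Fin.rev j)) = G := by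
  have hyinj : Function.Injective y := fun i j h => Sum.inl_injective (hu h)
  have hwinj : Function.Injective w := fun i j h => Sum.inr_injective (hu h)
  have hw : ∀ i, IsUnit (1 + β * w i) := fun i => hβ (Sum.inr i)
  have hy : ∀ i, 1 + β * y i ≠ 0 := fun i => (hβ (Sum.inl i)).ne_zero
  have h1 := det_complementary hN β κ hτ e hp hs y w hu (fun a => (hβ a).ne_zero) hroot
  have h2 := revVandermondeProd_mul_amplitude β hτu hp y hy hb
  have hadd : ∀ i, (e (Sum.inr i) : ℕ) =
      i + countBelow (fun a => e (Sum.inl a)) (e (Sum.inr i)) := fun i => by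
    rw [← countBelow_add e, countBelow_self hs, Nat.add_comm]
  have h3 := bigPi_pow_mul_det_oneg β hN τ (s := fun i => e (Sum.inr i))
    (fun i => countBelow (fun a => e (Sum.inl a)) (e (Sum.inr i))) hadd
    (fun i => countBelow_le _ _) w hw
  have h4 := bigPi_pow_mul_vandermondeProd_oneg β w hw
  rw [← hG, pow_add] at h3
  rw [← h2] at h1
  have h5 := revVandermondeProd_eq w
  rw [prod_prod_neg_one] at h5
  set S : A := ∏ b, (-1) ^ countBelow (fun a => e (Sum.inl a)) (e (Sum.inr b))
  set S' : A := ∏ a : Fin k, (-1) ^ (e (Sum.inr a) : ℕ)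
  set S'' : A := ∏ i : Fin k, (-1) ^ (i : ℕ)
  -- The signs from clearing denominators, from reversing the Vandermonde product of `w` and from
  -- the complementary minor match because each place in the second block is its index plus the
  -- number of places of the first block below it.
  have hS : S' = S'' * S := by
    rw [← Finset.prod_mul_distrib]
    exact Finset.prod_congr rfl fun i _ => by rw [← pow_add, ← hadd]
  have hsq : ∀ f : Fin k → ℕ, (∏ i, (-1 : A) ^ f i) * ∏ i, (-1 : A) ^ f i = 1 := fun f => by
    rw [← Finset.prod_mul_distrib]
    exact Finset.prod_eq_one fun i _ => by rw [← mul_pow]; simp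
  have hS1 : S * S = 1 := hsq _
  have hS2 : S'' * S'' = 1 := hsq _
  set P := ∏ i, (1 + β * τ i) ^ countBelow (fun c => e (Sum.inl c)) i
  have hP : P ≠ 0 := (IsUnit.prod_univ_iff.2 fun i => (hτu i).pow _).ne_zero
  have hV : vandermondeProd w ≠ 0 := vandermondeProd_ne_zero hwinj
  have hR : revVandermondeProd y ≠ 0 := by
    refine Finset.prod_ne_zero_iff.2 fun i _ => Finset.prod_ne_zero_iff.2 fun j hj =>
      sub_ne_zero.2 (hyinj.ne (Finset.mem_Ioi.1 hj).ne)
  have hB : bigPi β w ^ n ≠ 0 := ((IsUnit.prod_univ_iff.2 hw).pow n).ne_zero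
  set F := (Matrix.of fun a b => (∏ l ∈ Finset.Iio (e (Sum.inr a)), (w b - τ l)) *
    (1 + β * w b) ^ (n - countBelow (fun c => e (Sum.inl c)) (e (Sum.inr a)))).det
  have h6 : bigPi β w ^ n * vandermondeProd w * G = S * F := by
    have : bigPi β w ^ n * (S'' * vandermondeProd w) * G = S'' * S * F := by
      rw [← h5, ← hS, ← h3, ← h4]; ring
    linear_combination S'' * this + (S * F - bigPi β w ^ n * vandermondeProd w * G) * hS2
  refine mul_left_cancel₀ (mul_ne_zero (mul_ne_zero hR hP) (mul_ne_zero hV hB)) ?_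
  linear_combination h1 - revVandermondeProd y * P * h6

end Translation

/-! ### The places of a partition and of its dual. -/

section Conjugation

variable {n k : ℕ}

namespace BoxedPartition

theorem bits_eq_one_iff (l : BoxedPartition n k) (j : Fin (n + k)) :
    l.bits j = 1 ↔ ∃ a, l.place a = j := by
  have key : l.bits j = 1 ↔ ∃ i, l.pos i = (j : ℕ) + 1 := by
    unfold bits
    split_ifs with hc <;> simp [hc]
  rw [key]
  refine exists_congr fun a => ?_
  rw [← l.val_place a, Fin.ext_iff]
  omega

theorem star_part_rev (l : BoxedPartition n k) (i : Fin k) :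
    l.star.part (Fin.rev i) =
      (Finset.univ.filter fun a : Fin n => l.part (Fin.rev a) ≤ i).card := by
  change (Finset.univ.filter fun a : Fin n => ((Fin.rev i : Fin k) : ℕ) < l.dual.part a).card = _
  congr 1
  ext a
  simp only [Finset.mem_filter, Finset.mem_univ, true_and]
  have h1 : l.dual.part a = k - l.part (Fin.rev a) := by
    change ((Fin.rev (l.1 (Fin.rev a)) : Fin (k + 1)) : ℕ) = _
    rw [Fin.val_rev, part]; omega
  have h2 : l.part (Fin.rev a) < k + 1 := (l.1 (Fin.rev a)).2
  rw [h1, Fin.val_rev]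
  have := i.2
  omega

/-- The `i`-th place of the dual is `i` plus the number of parts at most `i`. That number exceeds
`a` when the part at `a` is at most `i` and is at most `a` otherwise, so the places never coincide.
-/
theorem place_ne_star_place (l : BoxedPartition n k) (a : Fin n) (i : Fin k) :
    l.place a ≠ Fin.cast (Nat.add_comm k n) (l.star.place i) := by
  intro h
  have h1 : (l.place a : ℕ) = l.star.place i := by rw [h]; rfl
  have h2 : (l.place a : ℕ) = l.part (Fin.rev a) + a := rfl
  have h3 : (l.star.place i : ℕ) = l.star.part (Fin.rev i) + i := rfl
  rw [h2, h3, star_part_rev] at h1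
  have hmono : ∀ b c : Fin n, b ≤ c → l.part (Fin.rev b) ≤ l.part (Fin.rev c) := fun b c hbc =>
    l.2 (Fin.rev_le_rev.2 hbc)
  rcases le_or_gt (l.part (Fin.rev a)) i with hle | hlt
  · have : (Finset.Iic a).card ≤
        (Finset.univ.filter fun b : Fin n => l.part (Fin.rev b) ≤ i).card := by
      refine Finset.card_le_card fun b hb => ?_
      simp only [Finset.mem_filter, Finset.mem_univ, true_and]
      exact (hmono b a (Finset.mem_Iic.1 hb)).trans hle
    rw [Fin.card_Iic] at this
    omega
  · have : (Finset.univ.filter fun b : Fin n => l.part (Fin.rev b) ≤ i).card ≤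
        (Finset.Iio a).card := by
      refine Finset.card_le_card fun b hb => ?_
      simp only [Finset.mem_filter, Finset.mem_univ, true_and] at hb
      refine Finset.mem_Iio.2 (not_le.1 fun hab => ?_)
      have := hmono a b hab
      omega
    rw [Fin.card_Iio] at this
    omega

/-- The places of the letters `1`, followed by the places of the letters `0`. -/
noncomputable def placeEquiv (l : BoxedPartition n k) : Fin n ⊕ Fin k ≃ Fin (n + k) :=
  Equiv.ofBijective (Sum.elim l.place fun i => Fin.cast (Nat.add_comm k n) (l.star.place i)) <| by
    rw [Fintype.bijective_iff_injective_and_card]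
    refine ⟨Function.Injective.sumElim l.place_strictMono.injective
      ((Fin.cast_injective _).comp l.star.place_strictMono.injective) l.place_ne_star_place, ?_⟩
    simp

theorem isPlaces (l : BoxedPartition n k) :
    IsPlaces l.bits (Fin.snoc (α := fun _ => ℕ) (fun i => (l.place i : ℕ)) (n + k)) := by
  refine ⟨?_, by simp, fun j => ?_⟩
  · intro i j hij
    rcases Fin.eq_castSucc_or_eq_last j with ⟨j, rfl⟩ | rfl
    · obtain ⟨i, rfl⟩ : ∃ i', i = Fin.castSucc i' := ⟨i.castPred (ne_of_lt
        (hij.trans (Fin.castSucc_lt_last j))), by simp⟩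
      simp only [Fin.snoc_castSucc]
      exact l.place_strictMono (Fin.castSucc_lt_castSucc_iff.1 hij)
    · obtain ⟨i, rfl⟩ : ∃ i', i = Fin.castSucc i' := ⟨i.castPred (ne_of_lt hij), by simp⟩
      simp only [Fin.snoc_castSucc, Fin.snoc_last]
      exact (l.place i).2
  · rw [bits_eq_one_iff]
    simp only [Fin.snoc_castSucc, Fin.ext_iff]

end BoxedPartition

end Conjugation

/-! ### Bethe roots and their complements as roots of one equation. -/

section OnShell

-- `∏ (X - τ_l) - ∏ (X - x_l)` has degree less than `N` and agrees with `γ (1 + β X) ^ n` at `N`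
-- points, hence everywhere. Evaluation at `-1/β`, where the latter vanishes, gives the claim.
open Polynomial in
theorem prod_one_add_mul_eq_of_field {K : Type*} [Field K] {β : K} (hβ : β ≠ 0) (γ : K) {n N : ℕ}
    (hn : n ≠ 0) (hnN : n < N) (τ x : Fin N → K) (hx : Function.Injective x)
    (hroot : ∀ j, ∏ l, (x j - τ l) = γ * (1 + β * x j) ^ n) :
    ∏ j, (1 + β * x j) = ∏ j, (1 + β * τ j) := by
  have h1 : (1 + C β * X : K[X]).natDegree ≤ 1 := by compute_degree
  have h2 : (C γ * (1 + C β * X) ^ n : K[X]).degree < (N : WithBot ℕ) := by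
    refine degree_le_natDegree.trans_lt ?_
    have h3 := natDegree_pow_le_of_le n h1
    have h4 := natDegree_C_mul_le γ ((1 + C β * X : K[X]) ^ n)
    exact_mod_cast (by omega : (C γ * (1 + C β * X) ^ n : K[X]).natDegree < N)
  have hmon : ∀ v : Fin N → K, (∏ l, (X - C (v l))).Monic := fun v => monic_prod_X_sub_C v _
  have hdeg : ∀ v : Fin N → K, (∏ l, (X - C (v l))).degree = (N : WithBot ℕ) := fun v => by
    rw [degree_eq_natDegree (hmon v).ne_zero, natDegree_finsetProd_X_sub_C_eq_card]; simp
  have h5 : (∏ l, (X - C (τ l)) - ∏ l, (X - C (x l))).degree < (N : WithBot ℕ) := by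
    rw [← hdeg τ]
    exact degree_sub_lt_left ((hdeg τ).trans (hdeg x).symm) (hmon τ).ne_zero
      ((hmon τ).leadingCoeff.trans (hmon x).leadingCoeff.symm)
  have hpoly : ∏ l, (X - C (τ l)) - ∏ l, (X - C (x l)) = C γ * (1 + C β * X) ^ n := by
    refine eq_of_degrees_lt_of_eval_index_eq (s := Finset.univ) (v := x) hx.injOn
      (by simpa using h5) (by simpa using h2) fun j _ => ?_
    have h6 : ∏ l, (x j - x l) = 0 := Finset.prod_eq_zero (Finset.mem_univ j) (sub_self _)
    simp only [eval_sub, eval_prod, eval_X, eval_C, eval_mul, eval_pow, eval_add, eval_one]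
    rw [h6, sub_zero, hroot]
  have hev := congrArg (eval (-β⁻¹)) hpoly
  simp only [eval_sub, eval_prod, eval_X, eval_C, eval_mul, eval_pow, eval_add, eval_one] at hev
  have h7 : 1 + β * -β⁻¹ = 0 := by field_simp; ring
  rw [h7, zero_pow hn, mul_zero, sub_eq_zero] at hev
  have h8 : ∀ v : Fin N → K, ∏ j, (1 + β * v j) = (-β) ^ N * ∏ j, (-β⁻¹ - v j) := by
    intro v
    have hc : (-β) ^ N = ∏ _j : Fin N, (-β) := by simp
    rw [hc, ← Finset.prod_mul_distrib]
    refine Finset.prod_congr rfl fun j _ => ?_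
    field_simp
    ring
  rw [h8, h8, hev]

theorem prod_one_add_mul_eq {A : Type*} [CommRing A] [IsDomain A] {β : A} (hβ : β ≠ 0) (γ : A)
    {n N : ℕ} (hn : n ≠ 0) (hnN : n < N) (τ x : Fin N → A) (hx : Function.Injective x)
    (hroot : ∀ j, ∏ l, (x j - τ l) = γ * (1 + β * x j) ^ n) :
    ∏ j, (1 + β * x j) = ∏ j, (1 + β * τ j) := by
  have hφ := IsFractionRing.injective A (FractionRing A)
  set φ := algebraMap A (FractionRing A)
  have h := prod_one_add_mul_eq_of_field (β := φ β) (fun h => hβ (hφ (h.trans (map_zero φ).symm)))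
    (φ γ) hn hnN (φ ∘ τ) (φ ∘ x) (hφ.comp hx) (fun j => by
      simpa only [map_prod, map_sub, map_mul, map_pow, map_add, map_one, Function.comp_apply]
        using congrArg φ (hroot j))
  apply hφ
  simpa only [map_prod, map_add, map_one, map_mul, Function.comp_apply] using h

variable {n k : ℕ}

theorem constantCoeff_sumElim {α : BoxedPartition n k} {y : Fin n → RTq (n + k)}
    {w : Fin k → RTq (n + k)} (hy : IsBetheRoot α y) (hw : IsComplementaryRoot α w)
    (a : Fin n ⊕ Fin k) :
    PowerSeries.constantCoeff (Sum.elim y w a) = tR (n + k) (α.placeEquiv a) := by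
  rcases a with a | a
  · exact ((isBetheRoot_iff α y).1 hy).1 a
  · exact ((isComplementaryRoot_iff α w).1 hw).1 a

/-- The equation with the constant of `y` has `N` roots, `n` of which are `y`. The product formula
`∏ (1 + β x_j) = ∏ (1 + β t_j)` shows that the other `k` satisfy the complementary system, so by
uniqueness they are `w`. -/
theorem exists_common_constant {α : BoxedPartition n k} {y : Fin n → RTq (n + k)}
    {w : Fin k → RTq (n + k)} (hy : IsBetheRoot α y) (hw : IsComplementaryRoot α w) :
    ∃ κ, ∀ a, ∏ j, (Sum.elim y w a - PowerSeries.C (tR (n + k) j)) =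
      κ * (1 + beta (n + k) * Sum.elim y w a) ^ n := by
  obtain ⟨hy0, hy1⟩ := (isBetheRoot_iff α y).1 hy
  obtain ⟨hw0, hw1⟩ := (isComplementaryRoot_iff α w).1 hw
  rw [← beta_eq] at hy1 hw1
  -- If one family is empty, the constant of the other serves; the product formula needs `0 < n <
  -- N`.
  rcases Nat.eq_zero_or_pos k with hk | hk
  · refine ⟨PowerSeries.X * (-(-1) ^ n *
      (∏ j, (1 + beta (n + k) * PowerSeries.C (tR (n + k) j))) *
        Ring.inverse (bigPi (beta (n + k)) y)), ?_⟩
    rintro (a | a)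
    · rw [Sum.elim_inl, hy1 a, mul_right_comm]
    · exact absurd a.2 (by omega)
  rcases Nat.eq_zero_or_pos n with hn | hn
  · refine ⟨PowerSeries.X * (-(-1) ^ n * bigPi (beta (n + k)) w), ?_⟩
    rintro (a | a)
    · exact absurd a.2 (by omega)
    · rw [Sum.elim_inr, hw1 a, mul_right_comm]
  set T : RTq (n + k) := ∏ j, (1 + beta (n + k) * PowerSeries.C (tR (n + k) j))
  set c : RTq (n + k) := -(-1) ^ n * T * Ring.inverse (bigPi (beta (n + k)) y) with hc
  -- With the constant frozen at its value for `y` the equations decouple, and every `t_j` deforms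
  -- to a root.
  obtain ⟨x, ⟨hx0, hx1⟩, -⟩ := existsUnique_deformation (betaR (n + k)) (tR (n + k))
    (fun i j => isUnit_tR_sub) id n (fun _ => c) (fun _ _ _ _ _ _ => rfl)
  rw [← beta_eq] at hx1
  have hyx : y = fun i => x (α.place i) := by
    refine (existsUnique_deformation (betaR (n + k)) (tR (n + k)) (fun i j => isUnit_tR_sub)
      α.place n (fun _ => c) (fun _ _ _ _ _ _ => rfl)).unique ⟨hy0, ?_⟩
      ⟨fun i => hx0 _, fun i => ?_⟩
    · exact hy1
    · exact hx1 _
  have hxinj : Function.Injective x := injective_of_constantCoeff (P := id) Function.injective_id hx0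
  have hβ : beta (n + k) ≠ 0 := by
    rw [beta_eq]
    exact fun h => betaR_ne_zero (PowerSeries.C_injective (h.trans (map_zero _).symm))
  have hprod := prod_one_add_mul_eq hβ (PowerSeries.X * c) hn.ne' (by omega)
    (fun j => PowerSeries.C (tR (n + k) j)) x hxinj (fun j => by rw [hx1 j, mul_right_comm])
  set w' : Fin k → RTq (n + k) := fun i => x (Fin.cast (Nat.add_comm k n) (α.star.place i))
  have hsplit : bigPi (beta (n + k)) y * bigPi (beta (n + k)) w' = T := by
    refine Eq.trans ?_ hprod
    rw [← Equiv.prod_comp α.placeEquiv, Fintype.prod_sum_type, hyx]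
    rfl
  have hyu : IsUnit (bigPi (beta (n + k)) y) :=
    IsUnit.prod_univ_iff.2 fun i => isUnit_one_add_beta_mul (hy0 i)
  have hcw : c = -(-1) ^ n * bigPi (beta (n + k)) w' := by
    rw [hc, ← hsplit]
    linear_combination (-(-1) ^ n * bigPi (beta (n + k)) w') * Ring.mul_inverse_cancel _ hyu
  have hw' : IsComplementaryRoot α w' := by
    rw [isComplementaryRoot_iff, ← beta_eq, ← hcw]
    exact ⟨fun i => hx0 _, fun i => hx1 _⟩
  have hww : w = w' := (existsUnique_isComplementaryRoot α).unique hw hw'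
  refine ⟨PowerSeries.X * c, ?_⟩
  rintro (a | a)
  · rw [Sum.elim_inl, hyx, hx1, mul_right_comm]
  · rw [Sum.elim_inr, hww, hx1, mul_right_comm]

theorem isUnit_one_add_beta_mul_root {α : BoxedPartition n k} {y : Fin n → RTq (n + k)}
    (hy : IsBetheRoot α y) (i : Fin n) : IsUnit (1 + beta (n + k) * y i) :=
  isUnit_one_add_beta_mul (((isBetheRoot_iff α y).1 hy).1 i)

theorem isUnit_one_add_beta_mul_C (j : Fin (n + k)) :
    IsUnit (1 + beta (n + k) * PowerSeries.C (tR (n + k) j)) :=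
  isUnit_one_add_beta_mul (j := j) (by simp)

/-- The inhomogeneities `⊖ t`, numbered from `0`. -/
noncomputable abbrev site (n k : ℕ) (j : Fin (n + k)) : RTq (n + k) :=
  oneg (beta (n + k)) (tParam (n + k) ((j : ℕ) + 1))

theorem amplitude_eq_schubertValue (l : BoxedPartition n k) {y : Fin n → RTq (n + k)}
    (hinj : Function.Injective y) (hy : ∀ i, IsUnit (1 + beta (n + k) * y i)) :
    amplitude (beta (n + k)) (site n k) y l.bits = schubertValue l y := by
  refine mul_left_cancel₀ (vandermondeProd_ne_zero hinj) ?_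
  rw [schubertValue, vandermondeProd_mul_grothendieck _ _ _ (fun i => (hy i).ne_zero),
    vandermondeProd_mul_amplitude _ _ _ (fun i => (hy i).ne_zero), altSum_eq_det _ _ _ l.isPlaces,
    rowMatrix]
  simp only [Fin.snoc_castSucc]
  rfl

theorem placeProd_bits_mul (β : RTq (n + k)) (s τ : Fin (n + k) → RTq (n + k))
    (h : ∀ j, (1 + β * s j) * (1 + β * τ j) = 1) (l : BoxedPartition n k) :
    placeProd β s l.bits * ∏ i, (1 + β * τ (l.place i)) = 1 := by
  have h1 : placeProd β s l.bits = ∏ i, (1 + β * s (l.place i)) := by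
    rw [placeProd, ← Equiv.prod_comp l.placeEquiv, Fintype.prod_sum_type]
    have h2 : ∀ i, l.bits (l.placeEquiv (Sum.inl i)) = 1 := fun i =>
      (l.bits_eq_one_iff _).2 ⟨i, rfl⟩
    have h3 : ∀ i, l.bits (l.placeEquiv (Sum.inr i)) ≠ 1 := fun i hi => by
      obtain ⟨a, ha⟩ := (l.bits_eq_one_iff _).1 hi
      exact l.place_ne_star_place a i ha
    simp [h2, h3]
    rfl
  rw [h1, ← Finset.prod_mul_distrib]
  exact Finset.prod_eq_one fun i _ => h _

/-- Reversal produces the factor `Π(y) / Π(t_ν)`, the denominator coming from `1 + β (⊖t) = 1 / (1 +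
β t)` at the letters `1`; the remaining reversed amplitude is converted by the complementary minors.
-/
theorem creation_eq_dualSchubertValue {α : BoxedPartition n k} {y : Fin n → RTq (n + k)}
    {w : Fin k → RTq (n + k)} (hy : IsBetheRoot α y) (hw : IsComplementaryRoot α w)
    (ν : BoxedPartition n k) :
    creation (beta (n + k)) (site n k) y ν.bits =
      quo (bigPi (beta (n + k)) y) (bigPi (beta (n + k)) (specialize (tParam (n + k)) ν)) *
        dualSchubertValue ν w := by
  obtain ⟨κ, hκ⟩ := exists_common_constant hy hw
  have hcc := constantCoeff_sumElim hy hw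
  have hβ : ∀ a, IsUnit (1 + beta (n + k) * Sum.elim y w a) := fun a =>
    isUnit_one_add_beta_mul (hcc a)
  have hwu : ∀ i, IsUnit (1 + beta (n + k) * w i) := fun i => hβ (Sum.inr i)
  have hsite : site n k = fun j => oneg (beta (n + k)) (PowerSeries.C (tR (n + k) j)) := by
    funext j; rw [site, tParam_eq]
  have hamp := amplitude_eq_of_complementary rfl (beta (n + k)) κ
    (τ := fun j => PowerSeries.C (tR (n + k) j))
    (fun i j hij => by
      by_contra hne
      have := isUnit_tR_sub hne
      rw [PowerSeries.C_injective hij, sub_self] at this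
      exact not_isUnit_zero this)
    isUnit_one_add_beta_mul_C ν.placeEquiv ν.place_strictMono
    ν.star.place_strictMono y w
    (fun a b hab => by
      by_contra hne
      have := isUnit_tR_sub (α.placeEquiv.injective.ne hne)
      rw [← hcc, ← hcc, hab, sub_self] at this
      exact not_isUnit_zero this)
    hβ hκ (b := ν.bits) ν.bits_eq_one_iff (G := dualSchubertValue ν w) (by
      rw [dualSchubertValue, vandermondeProd_mul_grothendieck _ _ _ fun i =>
        (IsUnit.of_mul_eq_one _ (one_add_mul_oneg _ _ (hwu i))).ne_zero]
      congr 1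
      ext i j : 2
      rw [Matrix.of_apply, Matrix.of_apply]
      congr 1
      -- The dual partition lives on a chain of length `k + n`, which has to be identified with `n +
      -- k`.
      have key : ∀ {M : ℕ} (hM : k + n = M) (p : ℕ), initProd (beta (n + k))
          (oneg (beta (n + k)) (w j)) (fun j : Fin (k + n) => tParam (n + k) ((j : ℕ) + 1)) p =
          initProd (beta (n + k)) (oneg (beta (n + k)) (w j))
            (fun j : Fin M => tParam (n + k) ((j : ℕ) + 1)) p := by
        rintro M rfl p; rfl
      rw [key (Nat.add_comm k n)]
      simp only [tParam_eq]
      rfl)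
  rw [creation_eq, hsite, hamp, quo]
  have h1 : bigPi (beta (n + k)) (specialize (tParam (n + k)) ν) =
      ∏ i, (1 + beta (n + k) * PowerSeries.C (tR (n + k) (ν.place i))) := by
    rw [bigPi]
    refine Finset.prod_congr rfl fun i _ => ?_
    rw [specialize_eq ν rfl]; rfl
  have h2 := placeProd_bits_mul (beta (n + k))
    (fun j => oneg (beta (n + k)) (PowerSeries.C (tR (n + k) j)))
    (fun j => PowerSeries.C (tR (n + k) j))
    (fun j => one_add_mul_oneg _ _ (isUnit_one_add_beta_mul_C j)) ν
  rw [← h1] at h2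
  have h3 : Ring.inverse (bigPi (beta (n + k)) (specialize (tParam (n + k)) ν)) =
      placeProd (beta (n + k)) (fun j => oneg (beta (n + k)) (PowerSeries.C (tR (n + k) j)))
        ν.bits := by
    have hu : IsUnit (bigPi (beta (n + k)) (specialize (tParam (n + k)) ν)) :=
      IsUnit.of_mul_eq_one_right _ h2
    refine hu.mul_left_cancel ?_
    rw [Ring.mul_inverse_cancel _ hu, mul_comm, h2]
  rw [h3]

end OnShell

/-! ### Boxed partitions and binary strings. -/

section Strings

variable {n k : ℕ}

theorem add_sub_le_of_strictMono {m : ℕ} {p : Fin m → ℕ} (hp : StrictMono p) {i j : Fin m}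
    (hij : i ≤ j) : p i + ((j : ℕ) - i) ≤ p j := by
  obtain ⟨d, hd⟩ : ∃ d, (j : ℕ) - i = d := ⟨_, rfl⟩
  rw [hd]
  induction d generalizing j with
  | zero =>
    have : i = j := Fin.ext (by have : (i : ℕ) ≤ j := hij; omega)
    rw [this]; omega
  | succ d ih =>
    have hj : (j : ℕ) - 1 < m := by have := j.2; omega
    have h1 := ih (j := ⟨(j : ℕ) - 1, hj⟩) (by rw [Fin.le_def]; simp only; omega)
      (by simp only; omega)
    have h2 : p ⟨(j : ℕ) - 1, hj⟩ < p j := hp (by rw [Fin.lt_def]; simp only; omega)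
    omega

theorem BoxedPartition.place_injective :
    Function.Injective (BoxedPartition.place : BoxedPartition n k → Fin n → Fin (n + k)) := by
  intro l l' h
  refine Subtype.ext (funext fun i => Fin.ext ?_)
  have h1 : ∀ l : BoxedPartition n k, (l.place (Fin.rev i) : ℕ) = (l.1 i : ℕ) + (Fin.rev i : ℕ) := by
    intro l
    change l.part (Fin.rev (Fin.rev i)) + _ = _
    rw [Fin.rev_rev]; rfl
  have h2 := h1 l
  have h3 := h1 l'
  rw [h] at h2
  omega

theorem BoxedPartition.bits_injective :
    Function.Injective (BoxedPartition.bits : BoxedPartition n k → Fin (n + k) → Fin 2) := by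
  intro l l' h
  apply BoxedPartition.place_injective
  rw [← StrictMono.range_inj l.place_strictMono l'.place_strictMono]
  ext j
  rw [Set.mem_range, Set.mem_range, ← l.bits_eq_one_iff, ← l'.bits_eq_one_iff, h]

/-- Strict monotonicity and the final value `n + k` force `i ≤ p i ≤ k + i`, so the numbers `p i -
i` are the parts, in increasing order. -/
theorem IsPlaces.exists_bits_eq {b : Fin (n + k) → Fin 2} {p : Fin (n + 1) → ℕ}
    (h : IsPlaces b p) : ∃ l : BoxedPartition n k, l.bits = b := by
  have hge : ∀ i : Fin (n + 1), (i : ℕ) ≤ p i := fun i => by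
    have := add_sub_le_of_strictMono h.strictMono (Fin.zero_le i)
    simp only [Fin.val_zero] at this
    omega
  have hle : ∀ i : Fin (n + 1), p i ≤ k + i := fun i => by
    have := add_sub_le_of_strictMono h.strictMono (Fin.le_last i)
    rw [h.last, Fin.val_last] at this
    have := i.2
    omega
  let l : BoxedPartition n k := ⟨fun i => ⟨p (Fin.rev i).castSucc - (Fin.rev i : ℕ), by
      have := hle (Fin.rev i).castSucc
      simp only [Fin.val_castSucc] at this
      omega⟩, by
    intro i j hij
    rw [Fin.mk_le_mk]
    have h1 := add_sub_le_of_strictMono h.strictMono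
      (Fin.castSucc_le_castSucc_iff.2 (Fin.rev_le_rev.2 hij))
    have h2 := hge (Fin.rev j).castSucc
    have h3 : (Fin.rev j : ℕ) ≤ Fin.rev i := Fin.rev_le_rev.2 hij
    simp only [Fin.val_castSucc] at h1 h2
    omega⟩
  have hplace : ∀ i, (l.place i : ℕ) = p i.castSucc := by
    intro i
    change p (Fin.rev (Fin.rev i)).castSucc - (Fin.rev (Fin.rev i) : ℕ) + (i : ℕ) = _
    rw [Fin.rev_rev]
    have := hge i.castSucc
    simp only [Fin.val_castSucc] at this
    omega
  refine ⟨l, funext fun j => ?_⟩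
  have h1 : l.bits j = 1 ↔ b j = 1 := by
    rw [l.bits_eq_one_iff, h.iff]
    simp only [Fin.ext_iff, hplace]
  have key : ∀ a b : Fin 2, (a = 1 ↔ b = 1) → a = b := by decide
  exact key _ _ h1

theorem exists_bits_eq_of_card {b : Fin (n + k) → Fin 2}
    (h : (Finset.univ.filter fun j => b j = 1).card = n) :
    ∃ l : BoxedPartition n k, l.bits = b := by
  obtain ⟨m, p, hp⟩ := exists_isPlaces b
  obtain rfl : m = n := hp.card.symm.trans h
  exact hp.exists_bits_eq

theorem amplitude_eq_zero_of_card {A : Type*} [CommRing A] [IsDomain A] (β : A) {m N : ℕ}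
    (s : Fin N → A) {y : Fin m → A} (hinj : Function.Injective y) (hy : ∀ i, 1 + β * y i ≠ 0)
    {b : Fin N → Fin 2} (hb : (Finset.univ.filter fun j => b j = 1).card ≠ m) :
    amplitude β s y b = 0 := by
  obtain ⟨m', p, hp⟩ := exists_isPlaces b
  have h1 := vandermondeProd_mul_amplitude β s y hy b
  rw [altSum_eq_zero β s y hp (hp.card ▸ hb)] at h1
  exact (mul_eq_zero.1 h1).resolve_left (vandermondeProd_ne_zero hinj)

theorem creation_eq_zero_of_card {A : Type*} [CommRing A] [IsDomain A] (β : A) {m N : ℕ}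
    (s : Fin N → A) {y : Fin m → A} (hinj : Function.Injective y) (hy : ∀ i, 1 + β * y i ≠ 0)
    {b : Fin N → Fin 2} (hb : (Finset.univ.filter fun j => b j = 1).card ≠ m) :
    creation β s y b = 0 := by
  have h : (Finset.univ.filter fun j => b (Fin.rev j) = 1).card =
      (Finset.univ.filter fun j => b j = 1).card := by
    rw [Finset.card_filter, Finset.card_filter, ← Equiv.sum_comp Fin.revPerm]
    simp only [Fin.revPerm_apply, Fin.rev_rev]
  rw [creation_eq, amplitude_eq_zero_of_card β _ hinj hy (by rwa [h]), mul_zero]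

theorem sum_bits {M : Type*} [AddCommMonoid M] (f : (Fin (n + k) → Fin 2) → M)
    (hf : ∀ b, (Finset.univ.filter fun j => b j = 1).card ≠ n → f b = 0) :
    ∑ b, f b = ∑ l : BoxedPartition n k, f l.bits := by
  refine (Fintype.sum_of_injective _ BoxedPartition.bits_injective _ _ (fun b hb => hf b ?_)
    fun _ => rfl).symm
  exact fun h => hb (exists_bits_eq_of_card h)

end Strings

/-! ### Orthogonality and invertibility of the norms. -/

section Pairing

variable {n k : ℕ}

theorem oplus_site_mul (y : RTq (n + k)) (j : Fin (n + k)) :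
    oplus (beta (n + k)) y (site n k j) * (1 + beta (n + k) * PowerSeries.C (tR (n + k) j)) =
      y - PowerSeries.C (tR (n + k) j) := by
  have h : oneg (beta (n + k)) (PowerSeries.C (tR (n + k) j)) *
      (1 + beta (n + k) * PowerSeries.C (tR (n + k) j)) = 0 - PowerSeries.C (tR (n + k) j) :=
    quo_mul_cancel _ (isUnit_one_add_beta_mul_C j)
  rw [site, tParam_eq, oplus]
  linear_combination (1 + beta (n + k) * y) * h

theorem IsBetheRoot.constantCoeff_eq {α : BoxedPartition n k} {y : Fin n → RTq (n + k)}
    (hy : IsBetheRoot α y) (i : Fin n) :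
    PowerSeries.constantCoeff (y i) = tR (n + k) (α.place i) :=
  ((isBetheRoot_iff α y).1 hy).1 i

theorem IsBetheRoot.equation {α : BoxedPartition n k} {y : Fin n → RTq (n + k)}
    (hy : IsBetheRoot α y) (i : Fin n) :
    (∏ j, oplus (beta (n + k)) (y i) (site n k j)) * bigPi (beta (n + k)) y =
      -(-1) ^ n * PowerSeries.X * (1 + beta (n + k) * y i) ^ n := by
  have h1 := hy.2.1 i
  simp only [ominus_eq_oplus_oneg _ _ _ (isUnit_one_add_beta_mul_tParam _)] at h1
  have h2 := quo_mul_cancel (bigPi (beta (n + k)) y) ((isUnit_one_add_beta_mul_root hy i).pow n)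
  have hsq : ((-1 : RTq (n + k)) ^ n) * (-1) ^ n = 1 := by rw [← mul_pow]; simp
  change (-1) ^ n * quo (bigPi (beta (n + k)) y) ((1 + beta (n + k) * y i) ^ n) *
    (∏ j, oplus (beta (n + k)) (y i) (site n k j)) + PowerSeries.X = 0 at h1
  set O := ∏ j, oplus (beta (n + k)) (y i) (site n k j)
  set Q := quo (bigPi (beta (n + k)) y) ((1 + beta (n + k) * y i) ^ n)
  linear_combination (-1) ^ n * (1 + beta (n + k) * y i) ^ n * h1 - O * h2 -
    Q * O * (1 + beta (n + k) * y i) ^ n * hsq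

theorem exists_place_notMem {α α' : BoxedPartition n k} (h : α ≠ α') :
    ∃ i, ∀ j, α.place i ≠ α'.place j := by
  by_contra! hcon
  apply h
  apply BoxedPartition.place_injective
  rw [← StrictMono.range_inj α.place_strictMono α'.place_strictMono]
  refine Set.eq_of_subset_of_ncard_le ?_ ?_ (Set.toFinite _)
  · rintro _ ⟨i, rfl⟩
    obtain ⟨j, hj⟩ := hcon i
    exact ⟨j, hj.symm⟩
  · rw [Set.ncard_range_of_injective α.place_strictMono.injective,
      Set.ncard_range_of_injective α'.place_strictMono.injective]

/-- Take `x = t_j` with `j` a place of `α` but not of `α'`. The product over all sites vanishes at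
this `x`, while `∏ (y_i - x)` has constant term zero and `∏ (y'_i - x)` has a unit as constant term.
-/
theorem sum_amplitude_mul_creation_of_ne {α α' : BoxedPartition n k} (hne : α ≠ α')
    {y y' : Fin n → RTq (n + k)} (hy : IsBetheRoot α y) (hy' : IsBetheRoot α' y') :
    ∑ b, amplitude (beta (n + k)) (site n k) y b * creation (beta (n + k)) (site n k) y' b = 0 := by
  obtain ⟨i, hi⟩ := exists_place_notMem hne
  obtain _ | m := n
  · exact i.elim0
  have hsgn : ∀ (z : RTq (m + 1 + k)), -(-1) ^ (m + 1) * PowerSeries.X * z =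
      (-1) ^ m * PowerSeries.X * z := fun z => by ring
  refine sum_amplitude_mul_creation_eq_zero (beta (m + 1 + k))
    (PowerSeries.C (tR (m + 1 + k) (α.place i))) PowerSeries.X
    (isUnit_one_add_beta_mul_C _).ne_zero PowerSeries.X_ne_zero (site (m + 1) k) ?_ y y' hy.1
    (fun i => (isUnit_one_add_beta_mul_root hy i).ne_zero)
    (fun i => (hy.equation i).trans (hsgn _)) hy'.1
    (fun i => (isUnit_one_add_beta_mul_root hy' i).ne_zero)
    (fun i => (hy'.equation i).trans (hsgn _)) ?_
  · refine Finset.prod_eq_zero (Finset.mem_univ (α.place i)) ?_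
    have h := oplus_site_mul (PowerSeries.C (tR (m + 1 + k) (α.place i))) (α.place i)
    rw [sub_self] at h
    exact (mul_eq_zero.1 h).resolve_right (isUnit_one_add_beta_mul_C _).ne_zero
  · intro h
    have h1 := congrArg PowerSeries.constantCoeff h
    simp only [map_prod, map_sub, hy.constantCoeff_eq, hy'.constantCoeff_eq,
      PowerSeries.constantCoeff_C] at h1
    rw [Finset.prod_eq_zero (Finset.mem_univ i) (sub_self _)] at h1
    exact (IsUnit.prod_univ_iff.2 fun j => isUnit_tR_sub (hi j).symm).ne_zero h1.symm

theorem betheNorm_eq_sum (y : Fin n → RTq (n + k)) :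
    betheNorm (n + k) y = ∑ b, amplitude (beta (n + k)) (site n k) y b *
      creation (beta (n + k)) (site n k) y b :=
  normElement_eq_sum _ _ _ isUnit_one_add_beta_mul_tParam y y

/-- The zero block has `i + 1` rows and `m - i` columns, more than `m` in total, so every
permutation meets it. -/
theorem det_eq_zero_of_corner {A : Type*} [CommRing A] {m : ℕ} (M : Matrix (Fin m) (Fin m) A)
    (i : Fin m) (h : ∀ a c, a ≤ i → i ≤ c → M a c = 0) : M.det = 0 := by
  rw [Matrix.det_apply]
  refine Finset.sum_eq_zero fun σ _ => ?_
  suffices ∃ c, i ≤ c ∧ σ c ≤ i by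
    obtain ⟨c, hc, hc'⟩ := this
    have h0 : ∏ i, M (σ i) i = 0 := Finset.prod_eq_zero (Finset.mem_univ c) (h _ _ hc' hc)
    exact (congrArg _ h0).trans (smul_zero _)
  by_contra! hcon
  have h1 : (Finset.Ici i).card ≤ (Finset.Ioi i).card :=
    Finset.card_le_card_of_injOn σ (fun c hc => by simpa using hcon c (by simpa using hc))
      σ.injective.injOn
  rw [Fin.card_Ici, Fin.card_Ioi] at h1
  have := i.2
  omega

theorem constantCoeff_initProd_eq_zero {y : RTq (n + k)} {s : Fin (n + k)}
    (hy : PowerSeries.constantCoeff y = tR (n + k) s) {p : ℕ} (hp : (s : ℕ) < p) :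
    PowerSeries.constantCoeff (initProd (beta (n + k)) y (site n k) p) = 0 := by
  rw [initProd, map_prod]
  refine Finset.prod_eq_zero (Finset.mem_univ s) ?_
  rw [if_pos hp]
  have h := congrArg PowerSeries.constantCoeff (oplus_site_mul y s)
  rw [map_mul, map_sub, hy, PowerSeries.constantCoeff_C, sub_self] at h
  exact (mul_eq_zero.1 h).resolve_right ((isUnit_one_add_beta_mul_C s).map _).ne_zero

theorem isUnit_initProd {y : RTq (n + k)} {s : Fin (n + k)}
    (hy : PowerSeries.constantCoeff y = tR (n + k) s) {p : ℕ} (hp : p ≤ s) :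
    IsUnit (initProd (beta (n + k)) y (site n k) p) := by
  rw [initProd, IsUnit.prod_univ_iff]
  intro l
  split_ifs with hl
  · refine isUnit_of_mul_isUnit_left (y := 1 + beta (n + k) * PowerSeries.C (tR (n + k) l)) ?_
    rw [oplus_site_mul, PowerSeries.isUnit_iff_constantCoeff, map_sub, hy,
      PowerSeries.constantCoeff_C]
    exact isUnit_tR_sub fun h => by rw [h] at hp; omega
  · exact isUnit_one

variable {α : BoxedPartition n k} {y : Fin n → RTq (n + k)}

theorem vandermondeProd_mul_amplitude_bits (hy : IsBetheRoot α y) (l : BoxedPartition n k) :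
    vandermondeProd y * amplitude (beta (n + k)) (site n k) y l.bits =
      (Matrix.of fun i j : Fin n => (1 + beta (n + k) * y j) ^ (n - 1 - (i : ℕ)) *
        initProd (beta (n + k)) (y j) (site n k) (l.place i)).det := by
  rw [vandermondeProd_mul_amplitude _ _ _ fun i => (isUnit_one_add_beta_mul_root hy i).ne_zero,
    altSum_eq_det _ _ _ l.isPlaces, rowMatrix]
  simp only [Fin.snoc_castSucc]

theorem isUnit_sub_of_ne (hy : IsBetheRoot α y) {i j : Fin n} (hij : i ≠ j) :
    IsUnit (y i - y j) := by
  rw [PowerSeries.isUnit_iff_constantCoeff, map_sub, hy.constantCoeff_eq, hy.constantCoeff_eq]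
  exact isUnit_tR_sub (α.place_strictMono.injective.ne hij)

theorem isUnit_revVandermondeProd (hy : IsBetheRoot α y) : IsUnit (revVandermondeProd y) := by
  rw [revVandermondeProd, IsUnit.prod_univ_iff]
  intro i
  rw [IsUnit.prod_iff]
  exact fun j hj => isUnit_sub_of_ne hy (Finset.mem_Ioi.1 hj).ne

theorem isUnit_vandermondeProd (hy : IsBetheRoot α y) : IsUnit (vandermondeProd y) := by
  rw [vandermondeProd, IsUnit.prod_univ_iff]
  intro i
  rw [IsUnit.prod_iff]
  exact fun j hj => isUnit_sub_of_ne hy (Finset.mem_Ioi.1 hj).ne'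

/-- At `q = 0` the product over the sites before `l.place a` vanishes at `t_α` whenever it passes
the place in question, which produces a zero corner in the determinant. -/
theorem constantCoeff_amplitude_eq_zero (hy : IsBetheRoot α y) {l : BoxedPartition n k} {i : Fin n}
    (hi : α.place i < l.place i) :
    PowerSeries.constantCoeff (amplitude (beta (n + k)) (site n k) y l.bits) = 0 := by
  have h := congrArg PowerSeries.constantCoeff (vandermondeProd_mul_amplitude_bits hy l)
  rw [map_mul, RingHom.map_det, ← Matrix.det_transpose, det_eq_zero_of_corner _ i] at h
  · exact (mul_eq_zero.1 h).resolve_left ((isUnit_vandermondeProd hy).map _).ne_zero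
  · intro a c hai hic
    rw [Matrix.transpose_apply, RingHom.mapMatrix_apply, Matrix.map_apply, Matrix.of_apply,
      map_mul, constantCoeff_initProd_eq_zero (hy.constantCoeff_eq a), mul_zero]
    exact (α.place_strictMono.monotone hai).trans_lt
      (hi.trans_le (l.place_strictMono.monotone hic))

theorem isUnit_amplitude (hy : IsBetheRoot α y) :
    IsUnit (amplitude (beta (n + k)) (site n k) y α.bits) := by
  refine isUnit_of_mul_isUnit_right (x := vandermondeProd y) ?_
  rw [vandermondeProd_mul_amplitude_bits hy, PowerSeries.isUnit_iff_constantCoeff,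
    RingHom.map_det, Matrix.det_of_isUpperTriangular, IsUnit.prod_univ_iff]
  · intro i
    rw [RingHom.mapMatrix_apply, Matrix.map_apply, Matrix.of_apply]
    exact (((isUnit_one_add_beta_mul_root hy i).pow _).mul
      (isUnit_initProd (hy.constantCoeff_eq i) le_rfl)).map _
  · intro i j hij
    rw [RingHom.mapMatrix_apply, Matrix.map_apply, Matrix.of_apply, map_mul,
      constantCoeff_initProd_eq_zero (hy.constantCoeff_eq j), mul_zero]
    exact α.place_strictMono hij

/-- Here the products run over the sites after a place, so the vanishing at `q = 0` is opposite to
that of the amplitudes. -/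
theorem exists_unit_mul_creation (hy : IsBetheRoot α y) (l : BoxedPartition n k) :
    ∃ u, IsUnit u ∧ u * creation (beta (n + k)) (site n k) y l.bits =
      (Matrix.of fun a c : Fin n =>
        (∏ j ∈ Finset.Ioi (l.place a), (y c - PowerSeries.C (tR (n + k) j))) *
          (1 + beta (n + k) * y c) ^ countBelow l.place (l.place a)).det := by
  have h := revVandermondeProd_mul_amplitude (beta (n + k))
    (τ := fun j => PowerSeries.C (tR (n + k) j)) isUnit_one_add_beta_mul_C l.place_strictMono y
    (fun i => (isUnit_one_add_beta_mul_root hy i).ne_zero) l.bits_eq_one_iff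
  have hsite : site n k = fun j => oneg (beta (n + k)) (PowerSeries.C (tR (n + k) j)) := by
    funext j; rw [site, tParam_eq]
  have hprod := placeProd_bits_mul (beta (n + k))
    (fun j => oneg (beta (n + k)) (PowerSeries.C (tR (n + k) j)))
    (fun j => PowerSeries.C (tR (n + k) j))
    (fun j => one_add_mul_oneg _ _ (isUnit_one_add_beta_mul_C j)) l
  have hPi : IsUnit (bigPi (beta (n + k)) y) :=
    IsUnit.prod_univ_iff.2 fun i => isUnit_one_add_beta_mul_root hy i
  obtain ⟨v, hv⟩ := hPi
  set T := ∏ i, (1 + beta (n + k) * PowerSeries.C (tR (n + k) (l.place i)))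
  set P := ∏ i, (1 + beta (n + k) * PowerSeries.C (tR (n + k) i)) ^ countBelow l.place i
  refine ⟨revVandermondeProd y * P * T * (v⁻¹ : (RTq (n + k))ˣ), ?_, ?_⟩
  · exact (((isUnit_revVandermondeProd hy).mul (IsUnit.prod_univ_iff.2 fun i =>
      (isUnit_one_add_beta_mul_C i).pow _)).mul (IsUnit.of_mul_eq_one_right _ hprod)).mul
      (Units.isUnit _)
  · rw [← h, creation_eq, ← hv, hsite]
    set a := amplitude (beta (n + k))
      (fun j => oneg (beta (n + k)) (PowerSeries.C (tR (n + k) (Fin.rev j)))) y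
      fun j => l.bits (Fin.rev j)
    linear_combination revVandermondeProd y * P * a * hprod + revVandermondeProd y * P * T * a *
      placeProd (beta (n + k)) (fun j => oneg (beta (n + k)) (PowerSeries.C (tR (n + k) j)))
        l.bits * v.inv_mul

theorem constantCoeff_creation_eq_zero (hy : IsBetheRoot α y) {l : BoxedPartition n k} {i : Fin n}
    (hi : l.place i < α.place i) :
    PowerSeries.constantCoeff (creation (beta (n + k)) (site n k) y l.bits) = 0 := by
  obtain ⟨u, hu, h⟩ := exists_unit_mul_creation hy l
  replace h := congrArg PowerSeries.constantCoeff h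
  rw [map_mul, RingHom.map_det, det_eq_zero_of_corner _ i] at h
  · exact (mul_eq_zero.1 h).resolve_left (hu.map _).ne_zero
  · intro a c hai hic
    rw [RingHom.mapMatrix_apply, Matrix.map_apply, Matrix.of_apply, map_mul, map_prod,
      Finset.prod_eq_zero (i := α.place c), zero_mul]
    · exact Finset.mem_Ioi.2 ((l.place_strictMono.monotone hai).trans_lt
        (hi.trans_le (α.place_strictMono.monotone hic)))
    · rw [map_sub, hy.constantCoeff_eq, PowerSeries.constantCoeff_C, sub_self]

theorem isUnit_creation (hy : IsBetheRoot α y) :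
    IsUnit (creation (beta (n + k)) (site n k) y α.bits) := by
  obtain ⟨u, -, h⟩ := exists_unit_mul_creation hy α
  refine isUnit_of_mul_isUnit_right (x := u) ?_
  rw [h, PowerSeries.isUnit_iff_constantCoeff, RingHom.map_det, Matrix.det_of_isLowerTriangular,
    IsUnit.prod_univ_iff]
  · intro i
    rw [RingHom.mapMatrix_apply, Matrix.map_apply, Matrix.of_apply]
    refine IsUnit.map _ (IsUnit.mul (IsUnit.prod_iff.2 fun j hj => ?_)
      ((isUnit_one_add_beta_mul_root hy i).pow _))
    rw [PowerSeries.isUnit_iff_constantCoeff, map_sub, hy.constantCoeff_eq,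
      PowerSeries.constantCoeff_C]
    exact isUnit_tR_sub (Finset.mem_Ioi.1 hj).ne
  · intro i j hij
    rw [RingHom.mapMatrix_apply, Matrix.map_apply, Matrix.of_apply, map_mul, map_prod,
      Finset.prod_eq_zero (i := α.place j), zero_mul]
    · exact Finset.mem_Ioi.2 (α.place_strictMono hij)
    · rw [map_sub, hy.constantCoeff_eq, PowerSeries.constantCoeff_C, sub_self]

/-- A partition different from `α` has a place that differs from the corresponding one of `α`.
According to its side, either the amplitude or the creation coefficient vanishes at `q = 0`; the
term of `α` is a product of units. -/
theorem isUnit_betheNorm (hy : IsBetheRoot α y) : IsUnit (betheNorm (n + k) y) := by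
  rw [betheNorm_eq_sum, sum_bits, PowerSeries.isUnit_iff_constantCoeff, map_sum,
    Finset.sum_eq_single α]
  · exact ((isUnit_amplitude hy).mul (isUnit_creation hy)).map _
  · intro l _ hl
    obtain ⟨i, hi⟩ : ∃ i, l.place i ≠ α.place i := by
      by_contra! hcon
      exact hl (BoxedPartition.place_injective (funext hcon))
    rw [map_mul]
    rcases hi.lt_or_gt with hi | hi
    · rw [constantCoeff_creation_eq_zero hy hi, mul_zero]
    · rw [constantCoeff_amplitude_eq_zero hy hi, zero_mul]
  · intro h; exact absurd (Finset.mem_univ _) h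
  · intro b hb
    rw [amplitude_eq_zero_of_card _ _ hy.1
      (fun i => (isUnit_one_add_beta_mul_root hy i).ne_zero) hb, zero_mul]

end Pairing

/-! ### The spin basis of the weight space. -/

section SpinBasis

variable {n k : ℕ}

theorem weightSpace_apply_eq_zero {A : Type*} [CommRing A] {N n : ℕ} {v : QuantumSpace N A}
    (hv : v ∈ weightSpace A N n) {b : Fin N → Fin 2}
    (hb : (Finset.univ.filter fun j => b j = 1).card ≠ n) : v b = 0 := by
  induction hv using Submodule.span_induction with
  | mem x hx =>
    obtain ⟨b', hb', rfl⟩ := hx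
    rw [tensorVec, Pi.single_apply, if_neg]
    rintro rfl
    exact hb hb'
  | zero => rfl
  | add x y _ _ hx hy => rw [Pi.add_apply, hx, hy, add_zero]
  | smul a x _ hx => rw [Pi.smul_apply, hx, smul_zero]

theorem spinVec_apply_bits (A : Type*) [CommRing A] (l m : BoxedPartition n k) :
    (spinVec A l : QuantumSpace (n + k) A) m.bits = if l = m then 1 else 0 := by
  change (tensorVec l.bits : QuantumSpace (n + k) A) m.bits = _
  rw [tensorVec, Pi.single_apply]
  simp only [BoxedPartition.bits_injective.eq_iff, eq_comm]

theorem weightSpace_ext {A : Type*} [CommRing A] {v v' : weightSpace A (n + k) n}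
    (h : ∀ l : BoxedPartition n k, (v : QuantumSpace (n + k) A) l.bits = v'.1 l.bits) : v = v' := by
  refine Subtype.ext (funext fun b => ?_)
  by_cases hb : (Finset.univ.filter fun j => b j = 1).card = n
  · obtain ⟨l, rfl⟩ := exists_bits_eq_of_card hb
    exact h l
  · rw [weightSpace_apply_eq_zero v.2 hb, weightSpace_apply_eq_zero v'.2 hb]

theorem sum_spinVec_apply_bits {A : Type*} [CommRing A] (c : BoxedPartition n k → A)
    (m : BoxedPartition n k) :
    ((∑ l, c l • spinVec A l : weightSpace A (n + k) n) : QuantumSpace (n + k) A) m.bits = c m := by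
  rw [AddSubmonoidClass.coe_finsetSum, Finset.sum_apply]
  simp only [Submodule.coe_smul, Pi.smul_apply, spinVec_apply_bits, smul_eq_mul, mul_ite, mul_one,
    mul_zero]
  simp

/-- The basis of spin vectors; the coordinates of `v` are its values at the strings of the
partitions. -/
noncomputable def spinBasis (A : Type*) [CommRing A] (n k : ℕ) :
    Module.Basis (BoxedPartition n k) A (weightSpace A (n + k) n) :=
  Module.Basis.ofEquivFun
    { toFun := fun v l => (v : QuantumSpace (n + k) A) l.bits
      map_add' := fun _ _ => rfl
      map_smul' := fun _ _ => rfl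
      invFun := fun c => ∑ l, c l • spinVec A l
      left_inv := fun _ => weightSpace_ext fun m => sum_spinVec_apply_bits _ m
      right_inv := fun c => funext fun m => sum_spinVec_apply_bits c m }

theorem spinBasis_repr (A : Type*) [CommRing A] (v : weightSpace A (n + k) n)
    (l : BoxedPartition n k) :
    (spinBasis A n k).repr v l = (v : QuantumSpace (n + k) A) l.bits := rfl

theorem spinBasis_apply (A : Type*) [CommRing A] (l : BoxedPartition n k) :
    spinBasis A n k l = spinVec A l := by
  classical
  refine weightSpace_ext fun m => ?_
  rw [← spinBasis_repr, Module.Basis.repr_self, spinVec_apply_bits, Finsupp.single_apply]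

end SpinBasis

/-! ### Change of basis and diagonal structures. -/

section ChangeOfBasis

variable {ι A M : Type*} [CommRing A] [AddCommGroup M] [Module A M] [Fintype ι]

/-- A one-sided inverse of a square matrix over a commutative ring is two-sided, so orthogonality in
one order yields both the basis property and the expansion of the old basis. -/
theorem exists_basis_of_mul_eq_one [DecidableEq ι] (S : Module.Basis ι A M) {P Q : Matrix ι ι A} (h : P * Q = 1) :
    ∃ Y : Module.Basis ι A M, (∀ α, Y α = ∑ l, Q l α • S l) ∧ ∀ l, S l = ∑ α, P α l • Y α := by
  have h' : Q * P = 1 := mul_eq_one_comm.1 h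
  have hdet : IsUnit Q.det := (Matrix.isUnit_iff_isUnit_det Q).1 (IsUnit.of_mul_eq_one _ h')
  have hY : ∀ α, S.map (Matrix.toLinearEquiv S Q hdet) α = ∑ l, Q l α • S l := fun α => by
    rw [Module.Basis.map_apply, Matrix.toLinearEquiv_apply, Matrix.toLin_self]
  refine ⟨S.map (Matrix.toLinearEquiv S Q hdet), hY, fun l => ?_⟩
  simp only [hY, Finset.smul_sum, smul_smul]
  rw [Finset.sum_comm]
  simp only [← Finset.sum_smul]
  have h1 : ∀ j, ∑ i, P i l * Q j i = (1 : Matrix ι ι A) j l := fun j => by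
    rw [← h', Matrix.mul_apply]
    exact Finset.sum_congr rfl fun i _ => mul_comm _ _
  simp [h1, Matrix.one_apply]

theorem idempotentProduct_sum [DecidableEq ι] (Y : Module.Basis ι A M) (a b : ι → A) :
    idempotentProduct Y (∑ i, a i • Y i) (∑ i, b i • Y i) = ∑ i, (a i * b i) • Y i := by
  simp only [idempotentProduct, map_sum, map_smul, Module.Basis.constr_basis,
    LinearMap.sum_apply, LinearMap.smul_apply]
  simp only [smul_ite, smul_zero, smul_smul, Finset.sum_ite_eq',
    Finset.mem_univ, if_true]
  exact Finset.sum_congr rfl fun i _ => by rw [mul_comm]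

theorem diagonalForm_sum [DecidableEq ι] (Y : Module.Basis ι A M) (c a b : ι → A) :
    diagonalForm Y c (∑ i, a i • Y i) (∑ i, b i • Y i) = ∑ i, a i * b i * c i := by
  simp only [diagonalForm, map_sum, map_smul, Module.Basis.constr_basis,
    LinearMap.sum_apply, LinearMap.smul_apply]
  simp only [smul_eq_mul, mul_ite, mul_zero, Finset.sum_ite_eq',
    Finset.mem_univ, if_true]
  exact Finset.sum_congr rfl fun i _ => by ring

theorem diagonalOperator_sum (Y : Module.Basis ι A M) (g a : ι → A) :
    diagonalOperator Y g (∑ i, a i • Y i) = ∑ i, (g i * a i) • Y i := by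
  simp only [diagonalOperator, map_sum, map_smul, Module.Basis.constr_basis, smul_smul]
  exact Finset.sum_congr rfl fun i _ => by rw [mul_comm]

end ChangeOfBasis

/-! ### The basis of normalized Bethe vectors. -/

section BetheBasis

variable {n k : ℕ}

theorem sum_schubertValue_mul_creation [DecidableEq (BoxedPartition n k)]
    {y : BoxedPartition n k → Fin n → RTq (n + k)}
    (hy : ∀ α, IsBetheRoot α (y α)) (α α' : BoxedPartition n k) :
    ∑ l, schubertValue l (y α) * creation (beta (n + k)) (site n k) (y α') l.bits =
      if α = α' then betheNorm (n + k) (y α) else 0 := by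
  have h1 : ∑ l : BoxedPartition n k,
      schubertValue l (y α) * creation (beta (n + k)) (site n k) (y α') l.bits =
      ∑ b, amplitude (beta (n + k)) (site n k) (y α) b *
        creation (beta (n + k)) (site n k) (y α') b := by
    rw [sum_bits]
    · exact Finset.sum_congr rfl fun l _ => by
        rw [amplitude_eq_schubertValue l (hy α).1 (isUnit_one_add_beta_mul_root (hy α))]
    · intro b hb
      rw [amplitude_eq_zero_of_card _ _ (hy α).1
        (fun i => (isUnit_one_add_beta_mul_root (hy α) i).ne_zero) hb, zero_mul]
  rw [h1]
  split_ifs with h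
  · subst h; exact (betheNorm_eq_sum _).symm
  · exact sum_amplitude_mul_creation_of_ne h (hy α) (hy α')

/-- Orthogonality says that the matrix of Schubert values is inverse to the matrix of normalized
creation coefficients. Completeness of the Bethe vectors therefore needs no separate argument. -/
theorem exists_betheBasis {y : BoxedPartition n k → Fin n → RTq (n + k)}
    (hy : ∀ α, IsBetheRoot α (y α)) :
    ∃ Y : Module.Basis (BoxedPartition n k) (RTq (n + k)) (Vq n k),
      (∀ α, (Y α : QuantumSpace (n + k) (RTq (n + k))) =
        Ring.inverse (betheNorm (n + k) (y α)) •
          betheVector (beta (n + k)) (n + k) (tParam (n + k)) (y α)) ∧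
      ∀ l, schubertVec l = ∑ α, schubertValue l (y α) • Y α := by
  classical
  have hmul : (Matrix.of fun α l => schubertValue l (y α)) * (Matrix.of fun l α =>
      creation (beta (n + k)) (site n k) (y α) (BoxedPartition.bits l) *
        Ring.inverse (betheNorm (n + k) (y α))) = 1 := by
    ext α α'
    rw [Matrix.mul_apply]
    simp only [Matrix.of_apply, ← mul_assoc]
    rw [← Finset.sum_mul, sum_schubertValue_mul_creation hy, Matrix.one_apply]
    split_ifs with h
    · rw [← h, Ring.mul_inverse_cancel _ (isUnit_betheNorm (hy α))]
    · rw [zero_mul]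
  obtain ⟨Y, hY, hS⟩ := exists_basis_of_mul_eq_one (spinBasis (RTq (n + k)) n k) hmul
  simp only [spinBasis_apply, Matrix.of_apply] at hY hS
  refine ⟨Y, fun α => funext fun b => ?_, hS⟩
  rw [Pi.smul_apply, betheVector_eq_creation _ _ _ isUnit_one_add_beta_mul_tParam, smul_eq_mul]
  by_cases hb : (Finset.univ.filter fun j => b j = 1).card = n
  · obtain ⟨l, rfl⟩ := exists_bits_eq_of_card hb
    rw [hY, sum_spinVec_apply_bits, mul_comm]
  · rw [weightSpace_apply_eq_zero (Y α).2 hb, creation_eq_zero_of_card _ _ (hy α).1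
      (fun i => (isUnit_one_add_beta_mul_root (hy α) i).ne_zero) hb, mul_zero]

end BetheBasis

end BetheSchubert

/-! ### The residue formula. -/

open BetheSchubert
theorem mainTheorem4 (n k : ℕ) :
    (∀ α : BoxedPartition n k, ∃! y : Fin n → RTq (n + k), IsBetheRoot α y) ∧
    (∀ α : BoxedPartition n k, ∃! w : Fin k → RTq (n + k), IsComplementaryRoot α w) ∧
    ∀ (y : BoxedPartition n k → Fin n → RTq (n + k))
      (w : BoxedPartition n k → Fin k → RTq (n + k)),
      (∀ α, IsBetheRoot α (y α)) → (∀ α, IsComplementaryRoot α (w α)) →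
      (∀ α, IsUnit (betheNorm (n + k) (y α))) ∧
      ∃ Y : Module.Basis (BoxedPartition n k) (RTq (n + k)) (Vq n k),
        (∀ α, (Y α : QuantumSpace (n + k) (RTq (n + k))) =
          Ring.inverse (betheNorm (n + k) (y α)) •
            betheVector (beta (n + k)) (n + k) (tParam (n + k)) (y α)) ∧
        (∀ l m : BoxedPartition n k,
          idempotentProduct Y (schubertVec l) (schubertVec m) =
            schubertOperator Y y l (schubertVec m)) ∧
        (∀ l m : BoxedPartition n k,
          schubertOperator Y y l (schubertVec m) =
            ∑ ν : BoxedPartition n k,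
              spinElement (schubertOperator Y y l) ν m • (schubertVec ν : Vq n k)) ∧
        (∀ l m ν : BoxedPartition n k,
          spinElement (schubertOperator Y y l) ν m =
            ∑ α : BoxedPartition n k,
              quo (bigPi (beta (n + k)) (y α))
                  (bigPi (beta (n + k)) (specialize (tParam (n + k)) ν)) *
                quo (schubertValue l (y α) * schubertValue m (y α) * dualSchubertValue ν (w α))
                  (betheNorm (n + k) (y α))) ∧
        (∀ l m : BoxedPartition n k,
          diagonalForm Y (fun α => Ring.inverse (betheNorm (n + k) (y α)))
              (schubertVec l) (schubertVec m) =
            ∑ α : BoxedPartition n k,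
              quo (schubertValue l (y α) * schubertValue m (y α)) (betheNorm (n + k) (y α))) := by
  refine ⟨existsUnique_isBetheRoot, existsUnique_isComplementaryRoot, fun y w hy hw =>
    ⟨fun α => isUnit_betheNorm (hy α), ?_⟩⟩
  obtain ⟨Y, hY, hS⟩ := exists_betheBasis hy
  -- The coordinates of `v_m` in the basis `Y` are the values `G_m(y_α|⊖t)`, so the operator
  -- multiplies coordinates exactly as the product with `v_l` does.
  have hop : ∀ l m : BoxedPartition n k, schubertOperator Y y l (schubertVec m) =
      ∑ α, (schubertValue l (y α) * schubertValue m (y α)) • Y α := fun l m => by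
    rw [hS m, schubertOperator, diagonalOperator_sum]
  refine ⟨Y, hY, fun l m => ?_, fun l m => ?_, fun l m ν => ?_, fun l m => ?_⟩
  · rw [hop, hS l, hS m]
    exact idempotentProduct_sum Y _ _
  · refine weightSpace_ext fun ν => ?_
    exact (sum_spinVec_apply_bits
      (fun ν => spinElement (schubertOperator Y y l) ν m) ν).symm
  -- Reading off the coordinate at `ν` brings in the creation coefficient of `Y_α` at that string,
  -- which is where the complementary root enters.
  · rw [spinElement, hop, AddSubmonoidClass.coe_finsetSum, Finset.sum_apply]
    refine Finset.sum_congr rfl fun α _ => ?_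
    rw [Submodule.coe_smul, Pi.smul_apply, hY, Pi.smul_apply,
      betheVector_eq_creation _ _ _ isUnit_one_add_beta_mul_tParam]
    have h := creation_eq_dualSchubertValue (hy α) (hw α) ν
    simp only [smul_eq_mul, quo] at h ⊢
    rw [h]
    ring
  · rw [hS l, hS m]
    exact diagonalForm_sum Y _ _ _
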